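/- Let $k$ be an algebraically closed field and let $H$ be a Hopf $k$-algebra with comultiplication $\Delta$ and counit $\epsilon$. Let $\pi:H\to k$ be an algebra homomorphism, let $\Xi^l_\pi(a)=\sum\pi(a_1)a_2$ and $\Xi^r_\pi(a)=\sum a_1\pi(a_2)$ be the left and right winding automorphisms, put $G^l_\pi=\langle\Xi^l_\pi\rangle$ and $G^r_\pi=\langle\Xi^r_\pi\rangle$, let $H^l_0$ be the ring of invariants of $\Xi^l_\pi$, and let $H_0$ be the ring of common invariants of $\Xi^l_\pi$ and $\Xi^r_\pi$. Assume: (a) $H$ is affine, (two-sided) noetherian, prime and PI; (b) the order $n$ of $\pi$ in the group of characters of $H$ under convolution is equal to the PI-degree of $H$, i.e. to the least $m$ such that $H$ embeds as a ring in $M_m(C)$ for some commutative ring $C$; (c) $H^l_0$ is a (commutative) Dedekind domain; (d) if $\operatorname{char}k=p>0$ then $n$ is coprime to $p$; (e) $\operatorname{GKdim}H=\operatorname{gldim}H=1$; (f) $|G^l_\pi|>1$ and $G^l_\pi\cap G^r_\pi=\{1\}$. Let $H_{tw}=H/(\ker\epsilon\cap H_0)H$ (the twistor of $H$). For a primitive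 $n$th root of unity $\xi\in k$ let $H(n,1,\xi)$ be the Taft Hopf algebra generated by $g,x$ with relations $g^n=1$, $xg=\xi gx$ and with $\Delta(g)=g\otimes g$, $\Delta(x)=x\otimes g+1\otimes x$, $\epsilon(g)=1$, $\epsilon(x)=0$; its twistor $H(n,1,\xi)_{tw}$ is formed in the same way with respect to its character $g\mapsto\xi^{-1}$, $x\mapsto 0$. Then $(\ker\epsilon\cap H_0)H$ is a (two-sided) Hopf ideal of $H$, so that $H_{tw}$ is a Hopf algebra, and there is a primitive $n$th root of unity $\xi\in k$ such that $H(n,1,\xi)_{tw}$ is also a Hopf algebra quotient of $H(n,1,\xi)$ and $H_{tw}\cong H(n,1,\xi)_{tw}$ as Hopf algebras. Writing $g$ and $y$ for the images of $g$ and $x$, one has, as an algebra, $$H(n,1,\xi)_{tw}=k\langle g,y\rangle/(y^n,\ g^n-1,\ yg-\xi gy),$$ with $g$ group-like and $\Delta(y)=y\otimes g+1\otimes y$. Moreover there is a primitive $n$th root of unity $\zeta\in k$ such that, with $H_{ij}=\{a\in H:\Xi^l_\pi(a)=\zeta^i a,\ \Xi^r_\pi(a)=\zeta^j a\}$ for $0\le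 i,j\le n-1$, one can choose elements $u_{ij}\in H_{ij}$ that generate $H_{ij}$ freely as an $H_0$-module, with $u_{00}=1$ and $\epsilon(u_{ij})=\delta_{ij}$, whose images $v_{ij}$ in $H_{tw}$ form a $k$-basis of $H_{tw}$ and correspond under the isomorphism to $$v_{ij}=\begin{cases} g^iy^{j-i}, & i\le j,\\ g^iy^{n+j-i}, & i>j.\end{cases}$$ -/

import Mathlib

open TensorProduct

universe u v

noncomputable section

namespace TwistorPaper

/-! ### Characters of a Hopf algebra and winding automorphisms -/

section Winding

variable {k : Type v} {H : Type u} [Field k] [Ring H] [HopfAlgebra k H]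

/-- The left winding endomorphism `a ↦ ∑ π(a₁) a₂`. -/
def lWindHom (π : H →ₐ[k] k) : H →ₐ[k] H :=
  (Algebra.TensorProduct.lid k H).toAlgHom.comp
    ((Algebra.TensorProduct.map π (AlgHom.id k H)).comp (Bialgebra.comulAlgHom k H))

/-- The right winding endomorphism `a ↦ ∑ a₁ π(a₂)`. -/
def rWindHom (π : H →ₐ[k] k) : H →ₐ[k] H :=
  (Algebra.TensorProduct.rid k k H).toAlgHom.comp
    ((Algebra.TensorProduct.map (AlgHom.id k H) π).comp (Bialgebra.comulAlgHom k H))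

/-- The convolution inverse `π ∘ S` of a character `π`. -/
def charInv (π : H →ₐ[k] k) : H →ₐ[k] k :=
  AlgHom.ofLinearMap (π.toLinearMap ∘ₗ HopfAlgebra.antipode k)
    (by simp)
    (fun a b => by simp [HopfAlgebra.antipode_mul_antidistrib, mul_comm])

theorem lWindHom_apply {ι : Type*} (π : H →ₐ[k] k) {a : H} (r : Coalgebra.Repr k a ι) :
    lWindHom π a = ∑ i ∈ r.index, π (r.left i) • r.right i := by
  simp [lWindHom, ← r.eq]

theorem rWindHom_apply {ι : Type*} (π : H →ₐ[k] k) {a : H} (r : Coalgebra.Repr k a ι) :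
    rWindHom π a = ∑ i ∈ r.index, π (r.right i) • r.left i := by
  simp [rWindHom, ← r.eq]

theorem lWindHom_comp (π ρ : H →ₐ[k] k) :
    (lWindHom π).comp (lWindHom ρ) =
      lWindHom (WithConv.toConv ρ * WithConv.toConv π : WithConv (H →ₐ[k] k)).ofConv := by
  let F : H ⊗[k] (H ⊗[k] H) →ₗ[k] H :=
    (TensorProduct.lid k H).toLinearMap ∘ₗ TensorProduct.map ρ.toLinearMap
      ((TensorProduct.lid k H).toLinearMap ∘ₗ TensorProduct.map π.toLinearMap LinearMap.id)
  have h1 : (lWindHom π).toLinearMap ∘ₗ (TensorProduct.lid k H).toLinearMap ∘ₗ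
      TensorProduct.map ρ.toLinearMap LinearMap.id =
      F ∘ₗ (Coalgebra.comul (R := k) (A := H)).lTensor H := by
    ext x y
    simp [F, lWindHom]
    rfl
  have h2 : (TensorProduct.lid k H).toLinearMap ∘ₗ TensorProduct.map
      (WithConv.toConv ρ * WithConv.toConv π : WithConv (H →ₐ[k] k)).ofConv.toLinearMap
        LinearMap.id =
      F ∘ₗ (TensorProduct.assoc k H H H).toLinearMap ∘ₗ
        (Coalgebra.comul (R := k) (A := H)).rTensor H := by
    have h3 : ∀ (z : H) (t : H ⊗[k] H),
        (LinearMap.mul' k k (TensorProduct.map ρ.toLinearMap π.toLinearMap t)) • z =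
          F (TensorProduct.assoc k H H H (t ⊗ₜ z)) := by
      intro z t
      induction t with
      | zero => simp
      | tmul x y => simp [F, smul_smul, mul_comm]
      | add x y hx hy => simp only [map_add, add_smul, TensorProduct.add_tmul, hx, hy]
    ext x z
    exact h3 z (Coalgebra.comul x)
  ext a
  have e1 := LinearMap.congr_fun h1 (Coalgebra.comul a)
  have e2 := LinearMap.congr_fun h2 (Coalgebra.comul a)
  have e3 := Coalgebra.coassoc_apply (R := k) a
  simp only [LinearMap.comp_apply, LinearEquiv.coe_coe] at e1 e2
  rw [e3, ← e1] at e2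
  exact e2.symm

theorem rWindHom_comp (π ρ : H →ₐ[k] k) :
    (rWindHom π).comp (rWindHom ρ) =
      rWindHom (WithConv.toConv π * WithConv.toConv ρ : WithConv (H →ₐ[k] k)).ofConv := by
  let F : H ⊗[k] (H ⊗[k] H) →ₗ[k] H :=
    (TensorProduct.rid k H).toLinearMap ∘ₗ TensorProduct.map LinearMap.id
      (LinearMap.mul' k k ∘ₗ TensorProduct.map π.toLinearMap ρ.toLinearMap)
  have h1 : (rWindHom π).toLinearMap ∘ₗ (TensorProduct.rid k H).toLinearMap ∘ₗ
      TensorProduct.map LinearMap.id ρ.toLinearMap =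
      F ∘ₗ (TensorProduct.assoc k H H H).toLinearMap ∘ₗ
        (Coalgebra.comul (R := k) (A := H)).rTensor H := by
    have h3 : ∀ (z : H) (t : H ⊗[k] H),
        ρ z • (TensorProduct.rid k H (TensorProduct.map LinearMap.id π.toLinearMap t)) =
          F (TensorProduct.assoc k H H H (t ⊗ₜ z)) := by
      intro z t
      induction t with
      | zero => simp
      | tmul x y => simp [F, smul_smul, mul_comm]
      | add x y hx hy => simp only [map_add, smul_add, TensorProduct.add_tmul, hx, hy]
    ext x z
    simp only [TensorProduct.AlgebraTensorModule.curry_apply, LinearMap.restrictScalars_self,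
      TensorProduct.curry_apply, LinearMap.comp_apply, TensorProduct.map_tmul,
      LinearEquiv.coe_coe, TensorProduct.rid_tmul, LinearMap.id_apply, map_smul]
    exact h3 z (Coalgebra.comul x)
  have h2 : (TensorProduct.rid k H).toLinearMap ∘ₗ TensorProduct.map LinearMap.id
      (WithConv.toConv π * WithConv.toConv ρ : WithConv (H →ₐ[k] k)).ofConv.toLinearMap =
      F ∘ₗ (Coalgebra.comul (R := k) (A := H)).lTensor H := by
    ext x y
    simp [F, AlgHom.convMul_def]
    rfl
  ext a
  have e1 := LinearMap.congr_fun h1 (Coalgebra.comul a)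
  have e2 := LinearMap.congr_fun h2 (Coalgebra.comul a)
  have e3 := Coalgebra.coassoc_apply (R := k) a
  simp only [LinearMap.comp_apply, LinearEquiv.coe_coe] at e1 e2
  rw [e3, ← e2] at e1
  exact e1

theorem lWindHom_one :
    lWindHom (1 : WithConv (H →ₐ[k] k)).ofConv = AlgHom.id k H := by
  ext a
  have h := congrArg (TensorProduct.lid k H) (Coalgebra.rTensor_counit_comul (R := k) a)
  exact h.trans (by simp)

theorem rWindHom_one :
    rWindHom (1 : WithConv (H →ₐ[k] k)).ofConv = AlgHom.id k H := by
  ext a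
  have h := congrArg (TensorProduct.rid k H) (Coalgebra.lTensor_counit_comul (R := k) a)
  exact h.trans (by simp)

theorem charInv_apply (π : H →ₐ[k] k) (a : H) :
    charInv π a = π (HopfAlgebra.antipode k a) := rfl

theorem charInv_mul (π : H →ₐ[k] k) :
    (WithConv.toConv (charInv π) * WithConv.toConv π : WithConv (H →ₐ[k] k)) = 1 := by
  apply WithConv.ofConv_injective
  ext a
  have h := congrArg π (HopfAlgebra.mul_antipode_rTensor_comul_apply (R := k) a)
  rw [AlgHom.commutes] at h
  refine Eq.trans ?_ h
  have h3 : ∀ t : H ⊗[k] H,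
      LinearMap.mul' k k (TensorProduct.map (charInv π).toLinearMap π.toLinearMap t) =
        π (LinearMap.mul' k H ((HopfAlgebra.antipode k).rTensor H t)) := by
    intro t
    induction t with
    | zero => simp
    | tmul x y => simp [charInv_apply]
    | add x y hx hy => simp only [map_add, hx, hy]
  exact h3 _

theorem mul_charInv (π : H →ₐ[k] k) :
    (WithConv.toConv π * WithConv.toConv (charInv π) : WithConv (H →ₐ[k] k)) = 1 := by
  apply WithConv.ofConv_injective
  ext a
  have h := congrArg π (HopfAlgebra.mul_antipode_lTensor_comul_apply (R := k) a)
  rw [AlgHom.commutes] at h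
  refine Eq.trans ?_ h
  have h3 : ∀ t : H ⊗[k] H,
      LinearMap.mul' k k (TensorProduct.map π.toLinearMap (charInv π).toLinearMap t) =
        π (LinearMap.mul' k H ((HopfAlgebra.antipode k).lTensor H t)) := by
    intro t
    induction t with
    | zero => simp
    | tmul x y => simp [charInv_apply]
    | add x y hx hy => simp only [map_add, hx, hy]
  exact h3 _

/-- The left winding automorphism `Ξˡ_π : a ↦ ∑ π(a₁) a₂`. -/
def lWind (π : H →ₐ[k] k) : H ≃ₐ[k] H :=
  AlgEquiv.ofAlgHom (lWindHom π) (lWindHom (charInv π))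
    (by rw [lWindHom_comp, charInv_mul, lWindHom_one])
    (by rw [lWindHom_comp, mul_charInv, lWindHom_one])

/-- The right winding automorphism `Ξʳ_π : a ↦ ∑ a₁ π(a₂)`. -/
def rWind (π : H →ₐ[k] k) : H ≃ₐ[k] H :=
  AlgEquiv.ofAlgHom (rWindHom π) (rWindHom (charInv π))
    (by rw [rWindHom_comp, mul_charInv, rWindHom_one])
    (by rw [rWindHom_comp, charInv_mul, rWindHom_one])

/-- The group `Gˡ_π` generated by the left winding automorphism of `π`. -/
def lWindGroup (π : H →ₐ[k] k) : Subgroup (H ≃ₐ[k] H) := Subgroup.zpowers (lWind π)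

/-- The group `Gʳ_π` generated by the right winding automorphism of `π`. -/
def rWindGroup (π : H →ₐ[k] k) : Subgroup (H ≃ₐ[k] H) := Subgroup.zpowers (rWind π)

/-- The invariants `Hˡ₀` of the left winding automorphism. -/
def leftComponent (π : H →ₐ[k] k) : Subalgebra k H :=
  AlgHom.equalizer (lWind π : H →ₐ[k] H) (AlgHom.id k H)

/-- The invariants `Hʳ₀` of the right winding automorphism. -/
def rightComponent (π : H →ₐ[k] k) : Subalgebra k H :=
  AlgHom.equalizer (rWind π : H →ₐ[k] H) (AlgHom.id k H)

/-- The classical component `H₀ = Hˡ₀ ∩ Hʳ₀`: the common invariants of both winding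
automorphisms. -/
def classicalComponent (π : H →ₐ[k] k) : Subalgebra k H := leftComponent π ⊓ rightComponent π

/-- The bigraded piece `H_ij`: the common eigenspace of `Ξˡ_π` for `ζ ^ i` and of `Ξʳ_π`
for `ζ ^ j`. -/
def bigradedPiece (π : H →ₐ[k] k) (ζ : k) (i j : ℕ) : Submodule k H :=
  Module.End.eigenspace (lWind π : H →ₐ[k] H).toLinearMap (ζ ^ i) ⊓
    Module.End.eigenspace (rWind π : H →ₐ[k] H).toLinearMap (ζ ^ j)

/-- The augmentation ideal `ker ε ∩ H₀` of the classical component. -/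
def classicalAugmentation (π : H →ₐ[k] k) : Submodule k H :=
  LinearMap.ker (Coalgebra.counit (R := k) (A := H)) ⊓
    Subalgebra.toSubmodule (classicalComponent π)

/-- The two-sided ideal of `H` generated by `ker ε ∩ H₀`. -/
def twistorIdeal (π : H →ₐ[k] k) : Ideal H :=
  Ideal.span {x | ∃ c ∈ classicalAugmentation π, ∃ b : H, x = c * b}

instance twistorIdeal_isTwoSided (π : H →ₐ[k] k) : (twistorIdeal π).IsTwoSided := by
  refine ⟨fun {a} b ha => ?_⟩
  refine Submodule.span_induction (p := fun x _ => x * b ∈ twistorIdeal π)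
    ?_ ?_ ?_ ?_ ha
  · rintro x ⟨c, hc, d, rfl⟩
    exact Ideal.subset_span ⟨c, hc, d * b, mul_assoc _ _ _⟩
  · simp
  · intro x y _ _ hx hy
    rw [add_mul]
    exact add_mem hx hy
  · intro r x _ hx
    rw [smul_eq_mul, mul_assoc]
    exact Ideal.mul_mem_left _ _ hx

/-- The twistor of `(H, π)`: the quotient of `H` by the ideal generated by `ker ε ∩ H₀`.
It is a Hopf algebra as soon as that ideal is a Hopf ideal. -/
abbrev Twistor (π : H →ₐ[k] k) : Type u := H ⧸ twistorIdeal π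

end Winding

/-! ### The standing hypotheses -/

/-- A (possibly noncommutative) ring is prime if it is nonzero and `a R b = 0` forces
`a = 0` or `b = 0`. -/
def IsPrimeRing (R : Type u) [Ring R] : Prop :=
  Nontrivial R ∧ ∀ a b : R, (∀ r : R, a * r * b = 0) → a = 0 ∨ b = 0

/-- An algebra over a field satisfies a polynomial identity. -/
def IsPI (k : Type v) (R : Type u) [Field k] [Ring R] [Algebra k R] : Prop :=
  ∃ f : FreeAlgebra k ℕ, f ≠ 0 ∧ ∀ s : ℕ → R, FreeAlgebra.lift k s f = 0

/-- `n` is the PI-degree of `R`: the least `m` such that `R` embeds in the `m × m` matrices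
over some commutative ring. -/
def HasPIDegree (R : Type u) [Ring R] (n : ℕ) : Prop :=
  IsLeast {m : ℕ | ∃ (C : Type u) (_ : CommRing C) (f : R →+* Matrix (Fin m) (Fin m) C),
    Function.Injective f} n

/-- The Gelfand-Kirillov dimension: the supremum, over the finite-dimensional subspaces `V`
containing `1`, of `limsup log (dim V ^ n) / log n`. -/
def gkDim (k : Type v) (R : Type u) [Field k] [Ring R] [Algebra k R] : EReal :=
  ⨆ V : {V : Submodule k R // V.FG ∧ (1 : R) ∈ V},
    Filter.limsup
      (fun n : ℕ => ((Real.log (Module.finrank k (V.1 ^ n : Submodule k R)) / Real.log n : ℝ)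
        : EReal)) Filter.atTop

/-- The (left) global dimension: the supremum of the projective dimensions of all left
modules. -/
def glDim (R : Type u) [Ring R] : WithBot ℕ∞ :=
  ⨆ M : ModuleCat.{u} R, CategoryTheory.projectiveDimension M

/-- A (possibly noncommutative) ring is a Dedekind domain if it is commutative and a Dedekind
domain in the usual sense; here this is expressed through a commutative model. -/
def IsDedekind (R : Type u) [Ring R] : Prop :=
  ∃ (D : Type u) (_ : CommRing D), IsDedekindDomain D ∧ Nonempty (D ≃+* R)

/-- The standing hypotheses on a Hopf algebra `H` together with a character `π` of order `n`
(the order being taken in the convolution group of characters of `H`). -/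
structure StandingHypotheses {k : Type v} {H : Type u} [Field k] [Ring H] [HopfAlgebra k H]
    (π : H →ₐ[k] k) (n : ℕ) : Prop where
  affine : Algebra.FiniteType k H
  left_noetherian : IsNoetherianRing H
  right_noetherian : IsNoetherianRing Hᵐᵒᵖ
  prime : IsPrimeRing H
  pi : IsPI k H
  order : orderOf (WithConv.toConv π : WithConv (H →ₐ[k] k)) = n
  piDegree : HasPIDegree H n
  dedekind : IsDedekind (leftComponent π)
  coprime_char : ∀ p : ℕ, CharP k p → 0 < p → n.Coprime p
  gkDim_eq : gkDim k H = 1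
  glDim_eq : glDim H = 1

/-! ### The infinite-dimensional Taft algebra `H(n, 1, ξ)` -/

/-- The two generators `g` and `x`. -/
inductive Gen : Type
  | g : Gen
  | x : Gen

section Taft

variable (k : Type v) [Field k] (n : ℕ) (ξ : k)

/-- The defining relations `g ^ n = 1` and `x g = ξ g x`. -/
inductive TaftRel : FreeAlgebra k Gen → FreeAlgebra k Gen → Prop
  | g_pow : TaftRel (FreeAlgebra.ι k Gen.g ^ n) 1
  | comm : TaftRel (FreeAlgebra.ι k Gen.x * FreeAlgebra.ι k Gen.g)
      (ξ • (FreeAlgebra.ι k Gen.g * FreeAlgebra.ι k Gen.x))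

/-- The algebra `H(n, 1, ξ) = k⟨g, x⟩ / (g ^ n - 1, x g - ξ g x)`. -/
def Taft : Type v := RingQuot (TaftRel k n ξ)

instance : Ring (Taft k n ξ) := inferInstanceAs (Ring (RingQuot (TaftRel k n ξ)))

instance : Algebra k (Taft k n ξ) := inferInstanceAs (Algebra k (RingQuot (TaftRel k n ξ)))

/-- The images of the generators in `H(n, 1, ξ)`. -/
def Taft.gen (a : Gen) : Taft k n ξ := RingQuot.mkAlgHom k (TaftRel k n ξ) (FreeAlgebra.ι k a)

variable {k n ξ}

namespace Taft

theorem g_pow : gen k n ξ Gen.g ^ n = 1 := by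
  have h := RingQuot.mkAlgHom_rel k (TaftRel.g_pow (k := k) (n := n) (ξ := ξ))
  rwa [map_pow, map_one] at h

theorem x_mul_g : gen k n ξ Gen.x * gen k n ξ Gen.g =
    ξ • (gen k n ξ Gen.g * gen k n ξ Gen.x) := by
  have h := RingQuot.mkAlgHom_rel k (TaftRel.comm (k := k) (n := n) (ξ := ξ))
  rwa [map_mul, map_smul, map_mul] at h

/-- The universal property of `H(n, 1, ξ)`. -/
def lift {B : Type*} [Ring B] [Algebra k B] (b : Gen → B) (hg : b Gen.g ^ n = 1)
    (hx : b Gen.x * b Gen.g = ξ • (b Gen.g * b Gen.x)) : Taft k n ξ →ₐ[k] B :=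
  RingQuot.liftAlgHom k ⟨FreeAlgebra.lift k b, by
    rintro _ _ (_ | _)
    · simpa using hg
    · simpa using hx⟩

@[simp]
theorem lift_gen {B : Type*} [Ring B] [Algebra k B] (b : Gen → B) (hg : b Gen.g ^ n = 1)
    (hx : b Gen.x * b Gen.g = ξ • (b Gen.g * b Gen.x)) (a : Gen) :
    lift (n := n) (ξ := ξ) b hg hx (gen k n ξ a) = b a := by
  unfold lift gen
  erw [RingQuot.liftAlgHom_mkAlgHom_apply]
  simp

theorem algHom_ext {B : Type*} [Ring B] [Algebra k B] {f h : Taft k n ξ →ₐ[k] B}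
    (hfh : ∀ a, f (gen k n ξ a) = h (gen k n ξ a)) : f = h := by
  refine RingQuot.ringQuot_ext' k f h (FreeAlgebra.hom_ext (funext fun a => ?_))
  exact hfh a

/-- The comultiplication `Δ(g) = g ⊗ g`, `Δ(x) = x ⊗ g + 1 ⊗ x` on generators. -/
def comulGen : Gen → Taft k n ξ ⊗[k] Taft k n ξ
  | Gen.g => gen k n ξ Gen.g ⊗ₜ gen k n ξ Gen.g
  | Gen.x => gen k n ξ Gen.x ⊗ₜ gen k n ξ Gen.g + 1 ⊗ₜ gen k n ξ Gen.x

/-- The counit `ε(g) = 1`, `ε(x) = 0` on generators. -/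
def counitGen : Gen → k
  | Gen.g => 1
  | Gen.x => 0

/-- The antipode `S(g) = g⁻¹ = g ^ (n - 1)`, `S(x) = - x g⁻¹` on generators. -/
def antipodeGen : Gen → (Taft k n ξ)ᵐᵒᵖ
  | Gen.g => MulOpposite.op (gen k n ξ Gen.g ^ (n - 1))
  | Gen.x => MulOpposite.op (-(gen k n ξ Gen.x * gen k n ξ Gen.g ^ (n - 1)))

/-- The comultiplication as an algebra map. -/
def comulHom : Taft k n ξ →ₐ[k] Taft k n ξ ⊗[k] Taft k n ξ :=
  lift comulGen
    (by simp [comulGen, g_pow, Algebra.TensorProduct.one_def])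
    (by simp [comulGen, add_mul, mul_add, x_mul_g, TensorProduct.smul_tmul', smul_add])

/-- The counit as an algebra map. -/
def counitHom : Taft k n ξ →ₐ[k] k :=
  lift counitGen (by simp [counitGen]) (by simp [counitGen])

instance : Bialgebra k (Taft k n ξ) :=
  Bialgebra.ofAlgHom comulHom counitHom
    (algHom_ext (by
      rintro (_ | _) <;>
      simp [comulHom, comulGen, TensorProduct.add_tmul, TensorProduct.tmul_add, add_assoc,
        Algebra.TensorProduct.one_def]))
    (algHom_ext (by
      rintro (_ | _) <;>
      simp [comulHom, comulGen, counitHom, counitGen]))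
    (algHom_ext (by
      rintro (_ | _) <;>
      simp [comulHom, comulGen, counitHom, counitGen]))

theorem induction {C : Taft k n ξ → Prop} (hc : ∀ r : k, C (algebraMap k _ r))
    (hgen : ∀ a, C (gen k n ξ a)) (hmul : ∀ a b, C a → C b → C (a * b))
    (hadd : ∀ a b, C a → C b → C (a + b)) (a : Taft k n ξ) : C a := by
  obtain ⟨f, rfl⟩ := RingQuot.mkAlgHom_surjective k (TaftRel k n ξ) a
  induction f using FreeAlgebra.induction with
  | grade0 r => rw [AlgHom.commutes]; exact hc r
  | grade1 a => exact hgen a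
  | mul a b ha hb => rw [map_mul]; exact hmul _ _ ha hb
  | add a b ha hb => rw [map_add]; exact hadd _ _ ha hb

theorem comul_gen (a : Gen) :
    Coalgebra.comul (R := k) (gen k n ξ a) = comulGen a := by
  change comulHom (gen k n ξ a) = comulGen a
  simp [comulHom]

theorem counit_gen (a : Gen) :
    Coalgebra.counit (R := k) (gen k n ξ a) = counitGen (k := k) a := by
  change counitHom (gen k n ξ a) = counitGen a
  simp [counitHom]

variable [NeZero n]

theorem g_mul_inv : gen k n ξ Gen.g * gen k n ξ Gen.g ^ (n - 1) = 1 := by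
  rw [← pow_succ', Nat.sub_add_cancel (NeZero.one_le), g_pow]

theorem inv_mul_g : gen k n ξ Gen.g ^ (n - 1) * gen k n ξ Gen.g = 1 := by
  rw [← pow_succ, Nat.sub_add_cancel (NeZero.one_le), g_pow]

theorem inv_mul_x : gen k n ξ Gen.g ^ (n - 1) * gen k n ξ Gen.x =
    ξ • (gen k n ξ Gen.x * gen k n ξ Gen.g ^ (n - 1)) := by
  calc gen k n ξ Gen.g ^ (n - 1) * gen k n ξ Gen.x
      = gen k n ξ Gen.g ^ (n - 1) * (gen k n ξ Gen.x * gen k n ξ Gen.g)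
          * gen k n ξ Gen.g ^ (n - 1) := by
        rw [mul_assoc, mul_assoc, g_mul_inv, mul_one]
    _ = ξ • (gen k n ξ Gen.x * gen k n ξ Gen.g ^ (n - 1)) := by
        rw [x_mul_g, mul_smul_comm, smul_mul_assoc, ← mul_assoc, inv_mul_g, one_mul]

/-- The antipode as an algebra map to the opposite algebra. -/
def antipodeHom : Taft k n ξ →ₐ[k] (Taft k n ξ)ᵐᵒᵖ :=
  lift antipodeGen
    (by
      rw [antipodeGen, ← MulOpposite.op_pow, ← pow_mul, mul_comm, pow_mul, g_pow, one_pow,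
        MulOpposite.op_one])
    (by
      simp only [antipodeGen, ← MulOpposite.op_mul, ← MulOpposite.op_smul]
      rw [mul_neg, ← mul_assoc, inv_mul_x, neg_mul, smul_neg, smul_mul_assoc])

/-- The antipode as a linear map. -/
def antipodeLin : Taft k n ξ →ₗ[k] Taft k n ξ :=
  (MulOpposite.opLinearEquiv k).symm.toLinearMap ∘ₗ antipodeHom.toLinearMap

theorem antipodeLin_mul (a b : Taft k n ξ) :
    antipodeLin (a * b) = antipodeLin b * antipodeLin a := by
  simp [antipodeLin]

theorem antipodeLin_algebraMap (r : k) :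
    antipodeLin (algebraMap k (Taft k n ξ) r) = algebraMap k (Taft k n ξ) r := by
  simp [antipodeLin]

theorem antipodeLin_gen (a : Gen) :
    antipodeLin (gen k n ξ a) = (antipodeGen a).unop := by
  simp [antipodeLin, antipodeHom]

theorem mul_antipode_left (a : Taft k n ξ) :
    LinearMap.mul' k _ (TensorProduct.map antipodeLin LinearMap.id (Coalgebra.comul a)) =
      algebraMap k _ (Coalgebra.counit (R := k) a) := by
  induction a using induction with
  | hc r => simp [antipodeLin_algebraMap, Algebra.TensorProduct.algebraMap_apply]
  | hgen a =>
    rw [comul_gen, counit_gen]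
    cases a
    · simp [comulGen, counitGen, antipodeLin_gen, antipodeGen, inv_mul_g]
    · have h1 : antipodeLin (1 : Taft k n ξ) = 1 := by
        simpa using antipodeLin_algebraMap (k := k) (n := n) (ξ := ξ) 1
      simp [comulGen, counitGen, antipodeLin_gen, antipodeGen, mul_assoc, inv_mul_g, h1]
  | hmul a b ha hb =>
    have key : ∀ s t : Taft k n ξ ⊗[k] Taft k n ξ, ∀ c : k,
        LinearMap.mul' k _ (TensorProduct.map antipodeLin LinearMap.id s) = algebraMap k _ c →
        LinearMap.mul' k _ (TensorProduct.map antipodeLin LinearMap.id (s * t)) =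
          c • LinearMap.mul' k _ (TensorProduct.map antipodeLin LinearMap.id t) := by
      intro s t c hs
      induction t with
      | zero => simp
      | add t t' ht ht' => simp only [mul_add, map_add, smul_add, ht, ht']
      | tmul x y =>
        have h : ∀ s : Taft k n ξ ⊗[k] Taft k n ξ,
            LinearMap.mul' k _ (TensorProduct.map antipodeLin LinearMap.id (s * x ⊗ₜ y)) =
            antipodeLin x *
              LinearMap.mul' k _ (TensorProduct.map antipodeLin LinearMap.id s) * y := by
          intro s
          induction s with
          | zero => simp
          | add s s' h h' => simp only [add_mul, map_add, mul_add, h, h']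
          | tmul u v => simp [antipodeLin_mul, mul_assoc]
        rw [h, hs]
        simp [Algebra.algebraMap_eq_smul_one]
    rw [Bialgebra.comul_mul, key _ _ _ ha, hb, Bialgebra.counit_mul, map_mul,
      Algebra.smul_def]
  | hadd a b ha hb => simp only [map_add, ha, hb]

theorem mul_antipode_right (a : Taft k n ξ) :
    LinearMap.mul' k _ (TensorProduct.map LinearMap.id antipodeLin (Coalgebra.comul a)) =
      algebraMap k _ (Coalgebra.counit (R := k) a) := by
  induction a using induction with
  | hc r =>
    have h1 : antipodeLin (1 : Taft k n ξ) = 1 := by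
      simpa using antipodeLin_algebraMap (k := k) (n := n) (ξ := ξ) 1
    simp [h1, Algebra.TensorProduct.algebraMap_apply]
  | hgen a =>
    rw [comul_gen, counit_gen]
    cases a
    · simp [comulGen, counitGen, antipodeLin_gen, antipodeGen, g_mul_inv]
    · simp [comulGen, counitGen, antipodeLin_gen, antipodeGen]
  | hmul a b ha hb =>
    have key : ∀ s t : Taft k n ξ ⊗[k] Taft k n ξ, ∀ c : k,
        LinearMap.mul' k _ (TensorProduct.map LinearMap.id antipodeLin t) = algebraMap k _ c →
        LinearMap.mul' k _ (TensorProduct.map LinearMap.id antipodeLin (s * t)) =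
          c • LinearMap.mul' k _ (TensorProduct.map LinearMap.id antipodeLin s) := by
      intro s t c ht
      induction s with
      | zero => simp
      | add t t' ht ht' => simp only [add_mul, map_add, smul_add, ht, ht']
      | tmul x y =>
        have h : ∀ t : Taft k n ξ ⊗[k] Taft k n ξ,
            LinearMap.mul' k _ (TensorProduct.map LinearMap.id antipodeLin (x ⊗ₜ y * t)) =
            x * LinearMap.mul' k _ (TensorProduct.map LinearMap.id antipodeLin t) *
              antipodeLin y := by
          intro t
          induction t with
          | zero => simp
          | add s s' h h' => simp only [add_mul, map_add, mul_add, h, h']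
          | tmul u v => simp [antipodeLin_mul, mul_assoc]
        rw [h, ht]
        simp [Algebra.algebraMap_eq_smul_one]
    rw [Bialgebra.comul_mul, key _ _ _ hb, ha, Bialgebra.counit_mul, mul_comm, map_mul,
      Algebra.smul_def]
  | hadd a b ha hb => simp only [map_add, ha, hb]

instance : HopfAlgebra k (Taft k n ξ) where
  antipode := antipodeLin
  mul_antipode_rTensor_comul := LinearMap.ext mul_antipode_left
  mul_antipode_lTensor_comul := LinearMap.ext mul_antipode_right

/-- The character `g ↦ ξ⁻¹`, `x ↦ 0` of `H(n, 1, ξ)` on generators. -/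
def charGen (ξ : k) : Gen → k
  | Gen.g => ξ⁻¹
  | Gen.x => 0

end Taft

/-- The character `π` of `H(n, 1, ξ)` given by its homological integral: `g ↦ ξ⁻¹`, `x ↦ 0`. -/
def taftChar (n : ℕ) {ξ : k} (hξ : IsPrimitiveRoot ξ n) : Taft k n ξ →ₐ[k] k :=
  Taft.lift (Taft.charGen ξ) (by simp [Taft.charGen, hξ.pow_eq_one])
    (by simp [Taft.charGen])

variable (k n ξ)

/-- The relations `g ^ n = 1`, `y ^ n = 0`, `y g = ξ g y`; the generator called `Gen.x` here
plays the role of `y`. -/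
inductive SmallTaftRel : FreeAlgebra k Gen → FreeAlgebra k Gen → Prop
  | g_pow : SmallTaftRel (FreeAlgebra.ι k Gen.g ^ n) 1
  | y_pow : SmallTaftRel (FreeAlgebra.ι k Gen.x ^ n) 0
  | comm : SmallTaftRel (FreeAlgebra.ι k Gen.x * FreeAlgebra.ι k Gen.g)
      (ξ • (FreeAlgebra.ι k Gen.g * FreeAlgebra.ι k Gen.x))

/-- The algebra `k⟨g, y⟩ / (y ^ n, g ^ n - 1, y g - ξ g y)`. -/
abbrev SmallTaft : Type v := RingQuot (SmallTaftRel k n ξ)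

/-- The images of the generators in `k⟨g, y⟩ / (y ^ n, g ^ n - 1, y g - ξ g y)`. -/
def SmallTaft.gen (a : Gen) : SmallTaft k n ξ :=
  RingQuot.mkAlgHom k (SmallTaftRel k n ξ) (FreeAlgebra.ι k a)

end Taft

/-- `u` is an admissible choice of generators of the bigraded pieces: `u i j` freely generates
`H_ij` as a module over `H₀`, `u 0 0 = 1`, and `ε (u i j) = δ_ij`. -/
structure IsBigradedGenerators {k : Type v} {H : Type u} [Field k] [Ring H] [HopfAlgebra k H]
    (π : H →ₐ[k] k) (ζ : k) {n : ℕ} [NeZero n] (u : Fin n → Fin n → H) : Prop where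
  mem : ∀ i j : Fin n, u i j ∈ bigradedPiece π ζ i j
  generates : ∀ i j : Fin n, ∀ a ∈ bigradedPiece π ζ i j,
    ∃! c : classicalComponent π, a = (c : H) * u i j
  zero_zero : u 0 0 = 1
  counit : ∀ i j : Fin n, Coalgebra.counit (R := k) (u i j) = if i = j then 1 else 0

end TwistorPaper
end

open TwistorPaper

noncomputable section

namespace TwistorPaper

/-! ### Slices of the comultiplication -/

section Slices

variable {k : Type v} {H : Type u} [Field k] [Ring H] [HopfAlgebra k H]

/-! Since `n` is invertible in `k`, the two commuting winding automorphisms split `H` into pieces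
H_ij indexed by pairs of residues mod `n`. The proof extracts from this bigrading a group-like
element g of bidegree (1, 1) and a skew-primitive z of bidegree (0, 1) such that g^i z^e freely
generates H_ij over H₀ = H_00. Everything else follows from that.

The left component, the sum of the H_0j, is a Dedekind domain with augmentation ideal m (`leftAug`).
The powers of m intersect in 0, and m^N/m^(N+1) is spanned by u^N for any u in m outside m². Such a
u can be taken homogeneous for the right winding. Trivial intersection of the two winding groups
forces its weight to be prime to `n`, and a change of ζ makes the weight 1
(`exists_uniformizedFrame`). Independence of characters gives h in H_11 with counit 1.
Multiplication by powers of h is injective on each left eigenspace and transports H_ij into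
H_{0,j-i}, so questions about H become questions about the Dedekind domain.

Twisted conjugation by h acts on m/m² by a root of unity ξ. Comparing `n`th powers of two commuting
operators upgrades this to an exact rule x h = ξ^j h x on H_0j (`exists_commutation`), whence all
bihomogeneous elements commute up to powers of ξ (`color`). Such an algebra embeds in matrices of
size the order of ξ over a commutative ring. As the PI-degree is `n`, ξ is a primitive `n`th root
(`isPrimitiveRoot`).

The functional dual to u on m/m² extends to a skew point derivation f of `H`, and D = `rSlice f` is
a skew derivation of degree (0, -1) commuting with left slices. Its q-numbers in ξ vanish exactly at
multiples of `n`. Hence D kills H₀ (`rSlice_classical`) and is injective on H_ij for i ≠ j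
(`eq_zero_of_rSlice`). Consequently H₀ is stable under left slices, and the antipode turns D(u),
which has counit 1, into some z in H_01 with D(z) = 1 (`exists_integral`). Injectivity of D then
computes every slice of z, giving Δ(z) = z ⊗ g + 1 ⊗ z with g group-like (`taftFrame`).

Finally H₀ is central and slice-stable, so its augmentation generates a Hopf ideal. The images of
g^i z^e form a basis of the twistor. The relations hold in the quotient because z^n and g^n lie in
H₀. The twistor of the Taft algebra and the presented algebra are both spanned by the corresponding
n² monomials, so mapping these onto the basis gives the isomorphisms. -/

/-- The left slice `a ↦ ∑ φ(a₁) a₂`. -/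
def lSlice (φ : H →ₗ[k] k) : H →ₗ[k] H :=
  (TensorProduct.lid k H).toLinearMap ∘ₗ φ.rTensor H ∘ₗ Coalgebra.comul

/-- The right slice `a ↦ ∑ a₁ φ(a₂)`. -/
def rSlice (φ : H →ₗ[k] k) : H →ₗ[k] H :=
  (TensorProduct.rid k H).toLinearMap ∘ₗ φ.lTensor H ∘ₗ Coalgebra.comul

theorem lSlice_apply (φ : H →ₗ[k] k) (a : H) :
    lSlice φ a = TensorProduct.lid k H (φ.rTensor H (Coalgebra.comul a)) := rfl

theorem rSlice_apply (φ : H →ₗ[k] k) (a : H) :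
    rSlice φ a = TensorProduct.rid k H (φ.lTensor H (Coalgebra.comul a)) := rfl

/-- Coassociativity with the first of three legs evaluated: slicing one leg does not disturb the
coaction on the other. -/
theorem comul_lSlice (φ : H →ₗ[k] k) (a : H) :
    Coalgebra.comul (R := k) (lSlice φ a) = (lSlice φ).rTensor H (Coalgebra.comul a) := by
  have h1 : ∀ t : H ⊗[k] H, Coalgebra.comul (R := k) (TensorProduct.lid k H (φ.rTensor H t)) =
      TensorProduct.lid k (H ⊗[k] H) (φ.rTensor (H ⊗[k] H)
        ((Coalgebra.comul (R := k) (A := H)).lTensor H t)) := by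
    intro t
    induction t with
    | zero => simp
    | tmul x y => simp
    | add x y hx hy => simp only [map_add, hx, hy]
  have h2 : ∀ t : H ⊗[k] H, (lSlice φ).rTensor H t =
      TensorProduct.lid k (H ⊗[k] H) (φ.rTensor (H ⊗[k] H)
        (TensorProduct.assoc k H H H ((Coalgebra.comul (R := k) (A := H)).rTensor H t))) := by
    have h3 : ∀ (s : H ⊗[k] H) (z : H), TensorProduct.lid k H (φ.rTensor H s) ⊗ₜ[k] z =
        TensorProduct.lid k (H ⊗[k] H) (φ.rTensor (H ⊗[k] H)
          (TensorProduct.assoc k H H H (s ⊗ₜ z))) := by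
      intro s z
      induction s with
      | zero => simp
      | tmul x y => simp [TensorProduct.smul_tmul']
      | add x y hx hy => simp only [map_add, TensorProduct.add_tmul, hx, hy]
    intro t
    induction t with
    | zero => simp
    | tmul x y => exact h3 _ _
    | add x y hx hy => simp only [map_add, hx, hy]
  rw [lSlice_apply, h1, h2, Coalgebra.coassoc_apply]

theorem comul_rSlice (φ : H →ₗ[k] k) (a : H) :
    Coalgebra.comul (R := k) (rSlice φ a) = (rSlice φ).lTensor H (Coalgebra.comul a) := by
  have h1 : ∀ t : H ⊗[k] H, Coalgebra.comul (R := k) (TensorProduct.rid k H (φ.lTensor H t)) =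
      TensorProduct.rid k (H ⊗[k] H) (φ.lTensor (H ⊗[k] H)
        ((Coalgebra.comul (R := k) (A := H)).rTensor H t)) := by
    intro t
    induction t with
    | zero => simp
    | tmul x y => simp
    | add x y hx hy => simp only [map_add, hx, hy]
  have h2 : ∀ t : H ⊗[k] H, (rSlice φ).lTensor H t =
      TensorProduct.rid k (H ⊗[k] H) (φ.lTensor (H ⊗[k] H)
        ((TensorProduct.assoc k H H H).symm
          ((Coalgebra.comul (R := k) (A := H)).lTensor H t))) := by
    have h3 : ∀ (s : H ⊗[k] H) (z : H), z ⊗ₜ[k] TensorProduct.rid k H (φ.lTensor H s) =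
        TensorProduct.rid k (H ⊗[k] H) (φ.lTensor (H ⊗[k] H)
          ((TensorProduct.assoc k H H H).symm (z ⊗ₜ s))) := by
      intro s z
      induction s with
      | zero => simp
      | tmul x y => simp
      | add x y hx hy => simp only [map_add, TensorProduct.tmul_add, hx, hy]
    intro t
    induction t with
    | zero => simp
    | tmul x y => exact h3 _ _
    | add x y hx hy => simp only [map_add, hx, hy]
  rw [rSlice_apply, h1, h2, ← Coalgebra.coassoc_apply, LinearEquiv.symm_apply_apply]

theorem rSlice_rSlice (φ ψ : H →ₗ[k] k) (a : H) :
    rSlice φ (rSlice ψ a) = rSlice (φ ∘ₗ rSlice ψ) a := by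
  rw [rSlice_apply φ, comul_rSlice, rSlice_apply, LinearMap.lTensor_comp_apply]

/-- The two slices act on opposite legs. Every commutation between left and right windings, and
between left slices and D, comes from here. -/
theorem lSlice_rSlice (φ ψ : H →ₗ[k] k) (a : H) :
    lSlice φ (rSlice ψ a) = rSlice ψ (lSlice φ a) := by
  have h : ∀ t : H ⊗[k] H, TensorProduct.lid k H (φ.rTensor H ((rSlice ψ).lTensor H t)) =
      rSlice ψ (TensorProduct.lid k H (φ.rTensor H t)) := by
    intro t
    induction t with
    | zero => simp
    | tmul x y => simp
    | add x y hx hy => simp only [map_add, hx, hy]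
  rw [lSlice_apply φ, comul_rSlice, h]
  rfl

/-- Both sides are (ψ ⊗ φ)(Δ a). This duality later transposes facts about left slices of z into
facts about right slices. -/
theorem apply_lSlice (φ ψ : H →ₗ[k] k) (a : H) : φ (lSlice ψ a) = ψ (rSlice φ a) := by
  have h : ∀ t : H ⊗[k] H, φ (TensorProduct.lid k H (ψ.rTensor H t)) =
      ψ (TensorProduct.rid k H (φ.lTensor H t)) := by
    intro t
    induction t with
    | zero => simp
    | tmul x y => simp [mul_comm]
    | add x y hx hy => simp only [map_add, hx, hy]
  exact h _

@[simp]
theorem lSlice_one (φ : H →ₗ[k] k) : lSlice φ 1 = φ 1 • 1 := by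
  simp [lSlice_apply, Algebra.TensorProduct.one_def]

@[simp]
theorem rSlice_one (φ : H →ₗ[k] k) : rSlice φ 1 = φ 1 • 1 := by
  simp [rSlice_apply, Algebra.TensorProduct.one_def]

@[simp]
theorem lSlice_counit (a : H) : lSlice (Coalgebra.counit (R := k)) a = a := by
  simp [lSlice_apply]

@[simp]
theorem rSlice_counit (a : H) : rSlice (Coalgebra.counit (R := k)) a = a := by
  simp [rSlice_apply]

@[simp]
theorem counit_lSlice (φ : H →ₗ[k] k) (a : H) :
    Coalgebra.counit (R := k) (lSlice φ a) = φ a := by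
  rw [apply_lSlice, rSlice_counit]

@[simp]
theorem counit_rSlice (φ : H →ₗ[k] k) (a : H) :
    Coalgebra.counit (R := k) (rSlice φ a) = φ a := by
  rw [← apply_lSlice, lSlice_counit]

theorem lWind_eq_lSlice (π : H →ₐ[k] k) (a : H) : lWind π a = lSlice π.toLinearMap a := rfl

theorem rWind_eq_rSlice (π : H →ₐ[k] k) (a : H) : rWind π a = rSlice π.toLinearMap a := rfl

theorem lWind_rSlice (π : H →ₐ[k] k) (φ : H →ₗ[k] k) (a : H) :
    lWind π (rSlice φ a) = rSlice φ (lWind π a) := lSlice_rSlice _ _ _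

theorem lSlice_rWind (π : H →ₐ[k] k) (φ : H →ₗ[k] k) (a : H) :
    lSlice φ (rWind π a) = rWind π (lSlice φ a) := lSlice_rSlice _ _ _

theorem lWind_rWind (π : H →ₐ[k] k) (a : H) :
    lWind π (rWind π a) = rWind π (lWind π a) := lSlice_rSlice _ _ _

@[simp]
theorem counit_lWind (π : H →ₐ[k] k) (a : H) : Coalgebra.counit (R := k) (lWind π a) = π a :=
  counit_lSlice _ _

@[simp]
theorem counit_rWind (π : H →ₐ[k] k) (a : H) : Coalgebra.counit (R := k) (rWind π a) = π a :=
  counit_rSlice _ _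

/-- The coordinate functionals of a basis of `W` already separate tensors. It serves to read off
Δ(z) from the right slices of z. -/
theorem eq_of_rSlice_eq {V W : Type*} [AddCommGroup V] [Module k V] [AddCommGroup W] [Module k W]
    {s t : V ⊗[k] W}
    (h : ∀ φ : W →ₗ[k] k, TensorProduct.rid k V (φ.lTensor V s) =
      TensorProduct.rid k V (φ.lTensor V t)) : s = t := by
  classical
  let b := Module.Basis.ofVectorSpace k W
  apply (TensorProduct.equivFinsuppOfBasisRight (M := V) b).injective
  have key : ∀ (s : V ⊗[k] W) i, TensorProduct.equivFinsuppOfBasisRight (M := V) b s i =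
      TensorProduct.rid k V ((b.coord i).lTensor V s) := by
    intro s i
    induction s with
    | zero => simp
    | tmul x y => simp
    | add x y hx hy => simp only [map_add, Finsupp.add_apply, hx, hy]
  ext i
  rw [key, key, h]

/-- A tensor is a sum of products whose right factors are left slices of it. -/
theorem exists_sum_tmul_slice (t : H ⊗[k] H) : ∃ (ι : Type u) (s : Finset ι) (v : ι → H)
    (φ : ι → H →ₗ[k] k),
    t = ∑ i ∈ s, v i ⊗ₜ[k] TensorProduct.lid k H ((φ i).rTensor H t) := by
  classical
  let b := Module.Basis.ofVectorSpace k H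
  have key : ∀ (s : H ⊗[k] H) i, TensorProduct.equivFinsuppOfBasisLeft (N := H) b s i =
      TensorProduct.lid k H ((b.coord i).rTensor H s) := by
    intro s i
    induction s with
    | zero => simp
    | tmul x y => simp
    | add x y hx hy => simp only [map_add, Finsupp.add_apply, hx, hy]
  refine ⟨_, (TensorProduct.equivFinsuppOfBasisLeft (N := H) b t).support, b, b.coord, ?_⟩
  conv_lhs => rw [← (TensorProduct.equivFinsuppOfBasisLeft (N := H) b).symm_apply_apply t,
    TensorProduct.equivFinsuppOfBasisLeft_symm_apply]
  exact Finset.sum_congr rfl fun i _ => by rw [key]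

end Slices

/-! ### Eigenprojectors of an operator of finite order -/

section EigenProj

variable {k : Type*} {V : Type*} [Field k] [AddCommGroup V] [Module k V]

/-- The projector onto the `ζ ^ i`-eigenspace of an operator `T` with `T ^ n = 1`. -/
def eigenProj (T : Module.End k V) (ζ : k) (n : ℕ) (i : ℤ) : Module.End k V :=
  (n : k)⁻¹ • ∑ s ∈ Finset.range n, (ζ ^ (-i)) ^ s • T ^ s

variable {T : Module.End k V} {ζ : k} {n : ℕ}

theorem eigenProj_apply (i : ℤ) (x : V) :
    eigenProj T ζ n i x = (n : k)⁻¹ • ∑ s ∈ Finset.range n, (ζ ^ (-i)) ^ s • (T ^ s) x := by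
  simp [eigenProj]

theorem pow_apply_of_eigen {c : k} {x : V} (h : T x = c • x) (s : ℕ) : (T ^ s) x = c ^ s • x := by
  induction s with
  | zero => simp
  | succ s ih => rw [pow_succ', Module.End.mul_apply, ih, map_smul, h, smul_smul, ← pow_succ]

theorem sum_zpow_pow_of_primitive (hζ : IsPrimitiveRoot ζ n) (m : ℤ) :
    ∑ s ∈ Finset.range n, (ζ ^ m) ^ s = if (n : ℤ) ∣ m then (n : k) else 0 := by
  split_ifs with h
  · rw [(hζ.zpow_eq_one_iff_dvd m).2 h]; simp
  · have h1 : ζ ^ m ≠ 1 := fun h' => h ((hζ.zpow_eq_one_iff_dvd m).1 h')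
    rw [geom_sum_eq h1, ← zpow_natCast, ← zpow_mul, mul_comm, zpow_mul, zpow_natCast,
      hζ.pow_eq_one, one_zpow, sub_self, zero_div]

theorem eigenProj_of_eigen (hζ : IsPrimitiveRoot ζ n) (hn : (n : k) ≠ 0) (i : ℤ) {j : ℤ} {x : V}
    (h : T x = ζ ^ j • x) : eigenProj T ζ n i x = if (n : ℤ) ∣ j - i then x else 0 := by
  have hz : ζ ≠ 0 := hζ.ne_zero (by rintro rfl; simp at hn)
  have h1 : ∀ s, (ζ ^ (-i)) ^ s • (T ^ s) x = (ζ ^ (j - i)) ^ s • x := by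
    intro s
    rw [pow_apply_of_eigen h, smul_smul, ← mul_pow, ← zpow_add₀ hz, neg_add_eq_sub]
  rw [eigenProj_apply, Finset.sum_congr rfl fun s _ => h1 s, ← Finset.sum_smul,
    sum_zpow_pow_of_primitive hζ]
  split_ifs <;> simp [smul_smul, hn]

/-- Applying `T` shifts the summation index, and the term that leaves the range re-enters at 0
because T^n = 1 and ζ^n = 1. -/
theorem apply_eigenProj (hζ : IsPrimitiveRoot ζ n) (hn : (n : k) ≠ 0) (hT : T ^ n = 1) (i : ℤ)
    (x : V) : T (eigenProj T ζ n i x) = ζ ^ i • eigenProj T ζ n i x := by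
  have hz : ζ ≠ 0 := hζ.ne_zero (by rintro rfl; simp at hn)
  have h1 : ∀ s : ℕ, ζ ^ i • (ζ ^ (-i)) ^ (s + 1) • (T ^ (s + 1)) x =
      T ((ζ ^ (-i)) ^ s • (T ^ s) x) := by
    intro s
    rw [pow_succ' T, Module.End.mul_apply, map_smul, smul_smul, pow_succ', ← mul_assoc,
      ← zpow_add₀ hz]
    simp
  have h2 : (ζ ^ (-i)) ^ n • (T ^ n) x = (ζ ^ (-i)) ^ 0 • (T ^ 0) x := by
    rw [hT, ← zpow_natCast, ← zpow_mul, mul_comm, zpow_mul, zpow_natCast, hζ.pow_eq_one]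
    simp
  rw [eigenProj_apply, map_smul, map_sum, smul_comm]
  congr 1
  rw [← Finset.sum_congr rfl fun s _ => h1 s, ← Finset.smul_sum]
  congr 1
  have := Finset.sum_range_succ' (fun s => (ζ ^ (-i)) ^ s • (T ^ s) x) n
  rw [Finset.sum_range_succ, h2] at this
  exact (add_right_cancel this).symm

theorem sum_eigenProj (hζ : IsPrimitiveRoot ζ n) (hn : (n : k) ≠ 0) (x : V) :
    ∑ i ∈ Finset.range n, eigenProj T ζ n (i : ℤ) x = x := by
  have hpos : 0 < n := Nat.pos_of_ne_zero (by rintro rfl; simp at hn)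
  simp only [eigenProj_apply]
  rw [← Finset.smul_sum, Finset.sum_comm]
  have h1 : ∀ s ∈ Finset.range n, ∑ i ∈ Finset.range n, (ζ ^ (-(i : ℤ))) ^ s • (T ^ s) x =
      if s = 0 then (n : k) • x else 0 := by
    intro s hs
    have h2 : ∀ i : ℕ, (ζ ^ (-(i : ℤ))) ^ s = (ζ ^ (-(s : ℤ))) ^ i := by
      intro i
      rw [← zpow_natCast, ← zpow_natCast, ← zpow_mul, ← zpow_mul]
      congr 1
      ring
    rw [← Finset.sum_smul, Finset.sum_congr rfl fun i _ => h2 i,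
      sum_zpow_pow_of_primitive hζ]
    by_cases h0 : s = 0
    · simp [h0]
    · rw [if_neg, if_neg h0, zero_smul]
      rw [dvd_neg, Int.natCast_dvd_natCast]
      exact Nat.not_dvd_of_pos_of_lt (Nat.pos_of_ne_zero h0) (Finset.mem_range.1 hs)
  rw [Finset.sum_congr rfl h1, Finset.sum_ite_eq' (Finset.range n) 0,
    if_pos (Finset.mem_range.2 hpos), smul_smul, inv_mul_cancel₀ hn, one_smul]

theorem eigenProj_comm {W : Type*} [AddCommGroup W] [Module k W] {T' : Module.End k W}
    (S : V →ₗ[k] W) (h : ∀ x, S (T x) = T' (S x)) (i : ℤ) (x : V) :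
    S (eigenProj T ζ n i x) = eigenProj T' ζ n i (S x) := by
  have h1 : ∀ s : ℕ, S ((T ^ s) x) = (T' ^ s) (S x) := by
    intro s
    induction s with
    | zero => simp
    | succ s ih => rw [pow_succ', pow_succ', Module.End.mul_apply, h, ih, Module.End.mul_apply]
  simp only [eigenProj_apply, map_smul, map_sum, h1]

theorem eigenProj_mem {W : Submodule k V} (h : ∀ x ∈ W, T x ∈ W) (i : ℤ) {x : V} (hx : x ∈ W) :
    eigenProj T ζ n i x ∈ W := by
  have h1 : ∀ s : ℕ, (T ^ s) x ∈ W := by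
    intro s
    induction s with
    | zero => simpa
    | succ s ih => rw [pow_succ', Module.End.mul_apply]; exact h _ ih
  rw [eigenProj_apply]
  exact W.smul_mem _ (W.sum_mem fun s _ => W.smul_mem _ (h1 s))

end EigenProj

/-! ### The bigrading by the winding automorphisms -/

section Bigrading

variable {k : Type v} {H : Type u} [Field k] [Ring H] [HopfAlgebra k H]

/-- The common eigenspace of the left winding automorphism for `ζ ^ i` and of the right winding
automorphism for `ζ ^ j`, with integral exponents. -/
def biPiece (π : H →ₐ[k] k) (ζ : k) (i j : ℤ) : Submodule k H where
  carrier := {x | lWind π x = ζ ^ i • x ∧ rWind π x = ζ ^ j • x}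
  add_mem' := by
    rintro a b ⟨h1, h2⟩ ⟨h3, h4⟩
    simp [h1, h2, h3, h4]
  zero_mem' := by simp
  smul_mem' := by
    rintro c a ⟨h1, h2⟩
    simp [h1, h2, smul_comm c]

theorem mem_biPiece {π : H →ₐ[k] k} {ζ : k} {i j : ℤ} {x : H} :
    x ∈ biPiece π ζ i j ↔ lWind π x = ζ ^ i • x ∧ rWind π x = ζ ^ j • x := Iff.rfl

theorem bigradedPiece_eq_biPiece (π : H →ₐ[k] k) (ζ : k) (i j : ℕ) :
    bigradedPiece π ζ i j = biPiece π ζ i j := by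
  ext x
  simp only [bigradedPiece, Submodule.mem_inf, Module.End.mem_eigenspace_iff, mem_biPiece,
    zpow_natCast]
  rfl

theorem mem_leftComponent {π : H →ₐ[k] k} {x : H} : x ∈ leftComponent π ↔ lWind π x = x :=
  Iff.rfl

theorem mem_rightComponent {π : H →ₐ[k] k} {x : H} : x ∈ rightComponent π ↔ rWind π x = x :=
  Iff.rfl

theorem mem_classicalComponent {π : H →ₐ[k] k} (ζ : k) {x : H} :
    x ∈ classicalComponent π ↔ x ∈ biPiece π ζ 0 0 := by
  rw [classicalComponent, Algebra.mem_inf, mem_leftComponent, mem_rightComponent, mem_biPiece]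
  simp

theorem lWindHom_pow (π : H →ₐ[k] k) (m : ℕ) (x : H) :
    lWindHom ((WithConv.toConv π : WithConv (H →ₐ[k] k)) ^ m).ofConv x =
      (((lWind π).toLinearMap : Module.End k H) ^ m) x := by
  induction m generalizing x with
  | zero => rw [pow_zero, lWindHom_one]; rfl
  | succ m ih =>
    rw [pow_succ', pow_succ, Module.End.mul_apply]
    have := AlgHom.congr_fun (lWindHom_comp
      ((WithConv.toConv π : WithConv (H →ₐ[k] k)) ^ m).ofConv π) x
    rw [AlgHom.comp_apply, ih] at this
    exact this.symm

theorem rWindHom_pow (π : H →ₐ[k] k) (m : ℕ) (x : H) :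
    rWindHom ((WithConv.toConv π : WithConv (H →ₐ[k] k)) ^ m).ofConv x =
      (((rWind π).toLinearMap : Module.End k H) ^ m) x := by
  induction m generalizing x with
  | zero => rw [pow_zero, rWindHom_one]; rfl
  | succ m ih =>
    rw [pow_succ, pow_succ, Module.End.mul_apply]
    have := AlgHom.congr_fun (rWindHom_comp
      ((WithConv.toConv π : WithConv (H →ₐ[k] k)) ^ m).ofConv π) x
    rw [AlgHom.comp_apply, ih] at this
    exact this.symm

/-- A character `π` of order `n`, invertible in `k`, with a primitive `n`th root of unity `ζ`. -/
structure TameCharacter (π : H →ₐ[k] k) (ζ : k) (n : ℕ) : Prop where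
  prim : IsPrimitiveRoot ζ n
  cast_ne : (n : k) ≠ 0
  order : orderOf (WithConv.toConv π : WithConv (H →ₐ[k] k)) = n

namespace TameCharacter

variable {π : H →ₐ[k] k} {ζ : k} {n : ℕ} (hπ : TameCharacter π ζ n)

include hπ

theorem pos : 0 < n := Nat.pos_of_ne_zero fun h => hπ.cast_ne (by simp [h])

theorem zeta_ne : ζ ≠ 0 := hπ.prim.ne_zero hπ.pos.ne'

theorem lWind_pow : ((lWind π).toLinearMap : Module.End k H) ^ n = 1 := by
  ext x
  rw [← lWindHom_pow, ← hπ.order, pow_orderOf_eq_one, lWindHom_one]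
  rfl

theorem rWind_pow : ((rWind π).toLinearMap : Module.End k H) ^ n = 1 := by
  ext x
  rw [← rWindHom_pow, ← hπ.order, pow_orderOf_eq_one, rWindHom_one]
  rfl

theorem zpow_congr {i j : ℤ} (h : (n : ℤ) ∣ i - j) : ζ ^ i = ζ ^ j := by
  have h2 : ζ ^ (i - j) = 1 := (hπ.prim.zpow_eq_one_iff_dvd _).2 h
  rwa [zpow_sub₀ hπ.zeta_ne, div_eq_one_iff_eq (zpow_ne_zero _ hπ.zeta_ne)] at h2

theorem biPiece_congr {i j i' j' : ℤ} (h : (n : ℤ) ∣ i - i') (h' : (n : ℤ) ∣ j - j') :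
    biPiece π ζ i j = biPiece π ζ i' j' := by
  ext x
  rw [mem_biPiece, mem_biPiece, hπ.zpow_congr h, hπ.zpow_congr h']

theorem mul_mem {i j i' j' : ℤ} {x y : H} (hx : x ∈ biPiece π ζ i j)
    (hy : y ∈ biPiece π ζ i' j') : x * y ∈ biPiece π ζ (i + i') (j + j') := by
  rw [mem_biPiece] at *
  simp [hx.1, hx.2, hy.1, hy.2, smul_smul, zpow_add₀ hπ.zeta_ne, mul_comm]

omit hπ in
theorem one_mem : (1 : H) ∈ biPiece π ζ 0 0 := by
  rw [mem_biPiece]; simp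

theorem pow_mem {i j : ℤ} {x : H} (hx : x ∈ biPiece π ζ i j) (m : ℕ) :
    x ^ m ∈ biPiece π ζ (m * i) (m * j) := by
  induction m with
  | zero => simpa using one_mem
  | succ m ih =>
    rw [pow_succ]
    convert hπ.mul_mem ih hx using 2 <;> push_cast <;> ring

omit hπ in
/-- The projector onto the `ζ ^ i`-eigenspace of the left winding automorphism. -/
def lProj (π : H →ₐ[k] k) (ζ : k) (n : ℕ) (i : ℤ) : Module.End k H :=
  eigenProj (lWind π).toLinearMap ζ n i

omit hπ in
/-- The projector onto the `ζ ^ j`-eigenspace of the right winding automorphism. -/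
def rProj (π : H →ₐ[k] k) (ζ : k) (n : ℕ) (j : ℤ) : Module.End k H :=
  eigenProj (rWind π).toLinearMap ζ n j

theorem lWind_lProj (i : ℤ) (x : H) : lWind π (lProj π ζ n i x) = ζ ^ i • lProj π ζ n i x :=
  apply_eigenProj hπ.prim hπ.cast_ne hπ.lWind_pow i x

theorem rWind_rProj (j : ℤ) (x : H) : rWind π (rProj π ζ n j x) = ζ ^ j • rProj π ζ n j x :=
  apply_eigenProj hπ.prim hπ.cast_ne hπ.rWind_pow j x

omit hπ in
theorem rWind_lProj (i : ℤ) (x : H) : rWind π (lProj π ζ n i x) = lProj π ζ n i (rWind π x) :=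
  eigenProj_comm (T := (lWind π).toLinearMap) (T' := (lWind π).toLinearMap) (rWind π).toLinearMap
    (fun x => (lWind_rWind π x).symm) i x

omit hπ in
theorem lWind_rProj (i : ℤ) (x : H) : lWind π (rProj π ζ n i x) = rProj π ζ n i (lWind π x) :=
  eigenProj_comm (T := (rWind π).toLinearMap) (T' := (rWind π).toLinearMap) (lWind π).toLinearMap
    (fun x => lWind_rWind π x) i x

omit hπ in
theorem lProj_rSlice (i : ℤ) (φ : H →ₗ[k] k) (x : H) :
    rSlice φ (lProj π ζ n i x) = lProj π ζ n i (rSlice φ x) :=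
  eigenProj_comm (T := (lWind π).toLinearMap) (T' := (lWind π).toLinearMap) (rSlice φ)
     (fun x => (lWind_rSlice π φ x).symm) i x

theorem lProj_eigen {i j : ℤ} {x : H} (h : lWind π x = ζ ^ j • x) :
    lProj π ζ n i x = if (n : ℤ) ∣ j - i then x else 0 :=
  eigenProj_of_eigen hπ.prim hπ.cast_ne i h

theorem rProj_eigen {i j : ℤ} {x : H} (h : rWind π x = ζ ^ j • x) :
    rProj π ζ n i x = if (n : ℤ) ∣ j - i then x else 0 :=
  eigenProj_of_eigen hπ.prim hπ.cast_ne i h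

theorem lProj_mem {i j : ℤ} {x : H} (h : rWind π x = ζ ^ j • x) :
    lProj π ζ n i x ∈ biPiece π ζ i j :=
  ⟨hπ.lWind_lProj i x, by rw [rWind_lProj, h, map_smul]⟩

theorem rProj_mem {i j : ℤ} {x : H} (h : lWind π x = ζ ^ i • x) :
    rProj π ζ n j x ∈ biPiece π ζ i j :=
  ⟨by rw [lWind_rProj, h, map_smul], hπ.rWind_rProj j x⟩

theorem sum_lProj (x : H) : ∑ i ∈ Finset.range n, lProj π ζ n i x = x :=
  sum_eigenProj hπ.prim hπ.cast_ne x

theorem sum_rProj (x : H) : ∑ i ∈ Finset.range n, rProj π ζ n i x = x :=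
  sum_eigenProj hπ.prim hπ.cast_ne x

/-- Additive properties can be checked on bihomogeneous elements. -/
theorem homogeneous_induction {p : H → Prop} (x : H)
    (hp : ∀ (i j : ℤ), ∀ y ∈ biPiece π ζ i j, p y)
    (h0 : p 0) (hadd : ∀ y z, p y → p z → p (y + z)) : p x := by
  have hs : ∀ (s : Finset ℕ) (f : ℕ → H), (∀ i ∈ s, p (f i)) → p (∑ i ∈ s, f i) :=
    fun s f hf => Finset.sum_induction f p hadd h0 hf
  rw [← hπ.sum_lProj x]
  refine hs _ _ fun i _ => ?_
  rw [← hπ.sum_rProj (lProj π ζ n i x)]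
  exact hs _ _ fun j _ => hp i j _ (hπ.rProj_mem (hπ.lWind_lProj _ _))

theorem eq_zero_of_mem {i j i' j' : ℤ} {x : H} (h : x ∈ biPiece π ζ i j)
    (h' : x ∈ biPiece π ζ i' j') (hne : ¬ ((n : ℤ) ∣ i - i' ∧ (n : ℤ) ∣ j - j')) : x = 0 := by
  by_contra hx
  refine hne ⟨?_, ?_⟩
  · have h1 := hπ.lProj_eigen (i := i') h.1
    have h2 := hπ.lProj_eigen (i := i') h'.1
    by_contra hd
    rw [if_neg hd] at h1
    rw [h1] at h2
    simp at h2
    exact hx h2.symm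
  · have h1 := hπ.rProj_eigen (i := j') h.2
    have h2 := hπ.rProj_eigen (i := j') h'.2
    by_contra hd
    rw [if_neg hd] at h1
    rw [h1] at h2
    simp at h2
    exact hx h2.symm

/-- The counit composed with either winding is π, so the two eigenvalues must agree wherever the
counit is nonzero. -/
theorem counit_eq_zero {i j : ℤ} {x : H} (h : x ∈ biPiece π ζ i j) (hij : ¬ (n : ℤ) ∣ i - j) :
    Coalgebra.counit (R := k) x = 0 := by
  have h1 : Coalgebra.counit (R := k) (lWind π x) = Coalgebra.counit (R := k) (rWind π x) := by
    simp
  rw [h.1, h.2, map_smul, map_smul, smul_eq_mul, smul_eq_mul] at h1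
  by_contra hx
  refine hij ((hπ.prim.zpow_eq_one_iff_dvd _).1 ?_)
  rw [zpow_sub₀ hπ.zeta_ne, mul_right_cancel₀ hx h1, div_self (zpow_ne_zero _ hπ.zeta_ne)]

/-- There is a normalised element in the bidegree `(1, 1)`. -/
theorem exists_unit_degree : ∃ h ∈ biPiece π ζ 1 1, Coalgebra.counit (R := k) h = 1 := by
  have hinj : Function.Injective fun s : Fin n =>
      ((((WithConv.toConv π : WithConv (H →ₐ[k] k)) ^ (s : ℕ)).ofConv : H →ₐ[k] k) : H →* k) := by
    intro s t hst
    have h1 : ((WithConv.toConv π : WithConv (H →ₐ[k] k)) ^ (s : ℕ)) =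
        (WithConv.toConv π : WithConv (H →ₐ[k] k)) ^ (t : ℕ) := by
      apply WithConv.ofConv_injective
      ext x
      exact DFunLike.congr_fun hst x
    have := pow_injOn_Iio_orderOf (by simp [hπ.order]) (by simp [hπ.order]) h1
    exact Fin.ext this
  -- The powers of π below its order are distinct characters, hence linearly independent. The counit
  -- after `lProj` is a combination of them with nonzero coefficients, so it is not zero.
  have hli := (linearIndependent_monoidHom H k).comp _ hinj
  have hne : ∃ x, Coalgebra.counit (R := k) (lProj π ζ n 1 x) ≠ 0 := by
    by_contra hcon
    push Not at hcon
    have h2 := Fintype.linearIndependent_iff.1 hli (fun s => (ζ ^ (-1 : ℤ)) ^ (s : ℕ)) (by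
      funext x
      have h3 := hcon x
      rw [lProj, eigenProj_apply, map_smul, map_sum, smul_eq_mul, mul_eq_zero] at h3
      have h3 := h3.resolve_left (inv_ne_zero hπ.cast_ne)
      rw [← Fin.sum_univ_eq_sum_range (fun s => Coalgebra.counit (R := k)
        ((ζ ^ (-1 : ℤ)) ^ s • (((lWind π).toLinearMap : Module.End k H) ^ s) x))] at h3
      simp only [Finset.sum_apply, Pi.smul_apply, Pi.zero_apply, Function.comp]
      rw [← h3]
      refine Finset.sum_congr rfl fun s _ => ?_
      rw [← lWindHom_pow, map_smul]
      congr 1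
      exact (counit_lSlice (AlgHom.toLinearMap
        ((WithConv.toConv π : WithConv (H →ₐ[k] k)) ^ (s : ℕ)).ofConv) x).symm) ⟨0, hπ.pos⟩
    simp at h2
  obtain ⟨x, hx⟩ := hne
  have hy : ∃ y ∈ biPiece π ζ 1 1, Coalgebra.counit (R := k) y ≠ 0 := by
    by_contra hcon
    push Not at hcon
    refine hx ?_
    rw [← hπ.sum_rProj (lProj π ζ n 1 x), map_sum]
    refine Finset.sum_eq_zero fun j _ => ?_
    have hm := hπ.rProj_mem (j := j) (hπ.lWind_lProj 1 x)
    by_cases hj : (n : ℤ) ∣ 1 - j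
    · refine hcon _ ?_
      rwa [hπ.biPiece_congr (i := 1) (i' := 1) (by simp) hj]
    · exact hπ.counit_eq_zero hm hj
  obtain ⟨y, hy, hy0⟩ := hy
  refine ⟨(Coalgebra.counit (R := k) y)⁻¹ • y, Submodule.smul_mem _ _ hy, ?_⟩
  rw [map_smul, smul_eq_mul, inv_mul_cancel₀ hy0]

end TameCharacter

end Bigrading

open TameCharacter

/-! ### The augmentation filtration of the left component -/

section AugFiltration

variable {k : Type v} {H : Type u} [Field k] [Ring H] [HopfAlgebra k H]

/-- The augmentation ideal `ker ε ∩ Hˡ₀` of the left component. -/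
def leftAug (π : H →ₐ[k] k) : Submodule k H :=
  LinearMap.ker (Coalgebra.counit (R := k) (A := H)) ⊓ Subalgebra.toSubmodule (leftComponent π)

theorem mem_leftAug {π : H →ₐ[k] k} {x : H} :
    x ∈ leftAug π ↔ Coalgebra.counit (R := k) x = 0 ∧ lWind π x = x := by
  rw [leftAug, Submodule.mem_inf, LinearMap.mem_ker, Subalgebra.mem_toSubmodule,
    mem_leftComponent]

/-- The powers of the augmentation ideal of the left component. -/
def augFilt (π : H →ₐ[k] k) (N : ℕ) : Submodule k H :=
  leftAug π ^ N * Subalgebra.toSubmodule (leftComponent π)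

variable {π : H →ₐ[k] k}

/-- The trailing factor `leftComponent π` in `augFilt` makes step 0 the whole left component; the
zeroth power of a submodule would only be the scalars. -/
theorem mem_augFilt_zero {x : H} : x ∈ augFilt π 0 ↔ lWind π x = x := by
  rw [augFilt, Submodule.pow_zero, one_mul, Subalgebra.mem_toSubmodule, mem_leftComponent]

theorem augFilt_succ (N : ℕ) : augFilt π (N + 1) = leftAug π * augFilt π N := by
  rw [augFilt, augFilt, pow_succ', mul_assoc]

theorem mem_augFilt_one {x : H} :
    x ∈ augFilt π 1 ↔ Coalgebra.counit (R := k) x = 0 ∧ lWind π x = x := by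
  constructor
  · intro h
    rw [augFilt_succ] at h
    refine Submodule.mul_induction_on h ?_ ?_
    · intro a ha b hb
      rw [mem_leftAug] at ha
      rw [mem_augFilt_zero] at hb
      simp [ha.1, ha.2, hb]
    · rintro a b ⟨h1, h2⟩ ⟨h3, h4⟩
      simp [h1, h2, h3, h4]
  · intro h
    rw [augFilt_succ, ← mul_one x]
    exact Submodule.mul_mem_mul (mem_leftAug.2 h) (mem_augFilt_zero.2 (map_one _))

theorem augFilt_succ_induction {N : ℕ} {p : H → Prop} {x : H} (hx : x ∈ augFilt π (N + 1))
    (hmul : ∀ a ∈ augFilt π 1, ∀ b ∈ augFilt π N, p (a * b))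
    (hadd : ∀ a b, p a → p b → p (a + b)) : p x := by
  rw [augFilt_succ] at hx
  refine Submodule.mul_induction_on hx (fun a ha b hb => hmul a ?_ b hb) hadd
  rwa [mem_augFilt_one, ← mem_leftAug]

theorem lWind_of_mem_augFilt {N : ℕ} {x : H} (hx : x ∈ augFilt π N) : lWind π x = x := by
  induction N generalizing x with
  | zero => exact mem_augFilt_zero.1 hx
  | succ N ih =>
    refine augFilt_succ_induction (p := fun x => lWind π x = x) hx (fun a ha b hb => ?_)
      fun a b ha hb => ?_
    · rw [map_mul, ih hb, (mem_augFilt_one.1 ha).2]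
    · rw [map_add, ha, hb]

theorem counit_rWind_of_left {x : H} (hx : lWind π x = x) :
    Coalgebra.counit (R := k) (rWind π x) = Coalgebra.counit (R := k) x := by
  conv_rhs => rw [← hx]
  simp

theorem rWind_mem_augFilt {N : ℕ} {x : H} (hx : x ∈ augFilt π N) :
    rWind π x ∈ augFilt π N := by
  induction N generalizing x with
  | zero =>
    rw [mem_augFilt_zero] at *
    rw [lWind_rWind, hx]
  | succ N ih =>
    refine augFilt_succ_induction (p := fun x => rWind π x ∈ augFilt π (N + 1)) hx
      (fun a ha b hb => ?_) fun a b ha hb => ?_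
    · rw [map_mul, augFilt_succ]
      refine Submodule.mul_mem_mul ?_ (ih hb)
      rw [mem_augFilt_one] at ha
      rw [mem_leftAug, counit_rWind_of_left ha.2, lWind_rWind, ha.2]
      exact ⟨ha.1, rfl⟩
    · rw [map_add]; exact add_mem ha hb

/-- The augmentation filtration is transported from the powers of a prime of a commutative
Dedekind domain. -/
theorem exists_model (hD : IsDedekind (leftComponent π)) :
    ∃ (D : Type u) (_ : CommRing D) (_ : IsDedekindDomain D) (ι : D →+* H) (P : Ideal D),
      P.IsPrime ∧ Function.Injective ι ∧ (∀ x, lWind π x = x ↔ ∃ d, ι d = x) ∧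
      ∀ N x, x ∈ augFilt π N ↔ ∃ d ∈ P ^ N, ι d = x := by
  obtain ⟨D, _, hDD, ⟨e⟩⟩ := hD
  let ι : D →+* H := ((leftComponent π).val : leftComponent π →+* H).comp (e : D →+* _)
  have hι : ∀ x, lWind π x = x ↔ ∃ d, ι d = x := by
    intro x
    constructor
    · intro hx
      exact ⟨e.symm ⟨x, hx⟩, by simp [ι]⟩
    · rintro ⟨d, rfl⟩
      exact (e d).2
  -- The kernel of a ring homomorphism into the field `k`, hence prime.
  let P : Ideal D := RingHom.ker (((Bialgebra.counitAlgHom k H) : H →+* k).comp ι)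
  have hP : ∀ d, d ∈ P ↔ Coalgebra.counit (R := k) (ι d) = 0 := fun d => Iff.rfl
  refine ⟨D, inferInstance, hDD, ι, P, RingHom.ker_isPrime _, ?_, hι, ?_⟩
  · intro a b hab
    exact e.injective (Subtype.ext hab)
  · intro N
    induction N with
    | zero => intro x; rw [mem_augFilt_zero, hι]; simp
    | succ N ih =>
      intro x
      constructor
      · intro hx
        refine augFilt_succ_induction (p := fun x => ∃ d ∈ P ^ (N + 1), ι d = x) hx
          (fun a ha b hb => ?_) ?_
        · rw [mem_augFilt_one, hι] at ha
          obtain ⟨ha0, a, rfl⟩ := ha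
          obtain ⟨b, hb', rfl⟩ := (ih _).1 hb
          exact ⟨a * b, by rw [pow_succ']; exact Ideal.mul_mem_mul ((hP a).2 ha0) hb', map_mul _ _ _⟩
        · rintro _ _ ⟨a, ha, rfl⟩ ⟨b, hb, rfl⟩
          exact ⟨a + b, add_mem ha hb, map_add _ _ _⟩
      · rintro ⟨d, hd, rfl⟩
        rw [pow_succ'] at hd
        refine Submodule.mul_induction_on hd ?_ ?_
        · intro a ha b hb
          rw [map_mul, augFilt_succ]
          exact Submodule.mul_mem_mul (mem_leftAug.2 ⟨(hP a).1 ha, (hι _).2 ⟨a, rfl⟩⟩)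
            ((ih _).2 ⟨b, hb, rfl⟩)
        · intro a b ha hb
          rw [map_add]; exact add_mem ha hb

variable (hD : IsDedekind (leftComponent π))

include hD

theorem left_comm {a b : H} (ha : lWind π a = a) (hb : lWind π b = b) : a * b = b * a := by
  obtain ⟨D, _, _, ι, P, -, -, hι, -⟩ := exists_model hD
  obtain ⟨a, rfl⟩ := (hι _).1 ha
  obtain ⟨b, rfl⟩ := (hι _).1 hb
  rw [← map_mul, mul_comm, map_mul]

theorem left_eq_zero_or {a b : H} (ha : lWind π a = a) (hb : lWind π b = b) (h : a * b = 0) :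
    a = 0 ∨ b = 0 := by
  obtain ⟨D, _, _, ι, P, -, hinj, hι, -⟩ := exists_model hD
  obtain ⟨a, rfl⟩ := (hι _).1 ha
  obtain ⟨b, rfl⟩ := (hι _).1 hb
  rw [← map_mul, map_eq_zero_iff _ hinj, mul_eq_zero] at h
  rwa [map_eq_zero_iff _ hinj, map_eq_zero_iff _ hinj]

theorem augFilt_mul {M N : ℕ} {a b : H} (ha : a ∈ augFilt π M) (hb : b ∈ augFilt π N) :
    a * b ∈ augFilt π (M + N) := by
  obtain ⟨D, _, _, ι, P, -, -, -, hι⟩ := exists_model hD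
  obtain ⟨a, ha', rfl⟩ := (hι _ _).1 ha
  obtain ⟨b, hb', rfl⟩ := (hι _ _).1 hb
  exact (hι _ _).2 ⟨a * b, by rw [pow_add]; exact Ideal.mul_mem_mul ha' hb', map_mul _ _ _⟩

theorem augFilt_le {M N : ℕ} (h : M ≤ N) : augFilt π N ≤ augFilt π M := by
  obtain ⟨D, _, _, ι, P, -, -, -, hι⟩ := exists_model hD
  intro x hx
  obtain ⟨a, ha, rfl⟩ := (hι _ _).1 hx
  exact (hι _ _).2 ⟨a, Ideal.pow_le_pow_right h ha, rfl⟩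

/-- Krull's intersection theorem in a noetherian domain. -/
theorem eq_zero_of_mem_augFilt {x : H} (h : ∀ N, x ∈ augFilt π N) : x = 0 := by
  obtain ⟨D, _, _, ι, P, hP, hinj, -, hι⟩ := exists_model hD
  obtain ⟨d, -, rfl⟩ := (hι _ _).1 (h 0)
  have : d ∈ ⨅ N : ℕ, P ^ N := by
    rw [Submodule.mem_iInf]
    intro N
    obtain ⟨d', hd', hd⟩ := (hι _ _).1 (h N)
    rwa [← hinj hd]
  rw [Ideal.iInf_pow_eq_bot_of_isDomain P hP.ne_top] at this
  rw [(Submodule.mem_bot D).1 this, map_zero]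

theorem exists_notMem_augFilt_two (h : ∃ x ∈ augFilt π 1, x ≠ 0) :
    ∃ u ∈ augFilt π 1, u ∉ augFilt π 2 := by
  obtain ⟨D, _, _, ι, P, hP, hinj, -, hι⟩ := exists_model hD
  obtain ⟨x, hx, hx0⟩ := h
  obtain ⟨d, hd, rfl⟩ := (hι _ _).1 hx
  rw [pow_one] at hd
  have hPbot : P ≠ ⊥ := by
    rintro rfl
    exact hx0 (by rw [(Submodule.mem_bot D).1 hd, map_zero])
  obtain ⟨a, ha, ha2⟩ := SetLike.exists_of_lt (Ideal.pow_succ_lt_pow hPbot 1)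
  refine ⟨ι a, (hι _ _).2 ⟨a, ha, rfl⟩, fun h => ?_⟩
  obtain ⟨b, hb, hab⟩ := (hι _ _).1 h
  exact ha2 (hinj hab ▸ hb)

/-- No ideal lies strictly between P² and P, so P² + (u) = P. The coefficient of u may be replaced
by its counit, since the difference lies in P. -/
theorem exists_smul_sub_mem {u p : H} (hu : u ∈ augFilt π 1) (hu2 : u ∉ augFilt π 2)
    (hp : p ∈ augFilt π 1) : ∃ c : k, p - c • u ∈ augFilt π 2 := by
  have main : ∃ a, lWind π a = a ∧ p - a * u ∈ augFilt π 2 := by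
    obtain ⟨D, _, _, ι, P, hP, hinj, hι0, hι⟩ := exists_model hD
    obtain ⟨u, hu', rfl⟩ := (hι _ _).1 hu
    obtain ⟨p, hp', rfl⟩ := (hι _ _).1 hp
    have hu2 : u ∉ P ^ 2 := fun h => hu2 ((hι _ _).2 ⟨u, h, rfl⟩)
    have hPbot : P ≠ ⊥ := by
      rintro rfl
      rw [pow_one, Ideal.mem_bot] at hu'
      exact hu2 (by rw [hu']; exact zero_mem _)
    have : P ^ 2 ⊔ Ideal.span {u} = P ^ 1 := by
      refine Ideal.eq_prime_pow_of_succ_lt_of_le hPbot (i := 1) ?_ ?_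
      · refine lt_of_le_of_ne le_sup_left fun h => hu2 ?_
        rw [h]
        exact Ideal.mem_sup_right (Ideal.subset_span rfl)
      · exact sup_le (Ideal.pow_le_pow_right (by norm_num))
          ((Ideal.span_singleton_le_iff_mem _).2 hu')
    rw [← this] at hp'
    obtain ⟨q, hq, w, hw, rfl⟩ := Submodule.mem_sup.1 hp'
    obtain ⟨a, rfl⟩ := Ideal.mem_span_singleton'.1 hw
    exact ⟨ι a, (hι0 _).2 ⟨a, rfl⟩, (hι _ _).2 ⟨q, hq, by simp⟩⟩
  obtain ⟨a, ha, hau⟩ := main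
  refine ⟨Coalgebra.counit (R := k) a, ?_⟩
  have h1 : a - algebraMap k H (Coalgebra.counit (R := k) a) ∈ augFilt π 1 := by
    rw [mem_augFilt_one]; simp [ha]
  have h2 := augFilt_mul hD h1 hu
  have h3 := add_mem hau h2
  rwa [sub_mul, ← Algebra.smul_def, add_sub, sub_add_cancel] at h3

/-- Since c ≡ 1 modulo m, multiplication by c is the identity on each graded piece; membership of x
climbs one step at a time. -/
theorem mem_augFilt_of_mul_mem {c x : H} {N : ℕ} (hc : lWind π c = c)
    (hc0 : Coalgebra.counit (R := k) c = 1) (hx : lWind π x = x) (h : c * x ∈ augFilt π N) :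
    x ∈ augFilt π N := by
  have h1 : c - 1 ∈ augFilt π 1 := by rw [mem_augFilt_one]; simp [hc, hc0]
  have key : ∀ M ≤ N, x ∈ augFilt π M := by
    intro M
    induction M with
    | zero => intro _; exact mem_augFilt_zero.2 hx
    | succ M ih =>
      intro hM
      have h2 := augFilt_mul hD h1 (ih (by omega))
      rw [sub_mul, one_mul, add_comm] at h2
      have h3 := sub_mem (augFilt_le hD hM h) h2
      rwa [sub_sub_cancel] at h3
  exact key N le_rfl

theorem exists_smul_pow_sub_mem {u : H} (hu : u ∈ augFilt π 1) (hu2 : u ∉ augFilt π 2) {M : ℕ}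
    {y : H} (hy : y ∈ augFilt π M) : ∃ c : k, y - c • u ^ M ∈ augFilt π (M + 1) := by
  induction M generalizing y with
  | zero =>
    refine ⟨Coalgebra.counit (R := k) y, ?_⟩
    rw [mem_augFilt_zero] at hy
    rw [zero_add, mem_augFilt_one]
    simp [hy]
  | succ M ih =>
    refine augFilt_succ_induction
      (p := fun y => ∃ c : k, y - c • u ^ (M + 1) ∈ augFilt π (M + 1 + 1)) hy
      (fun a ha b hb => ?_) ?_
    · obtain ⟨c, hc⟩ := exists_smul_sub_mem hD hu hu2 ha
      obtain ⟨c', hc'⟩ := ih hb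
      refine ⟨c * c', ?_⟩
      have h1 := augFilt_mul hD hc hb
      have h2 := augFilt_mul hD hu hc'
      have h3 : a * b - (c * c') • u ^ (M + 1) =
          (a - c • u) * b + c • (u * (b - c' • u ^ M)) := by
        rw [sub_mul, mul_sub, smul_sub, mul_smul_comm, smul_smul, smul_mul_assoc, pow_succ']
        abel
      rw [h3]
      refine add_mem ?_ (Submodule.smul_mem _ _ ?_)
      · rwa [show M + 1 + 1 = 2 + M by ring]
      · rwa [show M + 1 + 1 = 1 + (M + 1) by ring]
    · rintro a b ⟨c, hc⟩ ⟨c', hc'⟩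
      refine ⟨c + c', ?_⟩
      rw [add_smul, add_sub_add_comm]
      exact add_mem hc hc'

/-- Modulo each power of the augmentation ideal, the left component is spanned by the powers
of a uniformizer. -/
theorem exists_sum_pow_sub_mem {u : H} (hu : u ∈ augFilt π 1) (hu2 : u ∉ augFilt π 2) (N : ℕ)
    {x : H} (hx : lWind π x = x) :
    ∃ c : ℕ → k, x - ∑ i ∈ Finset.range N, c i • u ^ i ∈ augFilt π N := by
  induction N with
  | zero => exact ⟨0, by rw [mem_augFilt_zero]; simpa using hx⟩
  | succ N ih =>
    obtain ⟨c, hc⟩ := ih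
    obtain ⟨c', hc'⟩ := exists_smul_pow_sub_mem hD hu hu2 hc
    refine ⟨Function.update c N c', ?_⟩
    rw [Finset.sum_range_succ, Function.update_self, ← sub_sub]
    convert hc' using 3
    refine Finset.sum_congr rfl fun i hi => ?_
    rw [Function.update_of_ne (Finset.mem_range.1 hi).ne]

end AugFiltration

/-! ### Transport to the left component and the bihomogeneous uniformizer -/

section Frame

variable {k : Type v} {H : Type u} [Field k] [Ring H] [HopfAlgebra k H]

/-- A tame character whose left component is Dedekind, with a normalised element `h` of
bidegree `(1, 1)`. -/
structure Frame (π : H →ₐ[k] k) (ζ : k) (n : ℕ) (h : H) : Prop extends TameCharacter π ζ n where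
  dedekind : IsDedekind (leftComponent π)
  mem : h ∈ biPiece π ζ 1 1
  counit_h : Coalgebra.counit (R := k) h = 1

/-- The projector is a polynomial in a left slice, so it acts on the left leg of Δ only. -/
theorem comul_lProj (π : H →ₐ[k] k) (ζ : k) (n : ℕ) (i : ℤ) (a : H) :
    Coalgebra.comul (R := k) (lProj π ζ n i a) =
      (lProj π ζ n i).rTensor H (Coalgebra.comul a) := by
  let T' : Module.End k (H ⊗[k] H) := (lWind π).toLinearMap.rTensor H
  have h1 : Coalgebra.comul (R := k) (lProj π ζ n i a) =
      eigenProj T' ζ n i (Coalgebra.comul a) :=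
    eigenProj_comm (T := (lWind π).toLinearMap) (T' := T') Coalgebra.comul
      (fun x => comul_lSlice π.toLinearMap x) i a
  rw [h1]
  induction (Coalgebra.comul (R := k) a) with
  | zero => simp
  | tmul x y =>
    exact (eigenProj_comm (T := (lWind π).toLinearMap) (T' := T') ((TensorProduct.mk k H H).flip y)
      (fun x => rfl) i x).symm
  | add x y hx hy => simp only [map_add, hx, hy]

namespace Frame

variable {π : H →ₐ[k] k} {ζ : k} {n : ℕ} {h : H} (F : Frame π ζ n h)

include F

theorem h_pow_mem (N : ℕ) : h ^ N ∈ biPiece π ζ N N := by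
  simpa using F.pow_mem F.mem N

theorem counit_h_pow (N : ℕ) : Coalgebra.counit (R := k) (h ^ N) = 1 := by
  simp [F.counit_h]

theorem exists_neg (i : ℤ) : ∃ N : ℕ, (n : ℤ) ∣ N + i := by
  have hn : (n : ℤ) ≠ 0 := by exact_mod_cast F.pos.ne'
  refine ⟨((-i) % n).toNat, ?_⟩
  rw [Int.toNat_of_nonneg (Int.emod_nonneg _ hn)]
  have h1 := Int.emod_add_mul_ediv (-i) n
  exact ⟨-((-i) / n), by linarith⟩

/-- This is how a general piece is moved into the left component, where Dedekind arithmetic applies;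
`h_pow_cancel` moves the conclusion back. -/
theorem h_pow_mul_left {N : ℕ} {i j : ℤ} {x : H} (hx : x ∈ biPiece π ζ i j)
    (hN : (n : ℤ) ∣ N + i) : h ^ N * x ∈ biPiece π ζ 0 (j - i) := by
  have h1 := F.mul_mem (F.h_pow_mem N) hx
  rwa [F.biPiece_congr (i' := 0) (j' := j - i) (by simpa using hN)
    (by convert hN using 1; ring)] at h1

theorem lWind_h_pow_mul {N : ℕ} {i : ℤ} {x : H} (hx : lWind π x = ζ ^ i • x)
    (hN : (n : ℤ) ∣ N + i) : lWind π (h ^ N * x) = h ^ N * x := by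
  rw [map_mul, (F.h_pow_mem N).1, hx, smul_mul_smul_comm, ← zpow_add₀ F.zeta_ne,
    F.zpow_congr (j := 0) (by simpa using hN), zpow_zero, one_smul]

/-- Write 1 = ∑ a S(b), where Δ(h^N) = ∑ a ⊗ b and every a has left weight -i. Each x a then lies in
the left component, a domain, and d x a = 0 gives x a = 0; summing against S(b) gives x = 0. -/
theorem left_torsionFree {i : ℤ} {d x : H} (hd : lWind π d = d) (hd0 : d ≠ 0)
    (hx : lWind π x = ζ ^ i • x) (h0 : d * x = 0) : x = 0 := by
  obtain ⟨N, hN⟩ := F.exists_neg i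
  let Λ : H ⊗[k] H →ₗ[k] H := LinearMap.mul' k H ∘ₗ (HopfAlgebra.antipode k).lTensor H
  have h1 : Λ (Coalgebra.comul (R := k) (h ^ N)) = 1 := by
    have := HopfAlgebra.mul_antipode_lTensor_comul_apply (R := k) (h ^ N)
    rw [F.counit_h_pow, map_one] at this
    exact this
  have h2 : lProj π ζ n (-i) (h ^ N) = h ^ N := by
    rw [F.lProj_eigen (F.h_pow_mem N).1, if_pos (by simpa using hN)]
  have h3 : ∀ t : H ⊗[k] H, x * Λ ((lProj π ζ n (-i)).rTensor H t) = 0 := by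
    intro t
    induction t with
    | zero => simp
    | add s t hs ht => rw [map_add, map_add, mul_add, hs, ht, add_zero]
    | tmul a b =>
      have h4 : lWind π (x * lProj π ζ n (-i) a) = x * lProj π ζ n (-i) a := by
        rw [map_mul, hx, F.lWind_lProj, smul_mul_smul_comm, ← zpow_add₀ F.zeta_ne]
        simp
      have h5 : d * (x * lProj π ζ n (-i) a) = 0 := by rw [← mul_assoc, h0, zero_mul]
      have h6 := (left_eq_zero_or F.dedekind hd h4 h5).resolve_left hd0
      simp [Λ, ← mul_assoc, h6]
  have h7 := h3 (Coalgebra.comul (h ^ N))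
  rwa [← comul_lProj, h2, h1, mul_one] at h7

/-- Raising the exponent to a multiple of `n` puts the power of h in the left component, where it is
nonzero because its counit is 1. -/
theorem h_pow_mul_ne_zero {i : ℤ} {x : H} (N : ℕ) (hx : lWind π x = ζ ^ i • x)
    (h0 : h ^ N * x = 0) : x = 0 := by
  have hN : N ≤ n * N := Nat.le_mul_of_pos_left _ F.pos
  have h1 : h ^ (n * N) * x = 0 := by
    rw [← Nat.sub_add_cancel hN, pow_add, mul_assoc, h0, mul_zero]
  refine F.left_torsionFree ?_ ?_ hx h1
  · rw [(F.h_pow_mem _).1, F.zpow_congr (j := 0) (by simp), zpow_zero, one_smul]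
  · intro h2
    have := F.counit_h_pow (n * N)
    rw [h2, map_zero] at this
    exact zero_ne_one this

theorem h_pow_cancel {i : ℤ} {x y : H} (N : ℕ) (hx : lWind π x = ζ ^ i • x)
    (hy : lWind π y = ζ ^ i • y) (h0 : h ^ N * x = h ^ N * y) : x = y := by
  rw [← sub_eq_zero]
  refine F.h_pow_mul_ne_zero (i := i) N ?_ ?_
  · rw [map_sub, hx, hy, smul_sub]
  · rw [mul_sub, h0, sub_self]

omit F in
theorem rProj_mem_augFilt {N : ℕ} (j : ℤ) {x : H} (hx : x ∈ augFilt π N) :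
    rProj π ζ n j x ∈ augFilt π N :=
  eigenProj_mem (T := (rWind π).toLinearMap) (fun _ h => rWind_mem_augFilt h) j hx

/-- A bihomogeneous uniformizer exists, and its powers determine the nonzero graded pieces. -/
theorem exists_uniformizer (hne : ∃ x ∈ augFilt π 1, x ≠ 0) :
    ∃ j : ℤ, ∃ u ∈ biPiece π ζ 0 j, u ∈ augFilt π 1 ∧ u ∉ augFilt π 2 := by
  obtain ⟨u, hu, hu2⟩ := exists_notMem_augFilt_two F.dedekind hne
  by_contra hcon
  push Not at hcon
  refine hu2 ?_
  -- The filtration is stable under the right projectors, so if every homogeneous component of u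
  -- were in the second step, u would be too.
  rw [← F.sum_rProj u]
  refine sum_mem fun j _ => hcon j _ (F.rProj_mem ?_) (rProj_mem_augFilt _ hu)
  rw [zpow_zero, one_smul]
  exact lWind_of_mem_augFilt hu

/-- Expand x in powers of u modulo m^N and project to weight j. No power of u survives, so x lies in
every m^N. -/
theorem eq_zero_of_not_multiple {j0 : ℤ} {u : H} (hu0 : u ∈ biPiece π ζ 0 j0)
    (hu : u ∈ augFilt π 1) (hu2 : u ∉ augFilt π 2) {j : ℤ} {x : H} (hx : x ∈ biPiece π ζ 0 j)
    (hj : ∀ i : ℕ, ¬ (n : ℤ) ∣ i * j0 - j) : x = 0 := by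
  have hxl : lWind π x = x := by simpa using hx.1
  refine eq_zero_of_mem_augFilt F.dedekind fun N => ?_
  obtain ⟨c, hc⟩ := exists_sum_pow_sub_mem F.dedekind hu hu2 N hxl
  have h1 := rProj_mem_augFilt (ζ := ζ) (n := n) j hc
  rw [map_sub, F.rProj_eigen hx.2, if_pos (by simp), map_sum, Finset.sum_eq_zero, sub_zero] at h1
  · exact h1
  · intro i _
    rw [map_smul, F.rProj_eigen (F.pow_mem hu0 i).2, if_neg (hj i), smul_zero]

-- The witness is n / gcd(j, n), the additive order of j mod `n`.
omit F in
theorem exists_nat_annihilating (n : ℕ) (h : 0 < n) (j : ℤ) : ∃ e : ℕ, (n : ℤ) ∣ e * j ∧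
    (n ∣ e → IsCoprime j (n : ℤ)) := by
  have hg : 0 < Int.gcd j n := Int.gcd_pos_of_ne_zero_right _ (by exact_mod_cast h.ne')
  obtain ⟨a, ha⟩ := Int.gcd_dvd_left j n
  obtain ⟨b, hb⟩ : Int.gcd j n ∣ n := by exact_mod_cast Int.gcd_dvd_right j n
  refine ⟨b, ⟨a, ?_⟩, fun hd => ?_⟩
  · conv_lhs => rw [ha]
    conv_rhs => rw [hb]
    push_cast
    ring
  · rw [Int.isCoprime_iff_gcd_eq_one]
    have hb0 : 0 < b := Nat.pos_of_ne_zero fun h0 => h.ne' (by rw [hb, h0, mul_zero])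
    have h1 : Int.gcd j n * b ∣ 1 * b := by rw [← hb, one_mul]; exact hd
    exact Nat.eq_one_of_dvd_one (Nat.dvd_of_mul_dvd_mul_right hb0 h1)

/-- The character is recovered from its winding by applying the counit. -/
theorem lWind_pow_eq_one {e : ℕ} (he : ((lWind π) ^ e) = 1) : n ∣ e := by
  rw [← F.order]
  refine orderOf_dvd_of_pow_eq_one ?_
  apply WithConv.ofConv_injective
  ext x
  have h1 := lWindHom_pow π e x
  have h2 : (((lWind π).toLinearMap : Module.End k H) ^ e) x = x := by
    have h3 : ∀ m : ℕ, (((lWind π).toLinearMap : Module.End k H) ^ m) x = ((lWind π) ^ m) x := by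
      intro m
      induction m with
      | zero => rfl
      | succ m ih => rw [pow_succ', pow_succ', Module.End.mul_apply, ih]; rfl
    rw [h3, he]
    rfl
  rw [h2] at h1
  exact (counit_lSlice (AlgHom.toLinearMap
    ((WithConv.toConv π : WithConv (H →ₐ[k] k)) ^ e).ofConv) x).symm.trans
      (congrArg (Coalgebra.counit (R := k)) h1)

omit F in
theorem algEquiv_pow_of_eigen {f : H ≃ₐ[k] H} {c : k} {x : H} (hx : f x = c • x) (e : ℕ) :
    (f ^ e) x = c ^ e • x := by
  induction e with
  | zero => simp
  | succ e ih => rw [pow_succ', AlgEquiv.mul_apply, ih, map_smul, hx, smul_smul, ← pow_succ]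

/-- On a nonzero H_ij the `e`th powers of the windings differ by ζ^(e(j-i)), and h^N carries H_ij
injectively into H_{0,j-i}. So the two powers coincide and lie in the trivial intersection. -/
theorem dvd_of_weights (hinf : lWindGroup π ⊓ rWindGroup π = ⊥) {e : ℕ}
    (he : ∀ j : ℤ, ∀ x ∈ biPiece π ζ 0 j, x ≠ 0 → (n : ℤ) ∣ e * j) : n ∣ e := by
  refine F.lWind_pow_eq_one ?_
  have h1 : (lWind π) ^ e = (rWind π) ^ e := by
    ext x
    refine F.homogeneous_induction x (p := fun x => ((lWind π) ^ e) x = ((rWind π) ^ e) x)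
      (fun i j y hy => ?_) (by simp) (fun y z hy hz => by rw [map_add, map_add, hy, hz])
    by_cases hy0 : y = 0
    · simp [hy0]
    obtain ⟨N, hN⟩ := F.exists_neg i
    have h2 := he _ _ (F.h_pow_mul_left hy hN) fun h0 => hy0 (F.h_pow_mul_ne_zero N hy.1 h0)
    rw [algEquiv_pow_of_eigen hy.1, algEquiv_pow_of_eigen hy.2, ← zpow_natCast, ← zpow_natCast,
      ← zpow_mul, ← zpow_mul]
    rw [F.zpow_congr (i := i * e) (j := j * e)]
    have h3 : i * (e : ℤ) - j * e = -(e * (j - i)) := by ring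
    rwa [h3, dvd_neg]
  have h2 : (lWind π) ^ e ∈ lWindGroup π ⊓ rWindGroup π :=
    ⟨Subgroup.npow_mem_zpowers _ _, h1 ▸ Subgroup.npow_mem_zpowers _ _⟩
  rwa [hinf, Subgroup.mem_bot] at h2

/-- The intersection condition makes the weight of a uniformizer primitive. -/
theorem isCoprime_weight (hinf : lWindGroup π ⊓ rWindGroup π = ⊥) {j0 : ℤ} {u : H}
    (hu0 : u ∈ biPiece π ζ 0 j0) (hu : u ∈ augFilt π 1) (hu2 : u ∉ augFilt π 2) :
    IsCoprime j0 (n : ℤ) := by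
  obtain ⟨e, he, hcop⟩ := exists_nat_annihilating n F.pos j0
  refine hcop (F.dvd_of_weights hinf fun j x hx hx0 => ?_)
  by_contra hj
  refine hx0 (F.eq_zero_of_not_multiple hu0 hu hu2 hx fun i hi => hj ?_)
  have h1 : (n : ℤ) ∣ e * j0 * i - e * (i * j0 - j) :=
    dvd_sub (he.mul_right _) (hi.mul_left _)
  convert h1 using 1
  ring

/-- If m = 0 the left component is just the scalars, so 0 is its only weight, and `dvd_of_weights`
with exponent 1 would give n ∣ 1. -/
theorem exists_mem_augFilt_one (hn : 1 < n) (hinf : lWindGroup π ⊓ rWindGroup π = ⊥) :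
    ∃ x ∈ augFilt π 1, x ≠ 0 := by
  by_contra hcon
  push Not at hcon
  refine hn.not_ge (Nat.le_of_dvd one_pos (F.dvd_of_weights hinf fun j x hx hx0 => ?_))
  have hxl : lWind π x = x := by simpa using hx.1
  have h1 := hcon (x - algebraMap k H (Coalgebra.counit (R := k) x))
    (mem_augFilt_one.2 (by simp [hxl]))
  by_contra hj
  refine hx0 (F.eq_zero_of_mem (j' := 0) hx (i' := 0) ?_ (by simpa using hj))
  rw [sub_eq_zero.1 h1, Algebra.algebraMap_eq_smul_one]
  exact Submodule.smul_mem _ _ one_mem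

end Frame

/-- A frame together with a bihomogeneous uniformizer of weight one. -/
structure UniformizedFrame (π : H →ₐ[k] k) (ζ : k) (n : ℕ) (h u : H) : Prop
    extends Frame π ζ n h where
  one_lt : 1 < n
  mem_u : u ∈ biPiece π ζ 0 1
  u_mem : u ∈ augFilt π 1
  u_notMem : u ∉ augFilt π 2

theorem exists_uniformizedFrame [IsAlgClosed k] (π : H →ₐ[k] k) (n : ℕ) [NeZero n]
    (hH : StandingHypotheses π n) (hcard : 1 < Nat.card (lWindGroup π))
    (hinf : lWindGroup π ⊓ rWindGroup π = ⊥) :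
    ∃ (ζ : k) (h u : H), UniformizedFrame π ζ n h u := by
  have hcast : (n : k) ≠ 0 := by
    intro h0
    have h1 : ringChar k ∣ n := (ringChar.spec k n).1 h0
    have hpos : 0 < ringChar k := Nat.pos_of_ne_zero fun h2 =>
      NeZero.ne n (Nat.eq_zero_of_zero_dvd (h2 ▸ h1))
    have h2 := hH.coprime_char (ringChar k) inferInstance hpos
    have h3 : ringChar k = 1 := h2.symm.eq_one_of_dvd h1
    exact CharP.ringChar_ne_one h3
  have : NeZero (n : k) := ⟨hcast⟩
  obtain ⟨ζ, hζ⟩ := HasEnoughRootsOfUnity.exists_primitiveRoot k n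
  have hT : TameCharacter π ζ n := ⟨hζ, hcast, hH.order⟩
  obtain ⟨h, hh, hε⟩ := hT.exists_unit_degree
  have F : Frame π ζ n h := ⟨hT, hH.dedekind, hh, hε⟩
  have hn : 1 < n := by
    refine lt_of_le_of_ne NeZero.one_le fun h1 => hcard.ne' ?_
    have h2 : lWind π = 1 := by
      ext x
      have := hT.lWind_pow
      rw [← h1, pow_one] at this
      exact LinearMap.congr_fun this x
    rw [lWindGroup, h2]
    simp
  obtain ⟨j, u, hu0, hu, hu2⟩ := F.exists_uniformizer (F.exists_mem_augFilt_one hn hinf)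
  have hcop := F.isCoprime_weight hinf hu0 hu hu2
  -- Replacing ζ by ζ^j gives u weight 1; h must be chosen again, since bidegree (1, 1) now refers
  -- to the new root.
  have hT' : TameCharacter π (ζ ^ j) n :=
    ⟨hζ.zpow_of_gcd_eq_one j (Int.isCoprime_iff_gcd_eq_one.1 hcop), hcast, hH.order⟩
  obtain ⟨h', hh', hε'⟩ := hT'.exists_unit_degree
  refine ⟨ζ ^ j, h', u, ⟨⟨hT', hH.dedekind, hh', hε'⟩, hn, ?_, hu, hu2⟩⟩
  rw [mem_biPiece] at *
  simpa using hu0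

end Frame

/-! ### Commutation of h with the left component -/

section Commutation

variable {k : Type v} {H : Type u} [Field k] [Ring H] [HopfAlgebra k H]

namespace UniformizedFrame

variable {π : H →ₐ[k] k} {ζ : k} {n : ℕ} {h u : H} (F : UniformizedFrame π ζ n h u)

include F

theorem lWind_h_pow_n : lWind π (h ^ n) = h ^ n := by
  rw [(F.h_pow_mem n).1, F.zpow_congr (j := 0) (by simp), zpow_zero, one_smul]

omit F in
/-- Twisted conjugation by `h`. -/
def twistConj (h : H) (n : ℕ) : Module.End k H :=
  LinearMap.mulLeft k (h ^ (n - 1)) * LinearMap.mulRight k h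

omit F in
theorem twistConj_apply (x : H) : twistConj (k := k) h n x = h ^ (n - 1) * x * h := by
  simp [twistConj, mul_assoc]

theorem twistConj_mem {j : ℤ} {x : H} (hx : x ∈ biPiece π ζ 0 j) :
    twistConj (k := k) h n x ∈ biPiece π ζ 0 j := by
  rw [twistConj_apply]
  have h1 := F.mul_mem (F.mul_mem (F.h_pow_mem (n - 1)) hx) F.mem
  have h2 : ((n - 1 : ℕ) : ℤ) = n - 1 := by rw [Nat.cast_sub F.pos]; simp
  rwa [F.biPiece_congr (i' := 0) (j' := j) (by simp [h2]) ⟨1, by rw [h2]; ring⟩] at h1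

theorem lWind_twistConj {x : H} (hx : lWind π x = x) :
    lWind π (twistConj (k := k) h n x) = twistConj (k := k) h n x := by
  rw [twistConj_apply, map_mul, map_mul, hx, (F.h_pow_mem (n - 1)).1, F.mem.1,
    smul_mul_assoc, smul_mul_smul_comm, ← zpow_add₀ F.zeta_ne, F.zpow_congr (j := 0), zpow_zero,
    one_smul]
  rw [Nat.cast_sub F.pos]
  simp

theorem counit_twistConj (x : H) :
    Coalgebra.counit (R := k) (twistConj (k := k) h n x) = Coalgebra.counit (R := k) x := by
  rw [twistConj_apply, Bialgebra.counit_mul, Bialgebra.counit_mul, F.counit_h_pow, F.counit_h]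
  simp

/-- h^(n-1) stands in for an inverse of h, which is not available. Multiplicativity therefore fails
by h · h^(n-1) = h^n, which commutes with the left component and is ≡ 1 modulo m. -/
theorem h_pow_n_mul_twistConj {x y : H} (hx : lWind π x = x) :
    h ^ n * twistConj (k := k) h n (x * y) =
      twistConj (k := k) h n x * twistConj (k := k) h n y := by
  have h1 : h * h ^ (n - 1) = h ^ n := by rw [← pow_succ', Nat.sub_add_cancel F.pos]
  have h2 := left_comm F.dedekind hx F.lWind_h_pow_n
  have h3 : h ^ (n - 1) * x * h * (h ^ (n - 1) * y * h) =
      h ^ (n - 1) * (x * (h * h ^ (n - 1))) * y * h := by noncomm_ring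
  rw [twistConj_apply, twistConj_apply, twistConj_apply, h3, h1, h2]
  have h4 : h ^ n * h ^ (n - 1) = h ^ (n - 1) * h ^ n := by rw [← pow_add, ← pow_add, add_comm]
  rw [← mul_assoc, ← mul_assoc, ← mul_assoc, ← mul_assoc, h4]

theorem h_pow_n_mul_sub_mem (m : ℕ) {N : ℕ} {x : H} (hx : x ∈ augFilt π N) :
    (h ^ n) ^ m * x - x ∈ augFilt π (N + 1) := by
  have h1 : (h ^ n) ^ m - 1 ∈ augFilt π 1 := by
    rw [mem_augFilt_one]
    constructor
    · rw [map_sub, Bialgebra.counit_pow, F.counit_h_pow]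
      simp
    · rw [map_sub, map_pow, F.lWind_h_pow_n, map_one]
  have h2 := augFilt_mul F.dedekind h1 hx
  rwa [sub_mul, one_mul, add_comm] at h2

theorem twistConj_mem_augFilt {N : ℕ} {x : H} (hx : x ∈ augFilt π N) :
    twistConj (k := k) h n x ∈ augFilt π N := by
  have hone : ∀ x ∈ augFilt π 1, twistConj (k := k) h n x ∈ augFilt π 1 := by
    intro x hx
    rw [mem_augFilt_one] at hx ⊢
    exact ⟨by rw [F.counit_twistConj, hx.1], F.lWind_twistConj hx.2⟩
  induction N generalizing x with
  | zero =>
    rw [mem_augFilt_zero] at hx ⊢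
    exact F.lWind_twistConj hx
  | succ N ih =>
    refine augFilt_succ_induction (p := fun x => twistConj (k := k) h n x ∈ augFilt π (N + 1)) hx
      (fun a ha b hb => ?_) fun a b ha hb => by rw [map_add]; exact add_mem ha hb
    -- Multiplying by h^n makes the operator multiplicative, and the factor can be cancelled because
    -- its counit is 1.
    refine mem_augFilt_of_mul_mem F.dedekind F.lWind_h_pow_n (F.counit_h_pow n) ?_ ?_
    · refine F.lWind_twistConj ?_
      rw [map_mul, lWind_of_mem_augFilt ha, lWind_of_mem_augFilt hb]
    · rw [F.h_pow_n_mul_twistConj (lWind_of_mem_augFilt ha), add_comm]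
      exact augFilt_mul F.dedekind (hone a ha) (ih hb)

/-- Acting by ξ on m/m² and being multiplicative up to h^n ≡ 1, the operator acts by ξ^N on
m^N/m^(N+1). -/
theorem twistConj_sub_mem {ξ : k} (hξ : twistConj (k := k) h n u - ξ • u ∈ augFilt π 2) {N : ℕ}
    {x : H} (hx : x ∈ augFilt π N) :
    twistConj (k := k) h n x - ξ ^ N • x ∈ augFilt π (N + 1) := by
  have hone : ∀ x ∈ augFilt π 1, twistConj (k := k) h n x - ξ • x ∈ augFilt π 2 := by
    intro x hx
    obtain ⟨c, hc⟩ := exists_smul_sub_mem F.dedekind F.u_mem F.u_notMem hx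
    have h1 := F.twistConj_mem_augFilt hc
    have h2 : twistConj (k := k) h n x - ξ • x = twistConj (k := k) h n (x - c • u) -
        ξ • (x - c • u) + c • (twistConj (k := k) h n u - ξ • u) := by
      rw [map_sub, map_smul]
      module
    rw [h2]
    exact add_mem (sub_mem h1 (Submodule.smul_mem _ _ hc)) (Submodule.smul_mem _ _ hξ)
  induction N generalizing x with
  | zero =>
    rw [mem_augFilt_zero] at hx
    rw [zero_add, mem_augFilt_one, pow_zero, one_smul, map_sub, map_sub, F.counit_twistConj,
      F.lWind_twistConj hx, hx, sub_self]
    exact ⟨rfl, rfl⟩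
  | succ N ih =>
    refine augFilt_succ_induction
      (p := fun x => twistConj (k := k) h n x - ξ ^ (N + 1) • x ∈ augFilt π (N + 1 + 1)) hx
      (fun a ha b hb => ?_) fun a b ha hb => ?_
    · have hab : a * b ∈ augFilt π (N + 1) := by
        rw [add_comm]; exact augFilt_mul F.dedekind ha hb
      have h1 := F.h_pow_n_mul_sub_mem 1 (F.twistConj_mem_augFilt hab)
      rw [pow_one, F.h_pow_n_mul_twistConj (lWind_of_mem_augFilt ha)] at h1
      have h2 := augFilt_mul F.dedekind (hone a ha) (F.twistConj_mem_augFilt hb)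
      have h3 := augFilt_mul F.dedekind ha (ih hb)
      rw [show 2 + N = N + 1 + 1 by ring] at h2
      rw [show 1 + (N + 1) = N + 1 + 1 by ring] at h3
      have h4 := sub_mem (add_mem h2 (Submodule.smul_mem _ ξ h3)) h1
      convert h4 using 1
      rw [sub_mul, mul_sub, mul_smul_comm, smul_mul_assoc, smul_sub, smul_smul, ← pow_succ']
      abel
    · rw [map_add, smul_add, add_sub_add_comm]
      exact add_mem ha hb

/-- The `n`th power has n(n-1) factors h on the left and n on the right; those on the right form
h^n, which commutes with x. -/
theorem twistConj_pow_n {x : H} (hx : lWind π x = x) :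
    ((twistConj (k := k) h n) ^ n) x = (h ^ n) ^ n * x := by
  have h1 : ∀ m : ℕ, ((twistConj (k := k) h n) ^ m) x = h ^ ((n - 1) * m) * x * h ^ m := by
    intro m
    induction m with
    | zero => simp
    | succ m ih =>
      rw [pow_succ', Module.End.mul_apply, ih, twistConj_apply, mul_add, mul_one, pow_add,
        pow_succ h m, ← mul_assoc, ← mul_assoc, ← mul_assoc, ← pow_add, ← pow_add, add_comm]
  rw [h1, mul_assoc, left_comm F.dedekind hx F.lWind_h_pow_n, ← mul_assoc, ← pow_add, ← pow_mul]
  congr 2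
  obtain ⟨m, rfl⟩ : ∃ m, n = m + 1 := ⟨n - 1, (Nat.sub_add_cancel F.pos).symm⟩
  simp
  ring

/-- An operator congruent to the identity on each step of the filtration and whose `n`th power
is multiplication by `(h ^ n) ^ n` is multiplication by `h ^ n`. -/
theorem exists_commutation : ∃ ξ : k, ξ ^ n = 1 ∧ ∀ (j : ℤ) (x : H), x ∈ biPiece π ζ 0 j →
    x * h = ξ ^ j • (h * x) := by
  obtain ⟨ξ, hξ⟩ := exists_smul_sub_mem F.dedekind F.u_mem F.u_notMem
    (F.twistConj_mem_augFilt F.u_mem)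
  have hul : lWind π u = u := lWind_of_mem_augFilt F.u_mem
  -- The `n`th iterate is multiplication by (h^n)^n, which is trivial on m/m², whereas it acts there
  -- by ξ^n.
  have hξn : ξ ^ n = 1 := by
    have h1 : ∀ m : ℕ, ((twistConj (k := k) h n) ^ m) u - ξ ^ m • u ∈ augFilt π 2 := by
      intro m
      induction m with
      | zero => simp
      | succ m ih =>
        have h2 := F.twistConj_mem_augFilt ih
        have h3 := add_mem h2 (Submodule.smul_mem _ (ξ ^ m) hξ)
        convert h3 using 1
        rw [pow_succ', Module.End.mul_apply, map_sub, map_smul, smul_sub, smul_smul, ← pow_succ]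
        abel
    have h2 := h1 n
    rw [F.twistConj_pow_n hul] at h2
    have h3 := sub_mem h2 (F.h_pow_n_mul_sub_mem n F.u_mem)
    by_contra hne
    refine F.u_notMem ?_
    have h4 : (h ^ n) ^ n * u - ξ ^ n • u - ((h ^ n) ^ n * u - u) = (1 - ξ ^ n) • u := by module
    rw [h4] at h3
    have h5 := Submodule.smul_mem _ (1 - ξ ^ n)⁻¹ h3
    rwa [smul_smul, inv_mul_cancel₀ (sub_ne_zero.2 (Ne.symm hne)), one_smul] at h5
  have hξ0 : ξ ≠ 0 := by
    rintro rfl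
    rw [zero_pow F.pos.ne'] at hξn
    exact zero_ne_one hξn
  have hξcongr : ∀ {i j : ℤ}, (n : ℤ) ∣ i - j → ξ ^ i = ξ ^ j := by
    rintro i j ⟨m, hm⟩
    rw [show i = j + n * m by linarith, zpow_add₀ hξ0, zpow_mul, zpow_natCast, hξn, one_zpow,
      mul_one]
  refine ⟨ξ, hξn, fun j x hx => ?_⟩
  have hxl : lWind π x = x := by simpa using hx.1
  -- The goal is C x = T x. Both operators have the same `n`th power on x, so z = (C - T) x is
  -- killed by the cofactor ∑ C^i T^(n-1-i).
  let T : Module.End k H := (ξ ^ (-j)) • twistConj (k := k) h n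
  let C : Module.End k H := LinearMap.mulLeft k (h ^ n)
  have hCT : Commute C T := by
    ext y
    have h4 : h ^ n * h ^ (n - 1) = h ^ (n - 1) * h ^ n := by rw [← pow_add, ← pow_add, add_comm]
    simp only [T, C, Module.End.mul_apply, LinearMap.smul_apply, twistConj_apply,
      LinearMap.mulLeft_apply, mul_smul_comm]
    rw [← mul_assoc, ← mul_assoc, ← mul_assoc, h4]
  have hTmem : ∀ {y}, y ∈ biPiece π ζ 0 j → T y ∈ biPiece π ζ 0 j := fun hy =>
    Submodule.smul_mem _ _ (F.twistConj_mem hy)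
  have hCmem : ∀ {y}, y ∈ biPiece π ζ 0 j → C y ∈ biPiece π ζ 0 j := fun hy => by
    have := F.mul_mem (F.h_pow_mem n) hy
    rwa [F.biPiece_congr (i' := 0) (j' := j) (by simp) (by simp)] at this
  set z : H := (C - T) x with hz
  have hzmem : z ∈ biPiece π ζ 0 j := by
    rw [hz, LinearMap.sub_apply]
    exact sub_mem (hCmem hx) (hTmem hx)
  have hE : (∑ i ∈ Finset.range n, C ^ i * T ^ (n - 1 - i)) z = 0 := by
    rw [hz, ← Module.End.mul_apply, hCT.geom_sum₂_mul]
    have h1 : (T ^ n) x = (h ^ n) ^ n * x := by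
      rw [smul_pow, LinearMap.smul_apply, F.twistConj_pow_n hxl, ← zpow_natCast, ← zpow_mul,
        mul_comm, zpow_mul, zpow_natCast, hξn, one_zpow, one_smul]
    have h2 : (C ^ n) x = (h ^ n) ^ n * x := by
      rw [LinearMap.pow_mulLeft]
      rfl
    rw [LinearMap.sub_apply, h1, h2, sub_self]
  have hz0 : z = 0 := by
    refine eq_zero_of_mem_augFilt F.dedekind fun N => ?_
    induction N with
    | zero => rw [mem_augFilt_zero]; simpa using hzmem.1
    | succ N ih =>
      obtain ⟨c, hc⟩ := exists_smul_pow_sub_mem F.dedekind F.u_mem F.u_notMem ih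
      -- If N ≡ j, both C and T are the identity on m^N/m^(N+1), so the cofactor acts there as the
      -- invertible scalar n. Otherwise the leading term of z, a multiple of u^N, has the wrong
      -- right weight and must vanish.
      by_cases hN : (n : ℤ) ∣ N - j
      · have hTsub : ∀ y ∈ augFilt π N, T y - y ∈ augFilt π (N + 1) := by
          intro y hy
          have h1 := Submodule.smul_mem _ (ξ ^ (-j)) (F.twistConj_sub_mem hξ hy)
          rw [smul_sub, smul_smul, ← zpow_natCast, ← zpow_add₀ hξ0,
            hξcongr (i := -j + N) (j := 0) (by convert hN using 1; ring), zpow_zero, one_smul] at h1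
          exact h1
        have hCsub : ∀ y ∈ augFilt π N, C y - y ∈ augFilt π (N + 1) := by
          intro y hy
          have := F.h_pow_n_mul_sub_mem 1 hy
          rwa [pow_one] at this
        have hpow : ∀ (S : Module.End k H), (∀ y ∈ augFilt π N, S y - y ∈ augFilt π (N + 1)) →
            ∀ (m : ℕ), ∀ y ∈ augFilt π N, (S ^ m) y - y ∈ augFilt π (N + 1) := by
          intro S hS m
          induction m with
          | zero => intro y _; simp
          | succ m ihm =>
            intro y hy
            have h1 := ihm y hy
            have h2 : (S ^ m) y ∈ augFilt π N := by
              have := add_mem (augFilt_le F.dedekind (Nat.le_succ N) h1) hy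
              rwa [sub_add_cancel] at this
            have h3 := add_mem (hS _ h2) h1
            rwa [sub_add_sub_cancel, ← Module.End.mul_apply, ← pow_succ'] at h3
        have hsum : (∑ i ∈ Finset.range n, C ^ i * T ^ (n - 1 - i)) z - (n : k) • z ∈
            augFilt π (N + 1) := by
          have h1 : (∑ i ∈ Finset.range n, C ^ i * T ^ (n - 1 - i)) z - (n : k) • z =
              ∑ i ∈ Finset.range n, ((C ^ i * T ^ (n - 1 - i)) z - z) := by
            rw [Finset.sum_sub_distrib, LinearMap.sum_apply, Finset.sum_const, Finset.card_range,
              Nat.cast_smul_eq_nsmul]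
          rw [h1]
          refine sum_mem fun i _ => ?_
          have h2 := hpow T hTsub (n - 1 - i) z ih
          have h3 : (T ^ (n - 1 - i)) z ∈ augFilt π N := by
            have := add_mem (augFilt_le F.dedekind (Nat.le_succ N) h2) ih
            rwa [sub_add_cancel] at this
          have h4 := add_mem (hpow C hCsub i _ h3) h2
          rwa [sub_add_sub_cancel, ← Module.End.mul_apply] at h4
        rw [hE, zero_sub, neg_mem_iff] at hsum
        have := Submodule.smul_mem _ (n : k)⁻¹ hsum
        rwa [smul_smul, inv_mul_cancel₀ F.cast_ne, one_smul] at this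
      · have h1 := Frame.rProj_mem_augFilt (ζ := ζ) (n := n) j hc
        rwa [map_sub, map_smul, F.rProj_eigen hzmem.2, if_pos (by simp),
          F.rProj_eigen (F.pow_mem F.mem_u N).2, if_neg (by simpa using hN), smul_zero,
          sub_zero] at h1
  rw [hz, LinearMap.sub_apply, sub_eq_zero] at hz0
  have h1 : h ^ (n - 1) * (x * h) = h ^ (n - 1) * (ξ ^ j • (h * x)) := by
    have h2 : h ^ n * x = ξ ^ (-j) • (h ^ (n - 1) * x * h) := by
      have := hz0
      simpa [C, T, twistConj_apply] using this
    rw [mul_smul_comm, ← mul_assoc, ← mul_assoc, ← pow_succ, Nat.sub_add_cancel F.pos, h2,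
      smul_smul, ← zpow_add₀ hξ0]
    simp
  have hxh : lWind π (x * h) = ζ ^ (1 : ℤ) • (x * h) := by
    rw [map_mul, hxl, F.mem.1, mul_smul_comm]
  have hhx : lWind π (ξ ^ j • (h * x)) = ζ ^ (1 : ℤ) • ξ ^ j • (h * x) := by
    rw [map_smul, map_mul, hxl, F.mem.1, smul_mul_assoc, smul_comm]
  exact F.h_pow_cancel (n - 1) hxh hhx h1

end UniformizedFrame

end Commutation

/-! ### Twisted shift matrices -/

section ShiftMatrix

variable {k : Type*} [Field k] {R : Type*} [Ring R] [Algebra k R] {d : ℕ} [NeZero d]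

/-- The monomial matrix with entries `q ^ (j r) x` in the positions `(r, r + i)`. -/
def shiftMatrix (d : ℕ) [NeZero d] (q : k) (i j : ℤ) : R →ₗ[k] Matrix (ZMod d) (ZMod d) R where
  toFun x := Matrix.of fun r s => if s = r + i then q ^ (j * r.val) • x else 0
  map_add' x y := by
    ext r s
    simp only [Matrix.of_apply, Matrix.add_apply]
    split_ifs <;> simp
  map_smul' c x := by
    ext r s
    simp only [Matrix.of_apply, Matrix.smul_apply, RingHom.id_apply]
    split_ifs
    · rw [smul_comm]
    · simp

theorem shiftMatrix_apply (q : k) (i j : ℤ) (x : R) (r s : ZMod d) :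
    shiftMatrix d q i j x r s = if s = r + i then q ^ (j * r.val) • x else 0 := rfl

theorem zpow_congr_of_pow_eq_one {q : k} (hq0 : q ≠ 0) {d : ℕ} (hq : q ^ d = 1) {i j : ℤ}
    (h : (d : ℤ) ∣ i - j) : q ^ i = q ^ j := by
  obtain ⟨m, hm⟩ := h
  rw [show i = j + d * m by linarith, zpow_add₀ hq0, zpow_mul, zpow_natCast, hq, one_zpow, mul_one]

/-- The second factor is read in row r + i, so its entry contributes q^(j'(r+i)) and leaves behind
q^(i j'). Reduction of row indices mod `d` is harmless because q^d = 1. -/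
theorem shiftMatrix_mul {q : k} (hq0 : q ≠ 0) (hq : q ^ d = 1) (i j i' j' : ℤ) (x y : R) :
    shiftMatrix d q i j x * shiftMatrix d q i' j' y =
      q ^ (i * j') • shiftMatrix d q (i + i') (j + j') (x * y) := by
  ext r s
  rw [Matrix.mul_apply, Finset.sum_eq_single (r + i)]
  · rw [Matrix.smul_apply]
    simp only [shiftMatrix_apply, if_true]
    push_cast
    rw [add_assoc]
    split_ifs with hs
    · rw [smul_mul_smul_comm, smul_smul, ← zpow_add₀ hq0, ← zpow_add₀ hq0]
      congr 1
      refine zpow_congr_of_pow_eq_one hq0 hq ?_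
      have h1 : (d : ℤ) ∣ ((r + i : ZMod d).val : ℤ) - (r.val + i) := by
        rw [← ZMod.intCast_zmod_eq_zero_iff_dvd]; simp
      exact (h1.mul_left j').trans (dvd_of_eq (by ring))
    · simp
  · intro t _ ht
    rw [shiftMatrix_apply, if_neg ht, zero_mul]
  · intro h; exact absurd (Finset.mem_univ _) h

theorem shiftMatrix_congr {q : k} (hq0 : q ≠ 0) (hq : q ^ d = 1) {i j i' j' : ℤ}
    (hi : (d : ℤ) ∣ i - i') (hj : (d : ℤ) ∣ j - j') (x : R) :
    shiftMatrix d q i j x = shiftMatrix d q i' j' x := by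
  ext r s
  have h1 : (i : ZMod d) = i' := by
    rw [← sub_eq_zero, ← Int.cast_sub]
    exact (ZMod.intCast_zmod_eq_zero_iff_dvd _ d).2 hi
  rw [shiftMatrix_apply, shiftMatrix_apply, h1,
    zpow_congr_of_pow_eq_one hq0 hq (i := j * r.val) (j := j' * r.val)]
  rw [← sub_mul]
  exact hj.mul_right _

/-- Row 0 carries the factor q^0 = 1; this is what makes the twisted representation injective. -/
theorem sum_shiftMatrix_zero (q : k) (i j : ℤ) (x : R) :
    ∑ s, shiftMatrix d q i j x 0 s = x := by
  simp [shiftMatrix_apply]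

end ShiftMatrix

/-! ### Colour commutativity and the PI-degree -/

section Color

variable {k : Type v} {H : Type u} [Field k] [Ring H] [HopfAlgebra k H]

/-- A frame together with the commutation factor `ξ` of `h` with the left component. -/
structure ColorFrame (π : H →ₐ[k] k) (ζ : k) (n : ℕ) (h u : H) (ξ : k) : Prop
    extends UniformizedFrame π ζ n h u where
  pow_eq_one : ξ ^ n = 1
  commutation : ∀ (j : ℤ) (x : H), x ∈ biPiece π ζ 0 j → x * h = ξ ^ j • (h * x)

namespace ColorFrame

variable {π : H →ₐ[k] k} {ζ : k} {n : ℕ} {h u : H} {ξ : k} (F : ColorFrame π ζ n h u ξ)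

include F

theorem xi_ne : ξ ≠ 0 := by
  intro h0
  have := F.pow_eq_one
  rw [h0, zero_pow F.pos.ne'] at this
  exact zero_ne_one this

theorem xi_congr {i j : ℤ} (hij : (n : ℤ) ∣ i - j) : ξ ^ i = ξ ^ j :=
  zpow_congr_of_pow_eq_one F.xi_ne F.pow_eq_one hij

theorem mul_h {i j : ℤ} {x : H} (hx : x ∈ biPiece π ζ i j) :
    x * h = ξ ^ (j - i) • (h * x) := by
  obtain ⟨N, hN⟩ := F.exists_neg i
  have h1 := F.commutation _ _ (F.h_pow_mul_left hx hN)
  have h2 : h ^ N * (x * h) = h ^ N * (ξ ^ (j - i) • (h * x)) := by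
    rw [← mul_assoc, h1, mul_smul_comm, ← mul_assoc, ← mul_assoc, ← pow_succ, ← pow_succ']
  refine F.h_pow_cancel N (F.mul_mem hx F.mem).1 ?_ h2
  have h3 := (Submodule.smul_mem _ (ξ ^ (j - i)) (F.mul_mem F.mem hx)).1
  rwa [add_comm] at h3

theorem mul_h_pow {i j : ℤ} {x : H} (hx : x ∈ biPiece π ζ i j) (m : ℕ) :
    x * h ^ m = ξ ^ ((j - i) * m) • (h ^ m * x) := by
  induction m with
  | zero => simp
  | succ m ih =>
    rw [pow_succ, ← mul_assoc, ih, smul_mul_assoc, mul_assoc, F.mul_h hx, mul_smul_comm, smul_smul,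
      ← zpow_add₀ F.xi_ne, mul_assoc]
    push_cast
    congr 2
    ring

/-- The bihomogeneous elements commute up to powers of `ξ`. -/
theorem color {i j i' j' : ℤ} {x y : H} (hx : x ∈ biPiece π ζ i j) (hy : y ∈ biPiece π ζ i' j') :
    x * y = ξ ^ (i' * j - i * j') • (y * x) := by
  obtain ⟨M, hM⟩ := F.exists_neg i
  obtain ⟨N, hN⟩ := F.exists_neg i'
  -- After transport the two elements commute in the left component. Pulling the powers of h to the
  -- front and cancelling them leaves only a power of ξ.
  have h1 := left_comm F.dedekind (F.lWind_h_pow_mul hx.1 hM) (F.lWind_h_pow_mul hy.1 hN)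
  have h2 : h ^ M * x * (h ^ N * y) = ξ ^ ((j - i) * N) • (h ^ (M + N) * (x * y)) := by
    rw [mul_assoc, ← mul_assoc x, F.mul_h_pow hx, smul_mul_assoc, mul_smul_comm, pow_add]
    simp only [mul_assoc]
  have h3 : h ^ N * y * (h ^ M * x) = ξ ^ ((j' - i') * M) • (h ^ (M + N) * (y * x)) := by
    rw [mul_assoc, ← mul_assoc y, F.mul_h_pow hy, smul_mul_assoc, mul_smul_comm, add_comm M, pow_add]
    simp only [mul_assoc]
  rw [h2, h3] at h1
  have h4 : h ^ (M + N) * (x * y) =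
      h ^ (M + N) * (ξ ^ (i' * j - i * j') • (y * x)) := by
    have h5 := congrArg (fun z => ξ ^ (-((j - i) * N)) • z) h1
    simp only [smul_smul, ← zpow_add₀ F.xi_ne] at h5
    rw [neg_add_cancel, zpow_zero, one_smul] at h5
    rw [h5, mul_smul_comm]
    congr 1
    refine F.xi_congr ?_
    exact (dvd_sub (hM.mul_left (j' - i')) (hN.mul_left (j - i))).trans (dvd_of_eq (by ring))
  refine F.h_pow_cancel (M + N) (F.mul_mem hx hy).1 ?_ h4
  have h7 := (Submodule.smul_mem _ (ξ ^ (i' * j - i * j')) (F.mul_mem hy hx)).1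
  rwa [add_comm i' i] at h7

theorem central {a : H} (ha : a ∈ biPiece π ζ 0 0) (x : H) : a * x = x * a := by
  refine F.homogeneous_induction (p := fun x => a * x = x * a) x (fun i j y hy => ?_) (by simp)
    fun y z hy hz => ?_
  · rw [F.color ha hy]; simp
  · rw [mul_add, add_mul, hy, hz]

section PI

variable {d : ℕ} [NeZero d]

omit F in
/-- The doubly twisted regular representation. -/
def colorRep (π : H →ₐ[k] k) (ζ : k) (n : ℕ) (ξ : k) (d : ℕ) [NeZero d] :
    H →ₗ[k] Matrix (ZMod d) (ZMod d) (Matrix (ZMod d) (ZMod d) H) :=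
  ∑ i ∈ Finset.range n, ∑ j ∈ Finset.range n,
    shiftMatrix d ξ⁻¹ i j ∘ₗ shiftMatrix d ξ i j ∘ₗ rProj π ζ n j ∘ₗ lProj π ζ n i

theorem colorRep_of_mem (hd : ξ ^ d = 1) (hdn : d ∣ n) {i j : ℤ} {x : H}
    (hx : x ∈ biPiece π ζ i j) :
    colorRep π ζ n ξ d x = shiftMatrix d ξ⁻¹ i j (shiftMatrix d ξ i j x) := by
  have hd' : ξ⁻¹ ^ d = 1 := by rw [inv_pow, hd, inv_one]
  have hn : (n : ℤ) ≠ 0 := by exact_mod_cast F.pos.ne'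
  have key : ∀ i : ℤ, ∃ i0 : ℕ, i0 ∈ Finset.range n ∧ (n : ℤ) ∣ i - i0 ∧
      ∀ m ∈ Finset.range n, (n : ℤ) ∣ i - m → m = i0 := by
    intro i
    have h1 : (((i % n).toNat : ℕ) : ℤ) = i % n := Int.toNat_of_nonneg (Int.emod_nonneg _ hn)
    have h2 : i % n < n := Int.emod_lt_of_pos _ (by exact_mod_cast F.pos)
    have h0 : (n : ℤ) ∣ i - (i % n).toNat := by
      rw [h1]; exact ⟨i / n, by have := Int.emod_add_mul_ediv i n; linarith⟩
    refine ⟨(i % n).toNat, Finset.mem_range.2 (by omega), h0, fun m hm hmd => ?_⟩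
    rw [Finset.mem_range] at hm
    have h3 := dvd_sub h0 hmd
    have h4 : i - ((i % n).toNat : ℤ) - (i - m) = m - (i % n).toNat := by ring
    rw [h4] at h3
    have h5 := Int.eq_zero_of_abs_lt_dvd h3 (by rw [abs_lt]; omega)
    omega
  obtain ⟨i0, hi0, hi0d, hi0u⟩ := key i
  obtain ⟨j0, hj0, hj0d, hj0u⟩ := key j
  have hdn' : (d : ℤ) ∣ n := by exact_mod_cast hdn
  rw [colorRep, LinearMap.sum_apply, Finset.sum_eq_single i0]
  · rw [LinearMap.sum_apply, Finset.sum_eq_single j0]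
    · simp only [LinearMap.comp_apply]
      rw [F.lProj_eigen hx.1, if_pos hi0d, F.rProj_eigen hx.2, if_pos hj0d,
        shiftMatrix_congr (inv_ne_zero F.xi_ne) hd' (hdn'.trans hi0d) (hdn'.trans hj0d),
        shiftMatrix_congr F.xi_ne hd (hdn'.trans hi0d) (hdn'.trans hj0d)]
    · intro m hm hne
      simp only [LinearMap.comp_apply]
      rw [F.lProj_eigen hx.1, if_pos hi0d, F.rProj_eigen hx.2,
        if_neg fun h => hne (hj0u m hm h), map_zero, map_zero]
    · intro h; exact absurd hj0 h
  · intro m hm hne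
    rw [LinearMap.sum_apply]
    refine Finset.sum_eq_zero fun l _ => ?_
    simp only [LinearMap.comp_apply]
    rw [F.lProj_eigen hx.1, if_neg fun h => hne (hi0u m hm h), map_zero, map_zero, map_zero]
  · intro h; exact absurd hi0 h

/-- The outer shift uses ξ⁻¹ and the inner one ξ, so the two factors ξ^(-i j') and ξ^(i j') cancel.
-/
theorem colorRep_mul (hd : ξ ^ d = 1) (hdn : d ∣ n) (x y : H) :
    colorRep π ζ n ξ d (x * y) = colorRep π ζ n ξ d x * colorRep π ζ n ξ d y := by
  have hd' : ξ⁻¹ ^ d = 1 := by rw [inv_pow, hd, inv_one]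
  refine F.homogeneous_induction
    (p := fun x => colorRep π ζ n ξ d (x * y) = colorRep π ζ n ξ d x * colorRep π ζ n ξ d y) x
    (fun i j x hx => ?_) (by simp) fun x z hx hz => ?_
  · refine F.homogeneous_induction
      (p := fun y => colorRep π ζ n ξ d (x * y) = colorRep π ζ n ξ d x * colorRep π ζ n ξ d y) y
      (fun i' j' y hy => ?_) (by simp) fun y z hy hz => ?_
    · rw [F.colorRep_of_mem hd hdn (F.mul_mem hx hy), F.colorRep_of_mem hd hdn hx,
        F.colorRep_of_mem hd hdn hy, shiftMatrix_mul (inv_ne_zero F.xi_ne) hd',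
        shiftMatrix_mul F.xi_ne hd, map_smul, smul_smul, ← mul_zpow, inv_mul_cancel₀ F.xi_ne,
        one_zpow, one_smul]
    · rw [mul_add, map_add, map_add, mul_add, hy, hz]
  · rw [add_mul, map_add, map_add, add_mul, hx, hz]

theorem colorRep_one (hd : ξ ^ d = 1) (hdn : d ∣ n) : colorRep π ζ n ξ d 1 = 1 := by
  rw [F.colorRep_of_mem hd hdn one_mem]
  have h1 : ∀ {R : Type u} [Ring R] [Algebra k R] (q : k),
      shiftMatrix d q 0 0 (1 : R) = 1 := by
    intro R _ _ q
    ext r s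
    simp [shiftMatrix_apply, Matrix.one_apply, eq_comm]
  rw [h1, h1]

theorem sum_colorRep (hd : ξ ^ d = 1) (hdn : d ∣ n) (x : H) :
    ∑ s', (∑ s, colorRep π ζ n ξ d x 0 s) 0 s' = x := by
  refine F.homogeneous_induction
    (p := fun x => ∑ s', (∑ s, colorRep π ζ n ξ d x 0 s) 0 s' = x) x
    (fun i j x hx => ?_) (by simp) fun y z hy hz => ?_
  · rw [F.colorRep_of_mem hd hdn hx, sum_shiftMatrix_zero, sum_shiftMatrix_zero]
  · simp only [map_add, Matrix.add_apply, Finset.sum_add_distrib, hy, hz]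

omit F in
/-- The generators of the commutative coefficient ring. -/
def colorGenerators (π : H →ₐ[k] k) (ζ ξ : k) (d : ℕ) [NeZero d] :
    Set (Matrix (ZMod d) (ZMod d) H) :=
  {w | ∃ (i j : ℤ) (x : H), x ∈ biPiece π ζ i j ∧ w = shiftMatrix d ξ i j x}

/-- Products in the two orders acquire ξ^(i j') and ξ^(i' j), which exactly absorbs the commutation
factor of `color`. -/
theorem colorGenerators_comm (hd : ξ ^ d = 1) :
    ∀ a ∈ colorGenerators π ζ ξ d, ∀ b ∈ colorGenerators π ζ ξ d, a * b = b * a := by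
  rintro _ ⟨i, j, x, hx, rfl⟩ _ ⟨i', j', y, hy, rfl⟩
  rw [shiftMatrix_mul F.xi_ne hd, shiftMatrix_mul F.xi_ne hd, F.color hx hy, map_smul, smul_smul,
    ← zpow_add₀ F.xi_ne, add_comm i' i, add_comm j' j]
  congr 2
  ring

theorem colorRep_apply_mem (hd : ξ ^ d = 1) (hdn : d ∣ n) (x : H) (r s : ZMod d) :
    colorRep π ζ n ξ d x r s ∈ Subring.closure (colorGenerators π ζ ξ d) := by
  refine F.homogeneous_induction
    (p := fun x => colorRep π ζ n ξ d x r s ∈ Subring.closure (colorGenerators π ζ ξ d)) x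
    (fun i j x hx => ?_) ?_ fun y z hy hz => ?_
  · rw [F.colorRep_of_mem hd hdn hx, shiftMatrix_apply]
    split_ifs
    · rw [← map_smul]
      exact Subring.subset_closure ⟨i, j, _, Submodule.smul_mem _ _ hx, rfl⟩
    · exact zero_mem _
  · rw [map_zero]; exact zero_mem _
  · rw [map_add]; exact add_mem hy hz

/-- The inner twist makes the matrix entries commute, so they generate a commutative ring `C`. The
outer twist gives the `d` × `d` matrices over `C`, and row sums recover the original element. -/
theorem exists_embedding (hd : ξ ^ d = 1) (hdn : d ∣ n) :
    ∃ (C : Type u) (_ : CommRing C) (f : H →+* Matrix (Fin d) (Fin d) C),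
      Function.Injective f := by
  have hcomm := Subring.isMulCommutative_closure (F.colorGenerators_comm hd)
  let _ : CommRing (Subring.closure (colorGenerators π ζ ξ d)) :=
    { (inferInstance : Ring (Subring.closure (colorGenerators π ζ ξ d))) with
      mul_comm := hcomm.is_comm.comm }
  let C := Subring.closure (colorGenerators π ζ ξ d)
  let ι : Matrix (ZMod d) (ZMod d) C → Matrix (ZMod d) (ZMod d) (Matrix (ZMod d) (ZMod d) H) :=
    fun A => A.map (Subring.subtype C)
  have hι : Function.Injective ι := fun A B hAB => by
    ext1 r s
    exact Subtype.ext (congrFun (congrFun hAB r) s)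
  have hιmul : ∀ A B, ι (A * B) = ι A * ι B := fun A B => Matrix.map_mul (f := Subring.subtype C)
  have hιadd : ∀ A B, ι (A + B) = ι A + ι B := fun A B => by ext1 r s; rfl
  let f0 : H → Matrix (ZMod d) (ZMod d) C := fun x =>
    Matrix.of fun r s => ⟨colorRep π ζ n ξ d x r s, F.colorRep_apply_mem hd hdn x r s⟩
  have hf0 : ∀ x, ι (f0 x) = colorRep π ζ n ξ d x := fun x => rfl
  let f : H →+* Matrix (ZMod d) (ZMod d) C :=
    { toFun := f0
      map_one' := hι (by
        rw [hf0, F.colorRep_one hd hdn]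
        exact (Matrix.map_one _ rfl rfl).symm)
      map_zero' := hι (by
        rw [hf0, map_zero]
        ext1 r s
        rfl)
      map_add' := fun x y => hι (by rw [hιadd, hf0, hf0, hf0, map_add])
      map_mul' := fun x y => hι (by rw [hιmul, hf0, hf0, hf0, F.colorRep_mul hd hdn]) }
  have hf : Function.Injective f := by
    intro x y hxy
    have h1 : colorRep π ζ n ξ d x = colorRep π ζ n ξ d y := by
      rw [← hf0, ← hf0]; exact congrArg ι hxy
    rw [← F.sum_colorRep hd hdn x, h1, F.sum_colorRep hd hdn y]
  let e : ZMod d ≃ Fin d := Fintype.equivFinOfCardEq (ZMod.card d)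
  exact ⟨C, inferInstance, ((Matrix.reindexRingEquiv C e : _ ≃+* _) : _ →+* _).comp f,
    (Matrix.reindexRingEquiv C e).injective.comp hf⟩

end PI

/-- Minimality of the PI-degree bounds `n` by the order of ξ, which divides `n`. -/
theorem isPrimitiveRoot (hPI : HasPIDegree H n) : IsPrimitiveRoot ξ n := by
  have hdn : orderOf ξ ∣ n := orderOf_dvd_of_pow_eq_one F.pow_eq_one
  have hpos : 0 < orderOf ξ := Nat.pos_of_dvd_of_pos hdn F.pos
  have : NeZero (orderOf ξ) := ⟨hpos.ne'⟩
  have h1 : n ≤ orderOf ξ := hPI.2 (F.exists_embedding (pow_orderOf_eq_one ξ) hdn)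
  have h2 : orderOf ξ = n := le_antisymm (Nat.le_of_dvd F.pos hdn) h1
  exact h2 ▸ IsPrimitiveRoot.orderOf ξ

end ColorFrame

end Color

/-! ### A skew point derivation extending the cotangent functional -/

section Skew

variable {k : Type v} {H : Type u} [Field k] [Ring H] [HopfAlgebra k H]

theorem rSlice_smul (c : k) (φ : H →ₗ[k] k) (x : H) : rSlice (c • φ) x = c • rSlice φ x := by
  simp [rSlice_apply, LinearMap.lTensor_smul]

theorem rSlice_counit_rWind_pow (π : H →ₐ[k] k) (t : ℕ) (x : H) :
    rSlice ((Coalgebra.counit (R := k)) ∘ₗ ((rWind π ^ t : H ≃ₐ[k] H) : H →ₐ[k] H).toLinearMap) x =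
      (rWind π ^ t) x := by
  induction t generalizing x with
  | zero => exact rSlice_counit x
  | succ t ih =>
    rw [pow_succ, AlgEquiv.mul_apply, ← ih, rWind_eq_rSlice, rSlice_rSlice]
    rfl

/-- A skew derivation into `k` becomes one into `H` on slicing Δ(xy) = Δ(x)Δ(y); the slice by the
counit is the identity. -/
theorem rSlice_mul_of_skew {f χ : H →ₗ[k] k}
    (h : ∀ a b, f (a * b) = f a * χ b + Coalgebra.counit (R := k) a * f b) (x y : H) :
    rSlice f (x * y) = rSlice f x * rSlice χ y + x * rSlice f y := by
  have key : ∀ s t : H ⊗[k] H, TensorProduct.rid k H (f.lTensor H (s * t)) =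
      TensorProduct.rid k H (f.lTensor H s) * TensorProduct.rid k H (χ.lTensor H t) +
      TensorProduct.rid k H ((Coalgebra.counit (R := k)).lTensor H s) *
        TensorProduct.rid k H (f.lTensor H t) := by
    intro s t
    induction s with
    | zero => simp
    | add s s' hs hs' =>
      simp only [map_add, add_mul, hs, hs']
      abel
    | tmul a b =>
      induction t with
      | zero => simp
      | add t t' ht ht' =>
        simp only [map_add, mul_add, ht, ht']
        abel
      | tmul a' b' =>
        simp [h, add_smul, smul_smul, mul_comm]
  have h1 := key (Coalgebra.comul x) (Coalgebra.comul y)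
  rw [← Bialgebra.comul_mul] at h1
  rw [rSlice_apply, h1]
  congr 2
  exact rSlice_counit x

/-- A color frame with primitive commutation factor `ξ = ζ ^ t`, and a skew point derivation
`f` concentrated in the bidegrees `(i, i + 1)` with `f u = 1`. -/
structure SkewFrame (π : H →ₐ[k] k) (ζ : k) (n : ℕ) (h u : H) (ξ : k) (t : ℕ) (f : H →ₗ[k] k) :
    Prop extends ColorFrame π ζ n h u ξ where
  xi_prim : IsPrimitiveRoot ξ n
  xi_eq : ξ = ζ ^ t
  f_u : f u = 1
  f_degree : ∀ (i j : ℤ) (x : H), x ∈ biPiece π ζ i j → f x ≠ 0 → (n : ℤ) ∣ j - i - 1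
  rSlice_mul : ∀ x y : H, rSlice f (x * y) = rSlice f x * (rWind π ^ t) y + x * rSlice f y

theorem TameCharacter.exists_residue {n : ℕ} (hn : 0 < n) (i : ℤ) :
    ∃ i0 : ℕ, i0 < n ∧ (n : ℤ) ∣ i - i0 ∧ ∀ m : ℕ, m < n → (n : ℤ) ∣ i - m → m = i0 := by
  have hn0 : (n : ℤ) ≠ 0 := by exact_mod_cast hn.ne'
  have h1 : (((i % n).toNat : ℕ) : ℤ) = i % n := Int.toNat_of_nonneg (Int.emod_nonneg _ hn0)
  have h2 : i % n < n := Int.emod_lt_of_pos _ (by exact_mod_cast hn)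
  have h0 : (n : ℤ) ∣ i - (i % n).toNat := by
    rw [h1]; exact ⟨i / n, by have := Int.emod_add_mul_ediv i n; linarith⟩
  refine ⟨(i % n).toNat, by omega, h0, fun m hm hmd => ?_⟩
  have h3 := dvd_sub h0 hmd
  have h4 : i - ((i % n).toNat : ℤ) - (i - m) = m - (i % n).toNat := by ring
  rw [h4] at h3
  have h5 := Int.eq_zero_of_abs_lt_dvd h3 (by rw [abs_lt]; omega)
  omega

theorem TameCharacter.sum_map_lProj {π : H →ₐ[k] k} {ζ : k} {n : ℕ} (hπ : TameCharacter π ζ n)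
    {i : ℤ} {x : H} (hx : lWind π x = ζ ^ i • x) : ∃ i0 : ℕ, i0 < n ∧ (n : ℤ) ∣ i - i0 ∧
      ∀ Φ : ℕ → H →ₗ[k] k, ∑ m ∈ Finset.range n, Φ m (lProj π ζ n m x) = Φ i0 x := by
  obtain ⟨i0, h1, h2, h3⟩ := exists_residue hπ.pos i
  refine ⟨i0, h1, h2, fun Φ => ?_⟩
  rw [Finset.sum_eq_single i0]
  · rw [hπ.lProj_eigen hx, if_pos h2]
  · intro m hm hne
    rw [hπ.lProj_eigen hx, if_neg fun h => hne (h3 m (Finset.mem_range.1 hm) h), map_zero]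
  · intro h; exact absurd (Finset.mem_range.2 h1) h

namespace UniformizedFrame

variable {π : H →ₐ[k] k} {ζ : k} {n : ℕ} {h u : H} (F : UniformizedFrame π ζ n h u)

include F

theorem not_dvd_one : ¬ (n : ℤ) ∣ 1 := by
  intro h
  have h1 : n ∣ 1 := by exact_mod_cast h
  exact F.one_lt.ne' (Nat.dvd_one.1 h1)

/-- The cotangent functional at the counit of the left component. -/
theorem exists_cotangent : ∃ g : H →ₗ[k] k, g u = 1 ∧
    (∀ i j x, x ∈ biPiece π ζ i j → g x ≠ 0 → (n : ℤ) ∣ j - 1) ∧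
    ∀ a b, lWind π a = a → lWind π b = b →
      g (a * b) = Coalgebra.counit (R := k) a * g b + g a * Coalgebra.counit (R := k) b := by
  have hu : u ∉ Submodule.span k {(1 : H)} ⊔ augFilt π 2 := by
    intro hu
    obtain ⟨a, ha, b, hb, hab⟩ := Submodule.mem_sup.1 hu
    obtain ⟨c, rfl⟩ := Submodule.mem_span_singleton.1 ha
    have h1 := congrArg (Coalgebra.counit (R := k)) hab
    rw [map_add, map_smul, Bialgebra.counit_one, (mem_augFilt_one.1 F.u_mem).1,
      (mem_augFilt_one.1 (augFilt_le F.dedekind one_le_two hb)).1, add_zero, smul_eq_mul,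
      mul_one] at h1
    rw [h1, zero_smul, zero_add] at hab
    exact F.u_notMem (hab ▸ hb)
  obtain ⟨g0, hg0, hle⟩ := Submodule.exists_le_ker_of_notMem hu
  -- The functional separates u from k + m². Projecting to right weight 1 first keeps the value at
  -- u, and dividing by it normalises that value to 1.
  obtain ⟨g, hg⟩ : ∃ g : H →ₗ[k] k, ∀ x, g x = (g0 u)⁻¹ * g0 (rProj π ζ n 1 x) :=
    ⟨(g0 u)⁻¹ • g0 ∘ₗ rProj π ζ n 1, fun x => rfl⟩
  refine ⟨g, ?_, ?_, ?_⟩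
  · rw [hg, F.rProj_eigen F.mem_u.2, if_pos (by simp), inv_mul_cancel₀ hg0]
  · intro i j x hx hne
    by_contra hj
    refine hne ?_
    rw [hg, F.rProj_eigen hx.2, if_neg hj, map_zero, mul_zero]
  · have hvan : ∀ x ∈ augFilt π 2, g x = 0 := by
      intro x hx
      have h0 : rProj π ζ n 1 x ∈ augFilt π 2 := Frame.rProj_mem_augFilt 1 hx
      have h2 : rProj π ζ n 1 x ∈ Submodule.span k {(1 : H)} ⊔ augFilt π 2 :=
        Submodule.mem_sup_right h0
      have h1 : g0 (rProj π ζ n 1 x) = 0 := hle h2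
      rw [hg, h1, mul_zero]
    have hone : g 1 = 0 := by
      rw [hg, F.rProj_eigen (j := 0) (one_mem (ζ := ζ) (π := π)).2,
        if_neg (by simpa using F.not_dvd_one), map_zero, mul_zero]
    intro a b ha hb
    have haug : ∀ a, lWind π a = a →
        a - algebraMap k H (Coalgebra.counit (R := k) a) ∈ augFilt π 1 := fun a ha => by
      rw [mem_augFilt_one]; simp [ha]
    have h0 := augFilt_mul F.dedekind (haug a ha) (haug b hb)
    rw [one_add_one_eq_two] at h0
    have h1 := hvan _ h0
    have h2 : (a - algebraMap k H (Coalgebra.counit (R := k) a)) *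
        (b - algebraMap k H (Coalgebra.counit (R := k) b)) = a * b -
        Coalgebra.counit (R := k) a • b - Coalgebra.counit (R := k) b • a +
        (Coalgebra.counit (R := k) a * Coalgebra.counit (R := k) b) • 1 := by
      rw [sub_mul, mul_sub, mul_sub, ← Algebra.smul_def, ← Algebra.commutes, ← Algebra.smul_def,
        ← map_mul, Algebra.algebraMap_eq_smul_one]
      abel
    rw [h2, map_add, map_sub, map_sub, map_smul, map_smul, map_smul, hone, smul_zero, add_zero,
      sub_sub, sub_eq_zero] at h1
    rw [h1, smul_eq_mul, smul_eq_mul, mul_comm (g a)]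

end UniformizedFrame

namespace ColorFrame

variable {π : H →ₐ[k] k} {ζ : k} {n : ℕ} {h u : H} {ξ : k} (F : ColorFrame π ζ n h u ξ)

include F

/-- The cotangent functional g is extended by f(x) = g(h^N x), where N cancels the left weight of x.
Adding multiples of `n` to N changes nothing, since g vanishes on powers of h^n and their counit is
1. The twist in the Leibniz rule comes from moving h past the first factor. -/
theorem exists_skewFrame (hξ : IsPrimitiveRoot ξ n) :
    ∃ (t : ℕ) (f : H →ₗ[k] k), SkewFrame π ζ n h u ξ t f := by
  obtain ⟨g, hgu, hgdeg, hgmul⟩ := F.exists_cotangent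
  have hnz : NeZero n := ⟨F.pos.ne'⟩
  obtain ⟨t, -, ht⟩ := F.prim.eq_pow_of_pow_eq_one F.pow_eq_one
  have hg0 : ∀ m : ℕ, g ((h ^ n) ^ m) = 0 := by
    intro m
    by_contra hne
    rw [← pow_mul] at hne
    have h1 := hgdeg _ _ _ (F.h_pow_mem (n * m)) hne
    have h2 := dvd_sub (Dvd.intro (m : ℤ) (rfl : (n : ℤ) * m = n * m)) h1
    push_cast at h2
    rw [sub_sub_cancel] at h2
    exact F.not_dvd_one h2
  have hlw : ∀ m : ℕ, lWind π ((h ^ n) ^ m) = (h ^ n) ^ m := fun m => by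
    rw [map_pow, F.lWind_h_pow_n]
  have hgN : ∀ {i : ℤ} {x : H} {N N' : ℕ}, lWind π x = ζ ^ i • x → (n : ℤ) ∣ N + i →
      (n : ℤ) ∣ N' + i → g (h ^ N * x) = g (h ^ N' * x) := by
    have aux : ∀ {i : ℤ} {x : H} {N N' : ℕ}, N ≤ N' → lWind π x = ζ ^ i • x → (n : ℤ) ∣ N + i →
        (n : ℤ) ∣ N' + i → g (h ^ N * x) = g (h ^ N' * x) := by
      intro i x N N' hle hx hN hN'
      obtain ⟨m, hm⟩ : n ∣ N' - N := by
        have h1 := dvd_sub hN' hN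
        rw [add_sub_add_right_eq_sub, ← Nat.cast_sub hle] at h1
        exact_mod_cast h1
      have h2 : h ^ N' * x = (h ^ n) ^ m * (h ^ N * x) := by
        rw [← mul_assoc, ← pow_mul, ← pow_add, ← hm, Nat.sub_add_cancel hle]
      rw [h2, hgmul _ _ (hlw m) (F.lWind_h_pow_mul hx hN), hg0, zero_mul, add_zero, ← pow_mul,
        F.counit_h_pow, one_mul]
    intro i x N N' hx hN hN'
    rcases le_total N N' with hle | hle
    · exact aux hle hx hN hN'
    · exact (aux hle hx hN' hN).symm
  -- For a left weight 0 ≤ i < n, the exponent n - i is a nonnegative representative of -i.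
  let f : H →ₗ[k] k := ∑ i ∈ Finset.range n,
    g ∘ₗ LinearMap.mulLeft k (h ^ (n - i)) ∘ₗ lProj π ζ n i
  have hf : ∀ {i : ℤ} {x : H} {N : ℕ}, lWind π x = ζ ^ i • x → (n : ℤ) ∣ N + i →
      f x = g (h ^ N * x) := by
    intro i x N hx hN
    obtain ⟨i0, hi0, hi0d, hsum⟩ := F.sum_map_lProj hx
    have h1 := hsum fun m => g ∘ₗ LinearMap.mulLeft k (h ^ (n - m))
    have h2 : f x = g (h ^ (n - i0) * x) := by
      rw [LinearMap.sum_apply]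
      exact h1
    rw [h2]
    refine hgN hx ?_ hN
    rw [Nat.cast_sub hi0.le]
    exact (dvd_add (dvd_refl (n : ℤ)) hi0d).trans (dvd_of_eq (by ring))
  have hfdeg : ∀ (i j : ℤ) (x : H), x ∈ biPiece π ζ i j → f x ≠ 0 → (n : ℤ) ∣ j - i - 1 := by
    intro i j x hx hne
    obtain ⟨N, hN⟩ := F.exists_neg i
    rw [hf hx.1 hN] at hne
    exact hgdeg _ _ _ (F.h_pow_mul_left hx hN) hne
  have hfmul : ∀ a b, f (a * b) = f a * ((Coalgebra.counit (R := k)) ∘ₗ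
      ((rWind π ^ t : H ≃ₐ[k] H) : H →ₐ[k] H).toLinearMap) b +
      Coalgebra.counit (R := k) a * f b := by
    intro a b
    refine F.homogeneous_induction (p := fun a => f (a * b) = f a * ((Coalgebra.counit (R := k)) ∘ₗ
      ((rWind π ^ t : H ≃ₐ[k] H) : H →ₐ[k] H).toLinearMap) b +
      Coalgebra.counit (R := k) a * f b) a (fun i j a ha => ?_) (by simp) fun y z hy hz => ?_
    swap
    · simp only [add_mul, map_add, hy, hz]
      abel
    refine F.homogeneous_induction (p := fun b => f (a * b) = f a * ((Coalgebra.counit (R := k)) ∘ₗ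
      ((rWind π ^ t : H ≃ₐ[k] H) : H →ₐ[k] H).toLinearMap) b +
      Coalgebra.counit (R := k) a * f b) b (fun i' j' b hb => ?_) (by simp) fun y z hy hz => ?_
    swap
    · simp only [mul_add, map_add, hy, hz]
      abel
    obtain ⟨N, hN⟩ := F.exists_neg i
    obtain ⟨N', hN'⟩ := F.exists_neg i'
    have h1 : (n : ℤ) ∣ (N' + N : ℕ) + (i + i') := by
      push_cast
      exact (dvd_add hN hN').trans (dvd_of_eq (by ring))
    have h2 : h ^ (N' + N) * (a * b) = ξ ^ ((j - i) * i') • (h ^ N * a * (h ^ N' * b)) := by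
      rw [← mul_assoc (h ^ N * a), F.mul_h_pow (F.h_pow_mul_left ha hN), smul_mul_assoc, smul_smul,
        ← zpow_add₀ F.xi_ne, F.xi_congr (j := 0), zpow_zero, one_smul, pow_add]
      · simp only [mul_assoc]
      · exact (hN'.mul_left (j - i)).trans (dvd_of_eq (by ring))
    have h3 : ((Coalgebra.counit (R := k)) ∘ₗ
        ((rWind π ^ t : H ≃ₐ[k] H) : H →ₐ[k] H).toLinearMap) b =
        ξ ^ i' * Coalgebra.counit (R := k) b := by
      have h4 : (rWind π ^ t) b = ξ ^ j' • b := by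
        rw [Frame.algEquiv_pow_of_eigen hb.2, ← ht, ← zpow_natCast, ← zpow_natCast, ← zpow_mul,
          ← zpow_mul, mul_comm]
      have h5 : ((Coalgebra.counit (R := k)) ∘ₗ
          ((rWind π ^ t : H ≃ₐ[k] H) : H →ₐ[k] H).toLinearMap) b =
          ξ ^ j' * Coalgebra.counit (R := k) b := by
        change Coalgebra.counit (R := k) ((rWind π ^ t) b) = _
        rw [h4, map_smul, smul_eq_mul]
      rw [h5]
      by_cases hij : (n : ℤ) ∣ i' - j'
      · rw [F.xi_congr hij]
      · rw [F.counit_eq_zero hb hij, mul_zero, mul_zero]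
    rw [hf (F.mul_mem ha hb).1 h1, h2, map_smul, hgmul _ _ (F.lWind_h_pow_mul ha.1 hN)
      (F.lWind_h_pow_mul hb.1 hN'), ← hf ha.1 hN, ← hf hb.1 hN', Bialgebra.counit_mul,
      Bialgebra.counit_mul, F.counit_h_pow, F.counit_h_pow, one_mul, one_mul, h3, smul_eq_mul,
      mul_add, add_comm]
    -- The leftover factor is ξ^((j-i)i'). Where f(a) ≠ 0 one has j - i ≡ 1, so it is ξ^(i'); where
    -- the counit of a is nonzero one has j ≡ i, so it is 1.
    congr 1
    · by_cases h0 : f a = 0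
      · rw [h0]; ring
      · have h5 := hfdeg _ _ _ ha h0
        rw [F.xi_congr (i := (j - i) * i') (j := i')]
        · ring
        · exact (h5.mul_right i').trans (dvd_of_eq (by ring))
    · by_cases h0 : (n : ℤ) ∣ i - j
      · rw [F.xi_congr (i := (j - i) * i') (j := 0), zpow_zero, one_mul]
        exact (h0.mul_right (-i')).trans (dvd_of_eq (by ring))
      · rw [F.counit_eq_zero ha h0]; ring
  refine ⟨t, f, ⟨F, hξ, ht.symm, ?_, hfdeg, fun x y => ?_⟩⟩
  · rw [hf (N := 0) F.mem_u.1 (by simp), pow_zero, one_mul, hgu]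
  · rw [rSlice_mul_of_skew hfmul, rSlice_counit_rWind_pow]

end ColorFrame

end Skew

/-! ### The skew derivation D = `rSlice f` and its kernel -/

section SkewDerivation

variable {k : Type v} {H : Type u} [Field k] [Ring H] [HopfAlgebra k H]

namespace SkewFrame

variable {π : H →ₐ[k] k} {ζ : k} {n : ℕ} {h u : H} {ξ : k} {t : ℕ} {f : H →ₗ[k] k}
  (F : SkewFrame π ζ n h u ξ t f)

include F

theorem f_eq_zero {i j : ℤ} {x : H} (hx : x ∈ biPiece π ζ i j) (hij : ¬ (n : ℤ) ∣ j - i - 1) :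
    f x = 0 := by
  by_contra hne
  exact hij (F.f_degree i j x hx hne)

theorem f_one : f 1 = 0 := F.f_eq_zero one_mem (by simpa using F.not_dvd_one)

/-- Because f lives in bidegrees (i, i + 1), one has f ∘ Ξʳ = ζ · π ∘ D. Slicing by both sides shows
that D lowers the right weight by 1. -/
theorem rSlice_mem {i j : ℤ} {x : H} (hx : x ∈ biPiece π ζ i j) :
    rSlice f x ∈ biPiece π ζ i (j - 1) := by
  refine ⟨by rw [lWind_rSlice, hx.1, map_smul], ?_⟩
  have h1 : ζ • (π.toLinearMap ∘ₗ rSlice f) = f ∘ₗ (rWind π).toLinearMap := by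
    ext y
    refine F.homogeneous_induction
      (p := fun y => (ζ • (π.toLinearMap ∘ₗ rSlice f)) y = (f ∘ₗ (rWind π).toLinearMap) y) y
      (fun i j y hy => ?_) (by simp) fun a b ha hb => by rw [map_add, map_add, ha, hb]
    change ζ • π.toLinearMap (rSlice f y) = f (rWind π y)
    rw [← apply_lSlice, ← lWind_eq_lSlice, hy.1, hy.2, map_smul, map_smul, smul_smul]
    by_cases h0 : f y = 0
    · rw [h0, smul_zero, smul_zero]
    · have h2 := F.f_degree i j y hy h0
      have h3 : ζ * ζ ^ i = ζ ^ (i + 1) := by rw [zpow_add_one₀ F.zeta_ne, mul_comm]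
      rw [h3, F.zpow_congr (i := j) (j := i + 1)]
      exact h2.trans (dvd_of_eq (by ring))
  have h2 : ζ • rWind π (rSlice f x) = ζ ^ j • rSlice f x := by
    rw [rWind_eq_rSlice, rSlice_rSlice, ← rSlice_smul, h1]
    have h3 : f ∘ₗ (rWind π).toLinearMap = f ∘ₗ rSlice π.toLinearMap := rfl
    rw [h3, ← rSlice_rSlice, ← rWind_eq_rSlice, hx.2, map_smul]
  have h4 := congrArg (fun y => ζ⁻¹ • y) h2
  simp only [smul_smul] at h4
  rw [inv_mul_cancel₀ F.zeta_ne, one_smul] at h4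
  rw [h4, zpow_sub_one₀ F.zeta_ne, mul_comm]

theorem rSlice_mul_of_eigen (x : H) {j : ℤ} {y : H} (hy : rWind π y = ζ ^ j • y) :
    rSlice f (x * y) = ξ ^ j • (rSlice f x * y) + x * rSlice f y := by
  rw [F.rSlice_mul, Frame.algEquiv_pow_of_eigen hy, mul_smul_comm, F.xi_eq]
  congr 2
  rw [← zpow_natCast, ← zpow_natCast, ← zpow_mul, ← zpow_mul, mul_comm]

theorem rSlice_f_one : rSlice f 1 = 0 := by rw [rSlice_one, F.f_one, zero_smul]

theorem rSlice_u_mem : rSlice f u ∈ biPiece π ζ 0 0 := by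
  simpa using F.rSlice_mem F.mem_u

theorem counit_rSlice_u : Coalgebra.counit (R := k) (rSlice f u) = 1 := by
  rw [counit_rSlice, F.f_u]

theorem rSlice_u_pow (m : ℕ) :
    rSlice f (u ^ m) = (∑ i ∈ Finset.range m, ξ ^ i) • (u ^ (m - 1) * rSlice f u) := by
  induction m with
  | zero => simp [F.rSlice_f_one]
  | succ m ih =>
    rw [pow_succ, F.rSlice_mul_of_eigen _ F.mem_u.2, ih, smul_mul_assoc, mul_assoc,
      F.central F.rSlice_u_mem u, ← mul_assoc, geom_sum_succ, add_smul, one_smul, smul_smul,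
      zpow_one]
    cases m with
    | zero => simp
    | succ m => simp [pow_succ]

omit F in
theorem rWind_pow_mem_augFilt {N : ℕ} {x : H} (hx : x ∈ augFilt π N) (m : ℕ) :
    (rWind π ^ m) x ∈ augFilt π N := by
  induction m with
  | zero => exact hx
  | succ m ih => rw [pow_succ', AlgEquiv.mul_apply]; exact rWind_mem_augFilt ih

/-- By the Leibniz rule, D lowers the m-adic filtration by at most one step; hence the expansion
modulo m^(N+1) used for H₀. -/
theorem rSlice_mem_augFilt {N : ℕ} {x : H} (hx : x ∈ augFilt π (N + 1)) :
    rSlice f x ∈ augFilt π N := by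
  have hD : ∀ y, lWind π y = y → rSlice f y ∈ augFilt π 0 := by
    intro y hy
    rw [mem_augFilt_zero, lWind_rSlice, hy]
  induction N generalizing x with
  | zero => exact hD x (lWind_of_mem_augFilt hx)
  | succ N ih =>
    refine augFilt_succ_induction (p := fun x => rSlice f x ∈ augFilt π (N + 1)) hx
      (fun a ha b hb => ?_) fun a b ha hb => by rw [map_add]; exact add_mem ha hb
    rw [F.rSlice_mul]
    have h1 := augFilt_mul F.dedekind (hD a (lWind_of_mem_augFilt ha))
      (rWind_pow_mem_augFilt hb t)
    have h2 := augFilt_mul F.dedekind ha (ih hb)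
    rw [zero_add] at h1
    rw [add_comm] at h2
    exact add_mem h1 h2

/-- The skew derivation vanishes on the classical component. -/
theorem rSlice_classical {a : H} (ha : a ∈ biPiece π ζ 0 0) : rSlice f a = 0 := by
  refine eq_zero_of_mem_augFilt F.dedekind fun N => ?_
  have hal : lWind π a = a := by simpa using ha.1
  obtain ⟨c, hc⟩ := exists_sum_pow_sub_mem F.dedekind F.u_mem F.u_notMem (N + 1) hal
  have h1 := Frame.rProj_mem_augFilt (ζ := ζ) (n := n) 0 hc
  rw [map_sub, F.rProj_eigen ha.2, if_pos (by simp), map_sum] at h1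
  have h2 : ∀ i, rSlice f (rProj π ζ n 0 (c i • u ^ i)) = 0 := by
    intro i
    rw [map_smul, F.rProj_eigen (F.pow_mem F.mem_u i).2]
    split_ifs with hi
    · have hi' : n ∣ i := by
        have : (n : ℤ) ∣ i := by simpa using hi
        exact_mod_cast this
      obtain ⟨m, rfl⟩ := hi'
      -- Only powers u^(nm) have right weight 0, and their q-number vanishes as ξ^n = 1 and ξ ≠ 1.
      have hg : ∑ i ∈ Finset.range (n * m), ξ ^ i = 0 := by
        rw [geom_sum_eq (F.xi_prim.ne_one F.one_lt), pow_mul, F.pow_eq_one, one_pow, sub_self,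
          zero_div]
      rw [map_smul, F.rSlice_u_pow, hg, zero_smul, smul_zero]
    · rw [smul_zero, map_zero]
  have h3 := F.rSlice_mem_augFilt h1
  rwa [map_sub, map_sum, Finset.sum_eq_zero fun i _ => h2 i, sub_zero] at h3

theorem rSlice_classical_mul {a : H} (ha : a ∈ biPiece π ζ 0 0) (y : H) :
    rSlice f (a * y) = a * rSlice f y := by
  rw [F.rSlice_mul, F.rSlice_classical ha, zero_mul, zero_add]

/-- The ξ of the skew Leibniz rule cancels the ξ⁻¹ from moving D(h) past h, so an ordinary integer
appears instead of a q-number. -/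
theorem rSlice_h_pow' (m : ℕ) : rSlice f (h ^ m) = (m : k) • (h ^ (m - 1) * rSlice f h) := by
  induction m with
  | zero => simp [F.rSlice_f_one]
  | succ m ih =>
    have h1 : rSlice f h * h = ξ ^ (-1 : ℤ) • (h * rSlice f h) := by
      have := F.color (F.rSlice_mem F.mem) F.mem
      simpa using this
    rw [pow_succ, F.rSlice_mul_of_eigen _ F.mem.2, ih, smul_mul_assoc, mul_assoc, h1,
      mul_smul_comm, smul_comm (m : k), smul_smul, ← zpow_add₀ F.xi_ne, add_neg_cancel, zpow_zero,
      one_smul]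
    cases m with
    | zero => simp
    | succ m =>
      simp only [Nat.add_sub_cancel]
      rw [← mul_assoc, ← pow_succ]
      push_cast
      module

/-- As h^n lies in H₀, one gets n h^(n-1) D(h) = 0, and both n and the power of h cancel. -/
theorem rSlice_h : rSlice f h = 0 := by
  have h1 := F.rSlice_h_pow' n
  have h2 : h ^ n ∈ biPiece π ζ 0 0 := by
    have := F.h_pow_mem n
    rwa [F.biPiece_congr (i' := 0) (j' := 0) (by simp) (by simp)] at this
  rw [F.rSlice_classical h2] at h1
  have h3 := (smul_eq_zero.1 h1.symm).resolve_left F.cast_ne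
  exact F.h_pow_mul_ne_zero (n - 1) (F.rSlice_mem F.mem).1 h3

theorem rSlice_h_pow (m : ℕ) : rSlice f (h ^ m) = 0 := by
  rw [F.rSlice_h_pow', F.rSlice_h, mul_zero, smul_zero]

/-- The skew derivation is injective on the off-diagonal pieces. -/
theorem eq_zero_of_rSlice {i j : ℤ} {x : H} (hx : x ∈ biPiece π ζ i j)
    (hij : ¬ (n : ℤ) ∣ j - i) (h0 : rSlice f x = 0) : x = 0 := by
  obtain ⟨N, hN⟩ := F.exists_neg i
  refine F.h_pow_mul_ne_zero N hx.1 ?_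
  have hd := F.h_pow_mul_left hx hN
  have hd0 : rSlice f (h ^ N * x) = 0 := by
    rw [F.rSlice_mul_of_eigen _ hx.2, F.rSlice_h_pow, zero_mul, smul_zero, h0, mul_zero, zero_add]
  generalize h ^ N * x = d at hd hd0
  obtain ⟨r, hr, hrd, -⟩ := exists_residue F.pos (j - i)
  have hr0 : r ≠ 0 := by rintro rfl; exact hij (by simpa using hrd)
  -- This product lies in H₀, so D kills it. Since D(d) = 0, what remains is a nonzero q-number
  -- times u^(n-r-1) D(u) d, in a domain.
  have h1 : u ^ (n - r) * d ∈ biPiece π ζ 0 0 := by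
    have := F.mul_mem (F.pow_mem F.mem_u (n - r)) hd
    rwa [F.biPiece_congr (i' := 0) (j' := 0) (by simp) ?_] at this
    rw [Nat.cast_sub hr.le]
    exact (dvd_add (dvd_refl (n : ℤ)) hrd).trans (dvd_of_eq (by ring))
  have h2 := F.rSlice_classical h1
  rw [F.rSlice_mul_of_eigen _ hd.2, hd0, mul_zero, add_zero, F.rSlice_u_pow, smul_mul_assoc,
    smul_smul, smul_eq_zero] at h2
  have hdl : lWind π d = d := by simpa using hd.1
  have hul : lWind π u = u := by simpa using F.mem_u.1
  have hwl : lWind π (rSlice f u) = rSlice f u := by simpa using F.rSlice_u_mem.1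
  have hu0 : u ≠ 0 := by
    intro h
    have := F.f_u
    rw [h, map_zero] at this
    exact zero_ne_one this
  have hw0 : rSlice f u ≠ 0 := by
    intro h
    have := F.counit_rSlice_u
    rw [h, map_zero] at this
    exact zero_ne_one this
  have hup : ∀ m, u ^ m ≠ 0 := by
    intro m
    induction m with
    | zero =>
      intro h
      rw [pow_zero] at h
      exact hu0 (by rw [← mul_one u, h, mul_zero])
    | succ m ih =>
      intro h
      rw [pow_succ] at h
      rcases left_eq_zero_or F.dedekind (by rw [map_pow, hul]) hul h with h' | h'
      · exact ih h'
      · exact hu0 h'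
  have hl : ∀ m, lWind π (u ^ m) = u ^ m := fun m => by rw [map_pow, hul]
  rcases h2 with h2 | h2
  · exfalso
    rcases mul_eq_zero.1 h2 with h3 | h3
    · exact zpow_ne_zero _ F.xi_ne h3
    · rw [geom_sum_eq (F.xi_prim.ne_one F.one_lt), div_eq_zero_iff] at h3
      rcases h3 with h3 | h3
      · exact F.xi_prim.pow_ne_one_of_pos_of_lt (by omega) (by omega) (sub_eq_zero.1 h3)
      · exact F.xi_prim.ne_one F.one_lt (sub_eq_zero.1 h3)
  · refine (left_eq_zero_or F.dedekind ?_ hdl h2).resolve_left fun h3 => ?_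
    · rw [map_mul, hl, hwl]
    · exact (left_eq_zero_or F.dedekind (hl _) hwl h3).elim (hup _) hw0

theorem lProj_eq_self {i0 : ℕ} (hi0 : i0 < n) {x : H}
    (h : ∀ s : ℕ, s < n → s ≠ i0 → lProj π ζ n s x = 0) : lProj π ζ n i0 x = x := by
  conv_rhs => rw [← F.sum_lProj x]
  rw [Finset.sum_eq_single i0]
  · intro s hs hne
    exact h s (Finset.mem_range.1 hs) hne
  · intro h; exact absurd (Finset.mem_range.2 hi0) h

omit F in
theorem rWind_lSlice_of_eigen (φ : H →ₗ[k] k) {j : ℤ} {x : H} (hx : rWind π x = ζ ^ j • x) :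
    rWind π (lSlice φ x) = ζ ^ j • lSlice φ x := by
  rw [← lSlice_rWind, hx, map_smul]

omit F in
theorem rSlice_lProj_lSlice (φ : H →ₗ[k] k) (i : ℤ) (x : H) :
    rSlice f (lProj π ζ n i (lSlice φ x)) = lProj π ζ n i (lSlice φ (rSlice f x)) := by
  rw [lProj_rSlice, lSlice_rSlice]

/-- The classical component is stable under left slices. -/
theorem lSlice_classical (φ : H →ₗ[k] k) {a : H} (ha : a ∈ biPiece π ζ 0 0) :
    lSlice φ a ∈ biPiece π ζ 0 0 := by
  have hr := rWind_lSlice_of_eigen φ ha.2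
  -- A component of left weight s ≠ 0 lies in the off-diagonal piece H_s0. D commutes with left
  -- slices and kills a, so it kills that component, which must be 0.
  have h1 : lProj π ζ n (0 : ℕ) (lSlice φ a) = lSlice φ a := by
    refine F.lProj_eq_self F.pos fun s hs hs0 => ?_
    refine F.eq_zero_of_rSlice (F.lProj_mem hr) ?_ ?_
    · rw [zero_sub, dvd_neg, Int.natCast_dvd_natCast]
      exact Nat.not_dvd_of_pos_of_lt (Nat.pos_of_ne_zero hs0) hs
    · rw [rSlice_lProj_lSlice, F.rSlice_classical ha, map_zero, map_zero]
  rw [← h1]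
  exact F.lProj_mem hr

theorem lProj_zero_of_classical {a : H} (ha : a ∈ biPiece π ζ 0 0) : lProj π ζ n 0 a = a := by
  rw [F.lProj_eigen ha.1, if_pos (by simp)]

omit F in
theorem lProj_mul_classical (i : ℤ) (x : H) {a : H} (ha : a ∈ biPiece π ζ 0 0) :
    lProj π ζ n i (x * a) = lProj π ζ n i x * a :=
  (eigenProj_comm (T := (lWind π).toLinearMap) (T' := (lWind π).toLinearMap)
    (LinearMap.mulRight k a) (fun x => by
      have : lWind π a = a := by simpa using ha.1
      change lWind π x * a = lWind π (x * a)
      rw [map_mul, this]) i x).symm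

omit F in
theorem rProj_mul_classical (i : ℤ) (x : H) {a : H} (ha : a ∈ biPiece π ζ 0 0) :
    rProj π ζ n i (x * a) = rProj π ζ n i x * a :=
  (eigenProj_comm (T := (rWind π).toLinearMap) (T' := (rWind π).toLinearMap)
    (LinearMap.mulRight k a) (fun x => by
      have : rWind π a = a := by simpa using ha.2
      change rWind π x * a = rWind π (x * a)
      rw [map_mul, this]) i x).symm

/-- The skew derivation maps some element of bidegree `(0, 1)` to `1`. -/
theorem exists_integral : ∃ z ∈ biPiece π ζ 0 1, rSlice f z = 1 := by
  set w := rSlice f u with hw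
  have hwm : w ∈ biPiece π ζ 0 0 := F.rSlice_u_mem
  have hslice : ∀ φ : H →ₗ[k] k, ∃ y ∈ biPiece π ζ 0 1, rSlice f y = lSlice φ w := by
    intro φ
    refine ⟨lProj π ζ n 0 (lSlice φ u), F.lProj_mem (rWind_lSlice_of_eigen φ F.mem_u.2), ?_⟩
    rw [rSlice_lProj_lSlice, ← hw, F.lProj_zero_of_classical (F.lSlice_classical φ hwm)]
  choose Y hY hYw using hslice
  -- Each left slice of w = D(u) is again a value of D on H_01. The antipode identity ∑ S(w₁) w₂ = 1
  -- combines these values to 1.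
  obtain ⟨ι, s, v, φ, hsum⟩ := exists_sum_tmul_slice (Coalgebra.comul (R := k) w)
  have h1 := HopfAlgebra.mul_antipode_rTensor_comul_apply (R := k) w
  rw [F.counit_rSlice_u, map_one, hsum, map_sum, map_sum] at h1
  -- D is linear only over H₀, so the coefficients S(v_i) are projected there. The projection
  -- commutes with multiplication by the slices of w, which lie in H₀, so the sum is still 1.
  let E : H → H := fun x => rProj π ζ n 0 (lProj π ζ n 0 x)
  have hE : ∀ x, E x ∈ biPiece π ζ 0 0 := fun x => F.rProj_mem (F.lWind_lProj 0 x)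
  refine ⟨∑ i ∈ s, E (HopfAlgebra.antipode k (v i)) * Y (φ i), sum_mem fun i _ => ?_, ?_⟩
  · simpa using F.mul_mem (hE (HopfAlgebra.antipode k (v i))) (hY (φ i))
  · have h2 : E 1 = 1 := by
      simp only [E]
      rw [F.lProj_zero_of_classical one_mem, F.rProj_eigen (one_mem (π := π) (ζ := ζ)).2,
        if_pos (by simp)]
    rw [← h2, ← h1, map_sum]
    simp only [E, map_sum]
    refine Finset.sum_congr rfl fun i _ => ?_
    rw [F.rSlice_classical_mul (hE _), hYw]
    have h3 : LinearMap.mul' k H ((HopfAlgebra.antipode k).rTensor H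
        (v i ⊗ₜ[k] TensorProduct.lid k H ((φ i).rTensor H (Coalgebra.comul w)))) =
        HopfAlgebra.antipode k (v i) * lSlice (φ i) w := by
      simp [lSlice_apply]
    rw [h3, lProj_mul_classical 0 _ (F.lSlice_classical _ hwm),
      rProj_mul_classical 0 _ (F.lSlice_classical _ hwm)]

end SkewFrame

end SkewDerivation

/-! ### The skew-primitive z and the group-like g -/

section TaftFrame

variable {k : Type v} {H : Type u} [Field k] [Ring H] [HopfAlgebra k H]

/-- A skew frame together with a group-like element `g` of bidegree `(1, 1)` and a
skew-primitive element `z` of bidegree `(0, 1)` on which the skew derivation is `1`. -/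
structure TaftFrame (π : H →ₐ[k] k) (ζ : k) (n : ℕ) (h u : H) (ξ : k) (t : ℕ) (f : H →ₗ[k] k)
    (z g : H) : Prop extends SkewFrame π ζ n h u ξ t f where
  mem_z : z ∈ biPiece π ζ 0 1
  rSlice_z : rSlice f z = 1
  comul_z : Coalgebra.comul (R := k) z = z ⊗ₜ[k] g + 1 ⊗ₜ[k] z
  mem_g : g ∈ biPiece π ζ 1 1
  comul_g : Coalgebra.comul (R := k) g = g ⊗ₜ[k] g
  counit_g : Coalgebra.counit (R := k) g = 1

theorem eq_of_forall_functional {V : Type*} [AddCommGroup V] [Module k V] {x y : V}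
    (h : ∀ ψ : V →ₗ[k] k, ψ x = ψ y) : x = y := by
  rw [← sub_eq_zero, ← Module.forall_dual_apply_eq_zero_iff k]
  intro ψ
  rw [map_sub, h ψ, sub_self]

namespace SkewFrame

variable {π : H →ₐ[k] k} {ζ : k} {n : ℕ} {h u : H} {ξ : k} {t : ℕ} {f : H →ₗ[k] k}
  (F : SkewFrame π ζ n h u ξ t f) {z : H} (hz : z ∈ biPiece π ζ 0 1) (hz1 : rSlice f z = 1)

include F hz hz1

/-- Both sides lie in H_01 and have the same image ψ(1) under D, which is injective there. -/
theorem lProj_zero_lSlice (ψ : H →ₗ[k] k) : lProj π ζ n 0 (lSlice ψ z) = ψ 1 • z := by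
  rw [← sub_eq_zero]
  refine F.eq_zero_of_rSlice (i := 0) (j := 1) (sub_mem (F.lProj_mem
    (rWind_lSlice_of_eigen ψ hz.2)) (Submodule.smul_mem _ _ hz))
    (by simpa using F.not_dvd_one) ?_
  rw [map_sub, map_smul, rSlice_lProj_lSlice, hz1, lSlice_one, map_smul,
    F.lProj_zero_of_classical one_mem, sub_self]

/-- Left slices of z have left weights 0 and 1 only: a component of any other weight is off-diagonal
and killed by D. -/
theorem lWind_lSlice_sub (ψ : H →ₗ[k] k) :
    lWind π (lSlice ψ z) - ζ • lSlice ψ z = ((1 - ζ) * ψ 1) • z := by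
  have h1 : lProj π ζ n (0 : ℕ) (lSlice ψ z) + lProj π ζ n (1 : ℕ) (lSlice ψ z) =
      lSlice ψ z := by
    conv_rhs => rw [← F.sum_lProj (lSlice ψ z)]
    rw [Finset.sum_eq_add_of_mem 0 1 (Finset.mem_range.2 F.pos)
      (Finset.mem_range.2 F.one_lt) zero_ne_one]
    intro s hs hne
    have hsn := Finset.mem_range.1 hs
    refine F.eq_zero_of_rSlice (F.lProj_mem (rWind_lSlice_of_eigen ψ hz.2)) ?_ ?_
    · intro hd
      have := Int.eq_zero_of_abs_lt_dvd hd (by rw [abs_lt]; omega)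
      omega
    · rw [rSlice_lProj_lSlice, hz1, lSlice_one, map_smul,
        F.lProj_eigen (one_mem (π := π) (ζ := ζ)).1, if_neg, smul_zero]
      rw [zero_sub, dvd_neg, Int.natCast_dvd_natCast]
      exact Nat.not_dvd_of_pos_of_lt (by omega) hsn
  have h0 := F.lProj_zero_lSlice hz hz1 ψ
  have hl := F.lWind_lProj 1 (lSlice ψ z)
  have hzl : lWind π z = z := by simpa using hz.1
  rw [Nat.cast_zero, h0, Nat.cast_one] at h1
  rw [zpow_one] at hl
  rw [← h1, map_add, map_smul, hl, hzl]
  module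

/-- The transpose of `lWind_lSlice_sub`: pairing with all ψ through `apply_lSlice` turns left
winding of left slices into right winding of right slices. -/
theorem rSlice_sub_mem (φ : H →ₗ[k] k) : rSlice φ z - φ z • 1 ∈ biPiece π ζ 0 1 := by
  have hzl : lWind π z = z := by simpa using hz.1
  refine ⟨by simp [lWind_rSlice, hzl], ?_⟩
  have h1 : rWind π (rSlice φ z) - ζ • rSlice φ z = ((1 - ζ) * φ z) • 1 := by
    refine eq_of_forall_functional (k := k) fun ψ => ?_
    have h2 := congrArg φ (F.lWind_lSlice_sub hz hz1 ψ)
    rw [lWind_eq_lSlice, map_sub, map_smul, map_smul, apply_lSlice φ ψ,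
      apply_lSlice φ π.toLinearMap] at h2
    have h3 : π.toLinearMap (rSlice φ (lSlice ψ z)) = ψ (rWind π (rSlice φ z)) := by
      rw [rWind_eq_rSlice, rSlice_rSlice]
      exact apply_lSlice (π.toLinearMap ∘ₗ rSlice φ) ψ z
    rw [h3] at h2
    rw [map_sub, map_smul, map_smul, h2, smul_eq_mul, smul_eq_mul]
    ring
  rw [map_sub, map_smul, map_one, sub_eq_iff_eq_add.1 h1, zpow_one]
  module

/-- D of the right slice lies in H₀, and its left slices by ψ are ψ(1) times itself, so taking
counits shows it is a scalar. Injectivity of D on H_01 then determines the slice. -/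
theorem rSlice_eq (φ : H →ₗ[k] k) : rSlice φ z = φ z • 1 + φ (lSlice f z) • z := by
  have hm := F.rSlice_sub_mem hz hz1 φ
  have ham := F.rSlice_mem hm
  have ha : rSlice f (rSlice φ z - φ z • 1) = rSlice f (rSlice φ z) := by
    rw [map_sub, map_smul, F.rSlice_f_one, smul_zero, sub_zero]
  rw [ha, sub_self] at ham
  have h1 : ∀ ψ : H →ₗ[k] k, lSlice ψ (rSlice f (rSlice φ z)) = ψ 1 • rSlice f (rSlice φ z) := by
    intro ψ
    rw [← F.lProj_zero_of_classical (F.lSlice_classical ψ ham), ← rSlice_lProj_lSlice,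
      lSlice_rSlice, ← lProj_rSlice, F.lProj_zero_lSlice hz hz1, map_smul, map_smul]
  have h2 : rSlice f (rSlice φ z) = φ (lSlice f z) • 1 := by
    refine eq_of_forall_functional (k := k) fun ψ => ?_
    have := congrArg (Coalgebra.counit (R := k)) (h1 ψ)
    rw [counit_lSlice, map_smul, counit_rSlice, ← apply_lSlice φ f z] at this
    rw [this, map_smul, smul_eq_mul, smul_eq_mul, mul_comm]
  rw [add_comm, ← sub_eq_iff_eq_add, ← sub_eq_zero]
  refine F.eq_zero_of_rSlice (i := 0) (j := 1) (sub_mem hm (Submodule.smul_mem _ _ hz))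
    (by simpa using F.not_dvd_one) ?_
  rw [map_sub, ha, h2, map_smul, hz1, sub_self]

/-- The frame determined by an element on which the skew derivation is `1`. -/
theorem taftFrame : TaftFrame π ζ n h u ξ t f z (lSlice f z) := by
  have hcz : Coalgebra.comul (R := k) z = z ⊗ₜ[k] lSlice f z + 1 ⊗ₜ[k] z := by
    refine eq_of_rSlice_eq fun φ => ?_
    rw [← rSlice_apply, F.rSlice_eq hz hz1 φ]
    simp [add_comm]
  have hg : Coalgebra.comul (R := k) (lSlice f z) = lSlice f z ⊗ₜ[k] lSlice f z := by
    rw [comul_lSlice, hcz, map_add, LinearMap.rTensor_tmul, LinearMap.rTensor_tmul, lSlice_one,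
      F.f_one, zero_smul, TensorProduct.zero_tmul, add_zero]
  -- Slice duality gives π(g) = f(Ξʳ z) = ζ f(z), and f(z) is the counit of D(z) = 1.
  have hπg : π (lSlice f z) = ζ := by
    have h1 : f (rWind π z) = π.toLinearMap (lSlice f z) := by
      rw [rWind_eq_rSlice, apply_lSlice]
    have h2 : f z = 1 := by
      rw [← counit_rSlice, hz1, Bialgebra.counit_one]
    rw [hz.2, map_smul, h2, zpow_one] at h1
    simpa using h1.symm
  refine ⟨F, hz, hz1, hcz, ⟨?_, ?_⟩, hg, ?_⟩
  · rw [lWind_eq_lSlice, lSlice_apply, hg]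
    simp [hπg]
  · rw [rWind_eq_rSlice, rSlice_apply, hg]
    simp [hπg]
  · rw [counit_lSlice, ← counit_rSlice, hz1, Bialgebra.counit_one]

end SkewFrame

end TaftFrame

/-! ### Free generators of the bigraded pieces -/

section Generators

/-- The exponent of `y` in the monomial of bidegree `(i, j)`. -/
def monomialExp (n i j : ℕ) : ℕ := if i ≤ j then j - i else n + j - i

theorem monomialExp_lt {n i j : ℕ} (hj : j < n) : monomialExp n i j < n := by
  unfold monomialExp; split_ifs <;> omega

theorem dvd_sub_monomialExp {n i j : ℕ} (hi : i < n) : (n : ℤ) ∣ j - i - monomialExp n i j := by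
  unfold monomialExp
  split_ifs with h
  · exact ⟨0, by push_cast [h]; ring⟩
  · refine ⟨-1, ?_⟩
    rw [Nat.cast_sub (by omega)]
    push_cast
    ring

theorem monomialExp_eq_zero_iff {n i j : ℕ} (hi : i < n) : monomialExp n i j = 0 ↔ i = j := by
  unfold monomialExp; split_ifs <;> omega

theorem exists_monomialExp_eq {n i s : ℕ} (hi : i < n) (hs : s < n) :
    ∃ j < n, monomialExp n i j = s := by
  by_cases h : i + s < n
  · exact ⟨i + s, h, by unfold monomialExp; split_ifs <;> omega⟩
  · exact ⟨i + s - n, by omega, by unfold monomialExp; split_ifs <;> omega⟩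

variable {k : Type v} {H : Type u} [Field k] [Ring H] [HopfAlgebra k H]

namespace TaftFrame

variable {π : H →ₐ[k] k} {ζ : k} {n : ℕ} {h u : H} {ξ : k} {t : ℕ} {f : H →ₗ[k] k} {z g : H}
  (F : TaftFrame π ζ n h u ξ t f z g)

include F

theorem z_mul_g : z * g = ξ • (g * z) := by
  have := F.color F.mem_z F.mem_g
  simpa using this

theorem counit_z : Coalgebra.counit (R := k) z = 0 :=
  F.counit_eq_zero F.mem_z (by simpa using F.not_dvd_one)

theorem antipode_g_mul : HopfAlgebra.antipode k g * g = 1 := by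
  have := HopfAlgebra.mul_antipode_rTensor_comul_apply (R := k) g
  rw [F.comul_g, F.counit_g] at this
  simpa using this

theorem g_mul_antipode : g * HopfAlgebra.antipode k g = 1 := by
  have := HopfAlgebra.mul_antipode_lTensor_comul_apply (R := k) g
  rw [F.comul_g, F.counit_g] at this
  simpa using this

theorem g_pow_mul_antipode_pow (m : ℕ) : g ^ m * HopfAlgebra.antipode k g ^ m = 1 := by
  rw [← (show Commute g (HopfAlgebra.antipode k g) from
    F.g_mul_antipode.trans F.antipode_g_mul.symm).mul_pow, F.g_mul_antipode, one_pow]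

theorem antipode_pow_mul_g_pow (m : ℕ) : HopfAlgebra.antipode k g ^ m * g ^ m = 1 := by
  rw [← (show Commute (HopfAlgebra.antipode k g) g from
    F.antipode_g_mul.trans F.g_mul_antipode.symm).mul_pow, F.antipode_g_mul, one_pow]

theorem antipode_g_mem : HopfAlgebra.antipode k g ∈ biPiece π ζ (-1) (-1) := by
  have key : ∀ e : H ≃ₐ[k] H, e g = ζ ^ (1 : ℤ) • g →
      e (HopfAlgebra.antipode k g) = ζ ^ (-1 : ℤ) • HopfAlgebra.antipode k g := by
    intro e he
    have h1 : ζ ^ (1 : ℤ) • (e (HopfAlgebra.antipode k g) * g) = 1 := by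
      rw [← mul_smul_comm, ← he, ← map_mul, F.antipode_g_mul, map_one]
    calc e (HopfAlgebra.antipode k g)
        = ζ ^ (-1 : ℤ) • (ζ ^ (1 : ℤ) • (e (HopfAlgebra.antipode k g) * g)) *
            HopfAlgebra.antipode k g := by
          rw [smul_smul, ← zpow_add₀ F.zeta_ne, neg_add_cancel, zpow_zero, one_smul, mul_assoc,
            F.g_mul_antipode, mul_one]
      _ = _ := by rw [h1, smul_mul_assoc, one_mul]
  exact ⟨key _ F.mem_g.1, key _ F.mem_g.2⟩

theorem z_pow_mem (m : ℕ) : z ^ m ∈ biPiece π ζ 0 m := by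
  simpa using F.pow_mem F.mem_z m

theorem g_pow_mem (m : ℕ) : g ^ m ∈ biPiece π ζ m m := by
  simpa using F.pow_mem F.mem_g m

theorem z_pow_mem_classical : z ^ n ∈ biPiece π ζ 0 0 := by
  have := F.z_pow_mem n
  rwa [F.biPiece_congr (i' := 0) (j' := 0) (by simp) (by simp)] at this

theorem g_pow_mem_classical : g ^ n ∈ biPiece π ζ 0 0 := by
  have := F.g_pow_mem n
  rwa [F.biPiece_congr (i' := 0) (j' := 0) (by simp) (by simp)] at this

theorem rSlice_z_pow (m : ℕ) :
    rSlice f (z ^ (m + 1)) = (∑ i ∈ Finset.range (m + 1), ξ ^ i) • z ^ m := by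
  induction m with
  | zero => simp [F.rSlice_z]
  | succ m ih =>
    rw [pow_succ, F.rSlice_mul_of_eigen _ F.mem_z.2, ih, smul_mul_assoc, ← pow_succ, F.rSlice_z,
      mul_one, geom_sum_succ (n := m + 1), add_smul, one_smul, smul_smul, zpow_one]

/-- Elements of bidegree `(0, r)` are multiples of `z ^ r`. -/
theorem exists_eq_mul_z_pow (r : ℕ) (hr : r < n) {d : H} (hd : d ∈ biPiece π ζ 0 r) :
    ∃ c ∈ biPiece π ζ 0 0, d = c * z ^ r := by
  induction r generalizing d with
  | zero => exact ⟨d, by simpa using hd, by simp⟩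
  | succ r ih =>
    have h1 := F.rSlice_mem hd
    rw [show (((r + 1 : ℕ) : ℤ) - 1) = r by push_cast; ring] at h1
    obtain ⟨c, hc, hdc⟩ := ih (by omega) h1
    -- The q-number of r + 1 is nonzero because ξ is primitive and 0 < r + 1 < n.
    have hne : ∑ i ∈ Finset.range (r + 1), ξ ^ i ≠ 0 := by
      have h2 := F.xi_prim.ne_one F.one_lt
      rw [geom_sum_eq h2]
      exact div_ne_zero (sub_ne_zero.2 (F.xi_prim.pow_ne_one_of_pos_of_lt (by omega) hr))
        (sub_ne_zero.2 h2)
    set q := ∑ i ∈ Finset.range (r + 1), ξ ^ i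
    refine ⟨q⁻¹ • c, Submodule.smul_mem _ _ hc, ?_⟩
    rw [← sub_eq_zero]
    refine F.eq_zero_of_rSlice (i := 0) (j := (r + 1 : ℕ)) (sub_mem hd ?_) ?_ ?_
    · have := F.mul_mem (Submodule.smul_mem _ q⁻¹ hc) (F.z_pow_mem (r + 1))
      simpa only [zero_add] using this
    · rw [sub_zero, Int.natCast_dvd_natCast]
      exact Nat.not_dvd_of_pos_of_lt (by omega) hr
    · rw [map_sub, hdc, smul_mul_assoc, map_smul, F.rSlice_classical_mul hc, F.rSlice_z_pow,
        mul_smul_comm, smul_smul, inv_mul_cancel₀ hne, one_smul, sub_self]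

theorem z_pow_ne_zero (m : ℕ) : z ^ m ≠ 0 := by
  have h1 : (1 : H) ≠ 0 := by
    intro h1
    have := F.counit_g
    rw [← mul_one g, h1, mul_zero, map_zero] at this
    exact zero_ne_one this
  have hz0 : z ≠ 0 := by
    intro h0
    have := F.rSlice_z
    rw [h0, map_zero] at this
    exact h1 this.symm
  have hzl : lWind π z = z := by simpa using F.mem_z.1
  induction m with
  | zero => simpa using h1
  | succ m ih =>
    rw [pow_succ]
    exact fun h' => (left_eq_zero_or F.dedekind (by rw [map_pow, hzl]) hzl h').elim ih hz0

/-- The generator `g ^ i z ^ e` of the piece of bidegree `(i, j)`. -/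
theorem generator_mem {i j : ℕ} (hi : i < n) :
    g ^ i * z ^ monomialExp n i j ∈ biPiece π ζ i j := by
  have := F.mul_mem (F.g_pow_mem i) (F.z_pow_mem (monomialExp n i j))
  rwa [F.biPiece_congr (i' := i) (j' := j) (by simp) ?_] at this
  rw [← dvd_neg]
  exact (dvd_sub_monomialExp (j := j) hi).trans (dvd_of_eq (by ring))

/-- The unit g^i, with inverse S(g)^i, reduces to left weight 0. -/
theorem exists_eq_mul_generator {i j : ℕ} (hi : i < n) (hj : j < n) {x : H}
    (hx : x ∈ biPiece π ζ i j) :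
    ∃ c ∈ biPiece π ζ 0 0, x = c * (g ^ i * z ^ monomialExp n i j) := by
  have h1 := F.mul_mem (F.pow_mem F.antipode_g_mem i) hx
  rw [F.biPiece_congr (i' := 0) (j' := monomialExp n i j) (by simp) ?_] at h1
  · obtain ⟨c, hc, hxc⟩ := F.exists_eq_mul_z_pow _ (monomialExp_lt hj) h1
    refine ⟨c, hc, ?_⟩
    rw [← mul_assoc, F.central hc, mul_assoc, ← hxc, ← mul_assoc, F.g_pow_mul_antipode_pow, one_mul]
  · exact (dvd_sub_monomialExp (j := j) hi).trans (dvd_of_eq (by ring))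

theorem eq_zero_of_mul_generator {c : H} (hc : c ∈ biPiece π ζ 0 0) {i e : ℕ}
    (h0 : c * (g ^ i * z ^ e) = 0) : c = 0 := by
  have hzl : lWind π z = z := by simpa using F.mem_z.1
  have hcl : lWind π c = c := by simpa using hc.1
  rw [← mul_assoc, F.central hc, mul_assoc] at h0
  have h1 := congrArg (HopfAlgebra.antipode k g ^ i * ·) h0
  simp only [← mul_assoc, F.antipode_pow_mul_g_pow, one_mul, mul_zero] at h1
  exact (left_eq_zero_or F.dedekind hcl (by rw [map_pow, hzl]) h1).resolve_right
    (F.z_pow_ne_zero e)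

theorem isBigradedGenerators [NeZero n] : IsBigradedGenerators π ζ
    (fun i j : Fin n => g ^ (i : ℕ) * z ^ monomialExp n i j) where
  mem i j := by
    rw [bigradedPiece_eq_biPiece]
    exact F.generator_mem i.2
  generates i j a ha := by
    rw [bigradedPiece_eq_biPiece] at ha
    obtain ⟨c, hc, hac⟩ := F.exists_eq_mul_generator i.2 j.2 ha
    refine ⟨⟨c, (mem_classicalComponent ζ).2 hc⟩, hac, ?_⟩
    rintro ⟨c', hc'⟩ hac'
    ext
    rw [← sub_eq_zero]
    refine F.eq_zero_of_mul_generator (sub_mem ((mem_classicalComponent ζ).1 hc') hc)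
      (i := i) (e := monomialExp n i j) ?_
    rw [sub_mul, ← hac, ← show a = c' * _ from hac', sub_self]
  zero_zero := by simp [monomialExp]
  counit i j := by
    rw [Bialgebra.counit_mul, Bialgebra.counit_pow, Bialgebra.counit_pow, F.counit_g, F.counit_z,
      one_pow, one_mul, zero_pow_eq]
    simp [monomialExp_eq_zero_iff i.2, Fin.ext_iff]

end TaftFrame

end Generators

/-! ### The twistor ideal as a Hopf ideal -/

section TwistorIdeal

variable {k : Type v} {H : Type u} [Field k] [Ring H] [HopfAlgebra k H] {π : H →ₐ[k] k}

theorem mem_twistorIdeal {c : H} (hc : c ∈ classicalAugmentation π) : c ∈ twistorIdeal π :=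
  Ideal.subset_span ⟨c, hc, 1, (mul_one c).symm⟩

theorem mem_classicalAugmentation {c : H} : c ∈ classicalAugmentation π ↔
    Coalgebra.counit (R := k) c = 0 ∧ c ∈ classicalComponent π := Iff.rfl

theorem sub_counit_mem_classicalAugmentation {a : H} (ha : a ∈ classicalComponent π) :
    a - Coalgebra.counit (R := k) a • 1 ∈ classicalAugmentation π := by
  refine mem_classicalAugmentation.2 ⟨by simp, sub_mem ha ?_⟩
  exact Subalgebra.smul_mem _ (one_mem _) _

theorem mk_classical {a : H} (ha : a ∈ classicalComponent π) :
    Ideal.Quotient.mkₐ k (twistorIdeal π) a = Coalgebra.counit (R := k) a • 1 := by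
  rw [← map_one (Ideal.Quotient.mkₐ k (twistorIdeal π)), ← map_smul, Ideal.Quotient.mkₐ_eq_mk,
    Ideal.Quotient.eq]
  exact mem_twistorIdeal (sub_counit_mem_classicalAugmentation ha)

/-- Centrality turns a left multiple of c b into another c b'. Quantifying over all left multiples
is what carries the span induction through the scalar step. -/
theorem twistorIdeal_induction
    (hcen : ∀ c ∈ classicalAugmentation π, ∀ b : H, c * b = b * c)
    {p : H → Prop} {x : H} (hx : x ∈ twistorIdeal π)
    (hmul : ∀ c ∈ classicalAugmentation π, ∀ b, p (c * b)) (h0 : p 0)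
    (hadd : ∀ x y, p x → p y → p (x + y)) : p x := by
  have h1 : ∀ r : H, p (r * x) := by
    refine Submodule.span_induction (p := fun x _ => ∀ r : H, p (r * x)) ?_ ?_ ?_ ?_ hx
    · rintro x ⟨c, hc, b, rfl⟩ r
      rw [← mul_assoc, ← hcen c hc, mul_assoc]
      exact hmul c hc _
    · intro r
      rwa [mul_zero]
    · intro x y _ _ hx hy r
      rw [mul_add]
      exact hadd _ _ (hx r) (hy r)
    · intro a x _ hx r
      rw [smul_eq_mul, ← mul_assoc]
      exact hx _
  simpa using h1 1

theorem twistorIdeal_eq_mul (hcen : ∀ c ∈ classicalAugmentation π, ∀ b : H, c * b = b * c) :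
    (twistorIdeal π).restrictScalars k = classicalAugmentation π * ⊤ := by
  refine le_antisymm (fun x hx => ?_) (Submodule.mul_le.2 fun c hc b _ => ?_)
  · exact twistorIdeal_induction hcen (p := fun x => x ∈ classicalAugmentation π * ⊤) hx
      (fun c hc b => Submodule.mul_mem_mul hc trivial) (zero_mem _) fun _ _ => add_mem
  · exact Ideal.subset_span ⟨c, hc, b, rfl⟩

/-- If the classical component is central and stable under left slices, then the twistor
ideal is a Hopf ideal. -/
theorem twistorIdeal_isHopfIdeal
    (hcen : ∀ c ∈ classicalAugmentation π, ∀ b : H, c * b = b * c)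
    (hslice : ∀ (φ : H →ₗ[k] k), ∀ a ∈ classicalComponent π, lSlice φ a ∈ classicalComponent π) :
    (twistorIdeal π).IsHopfIdeal k := by
  let q := Ideal.Quotient.mkₐ k (twistorIdeal π)
  -- The right factors w_i are left slices of c, hence in H₀ and scalar in the quotient. So Δ(c)
  -- becomes c ⊗ 1, and ∑ S(v_i) w_i becomes S(c).
  have hrep : ∀ c ∈ classicalAugmentation π, ∃ (ι : Type u) (s : Finset ι) (v w : ι → H)
      (r : ι → k), Coalgebra.comul (R := k) c = ∑ i ∈ s, v i ⊗ₜ[k] w i ∧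
      (∀ i, q (w i) = r i • 1) ∧ ∑ i ∈ s, r i • v i = c := by
    intro c hc
    obtain ⟨ι, s, v, φ, hsum⟩ := exists_sum_tmul_slice (Coalgebra.comul (R := k) c)
    have hw : ∀ i, Coalgebra.counit (R := k) (lSlice (φ i) c) = φ i c := fun i => counit_lSlice _ _
    refine ⟨ι, s, v, fun i => lSlice (φ i) c, fun i => φ i c, hsum, fun i => ?_, ?_⟩
    · change q (lSlice (φ i) c) = φ i c • 1
      rw [← hw]
      exact mk_classical (hslice _ _ hc.2)
    · have h1 := rSlice_counit (k := k) c
      rw [rSlice_apply, hsum, map_sum, map_sum] at h1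
      conv_rhs => rw [← h1]
      refine Finset.sum_congr rfl fun i _ => ?_
      rw [LinearMap.lTensor_tmul, TensorProduct.rid_tmul]
      exact congrArg (· • v i) (hw i).symm
  have hq : ∀ x, x ∈ twistorIdeal π → q x = 0 := fun x hx => Ideal.Quotient.eq_zero_iff_mem.2 hx
  refine { counit_eq_zero := ?_, map_mkQ_comul_eq_zero := ?_, antipode_mem := ?_ }
  · intro x hx
    refine twistorIdeal_induction hcen (p := fun x => Coalgebra.counit (R := k) x = 0) hx
      (fun c hc b => ?_) (map_zero _) fun x y hx hy => by rw [map_add, hx, hy, add_zero]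
    rw [Bialgebra.counit_mul, (mem_classicalAugmentation.1 hc).1, zero_mul]
  · intro x hx
    change Algebra.TensorProduct.map q q (Coalgebra.comul (R := k) x) = 0
    refine twistorIdeal_induction hcen
      (p := fun x => Algebra.TensorProduct.map q q (Coalgebra.comul (R := k) x) = 0) hx
      (fun c hc b => ?_) (by simp) fun x y hx hy => by rw [map_add, map_add, hx, hy, add_zero]
    obtain ⟨ι, s, v, w, r, hcom, hqw, hsum⟩ := hrep c hc
    have h1 : Algebra.TensorProduct.map q q (Coalgebra.comul (R := k) c) = 0 := by
      have h2 : Algebra.TensorProduct.map q q (Coalgebra.comul (R := k) c) = q c ⊗ₜ[k] 1 := by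
        rw [hcom, map_sum, ← hsum, map_sum, TensorProduct.sum_tmul]
        refine Finset.sum_congr rfl fun i _ => ?_
        rw [Algebra.TensorProduct.map_tmul, hqw, map_smul, TensorProduct.smul_tmul]
      rw [h2, hq c (mem_twistorIdeal hc), TensorProduct.zero_tmul]
    rw [Bialgebra.comul_mul, map_mul, h1, zero_mul]
  · intro x hx
    refine twistorIdeal_induction hcen
      (p := fun x => HopfAlgebra.antipode k x ∈ twistorIdeal π) hx
      (fun c hc b => ?_) (by simp) fun x y hx hy => by rw [map_add]; exact add_mem hx hy
    rw [HopfAlgebra.antipode_mul_antidistrib]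
    refine Ideal.mul_mem_left _ _ (Ideal.Quotient.eq_zero_iff_mem.1 ?_)
    obtain ⟨ι, s, v, w, r, hcom, hqw, hsum⟩ := hrep c hc
    have h1 := congrArg q (HopfAlgebra.mul_antipode_rTensor_comul_apply (R := k) c)
    rw [(mem_classicalAugmentation.1 hc).1, map_zero, map_zero, hcom, map_sum, map_sum,
      map_sum] at h1
    change q (HopfAlgebra.antipode k c) = 0
    rw [← h1, ← hsum, map_sum, map_sum]
    refine Finset.sum_congr rfl fun i _ => ?_
    rw [LinearMap.rTensor_tmul, LinearMap.mul'_apply, map_mul, hqw, map_smul, map_smul,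
      mul_smul_comm, mul_one]

end TwistorIdeal

/-! ### The basis of the twistor -/

namespace TaftFrame

variable {k : Type v} {H : Type u} [Field k] [Ring H] [HopfAlgebra k H]
  {π : H →ₐ[k] k} {ζ : k} {n : ℕ} {h u : H} {ξ : k} {t : ℕ} {f : H →ₗ[k] k} {z g : H}
  (F : TaftFrame π ζ n h u ξ t f z g)

include F

theorem classicalAugmentation_central : ∀ c ∈ classicalAugmentation π, ∀ b : H, c * b = b * c :=
  fun _ hc b => F.central ((mem_classicalComponent ζ).1 hc.2) b

theorem isHopfIdeal : (twistorIdeal π).IsHopfIdeal k :=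
  twistorIdeal_isHopfIdeal F.classicalAugmentation_central fun φ a ha => by
    rw [mem_classicalComponent ζ] at ha ⊢
    exact F.lSlice_classical φ ha

theorem exists_sum_generator (x : H) : ∃ c : Fin n × Fin n → H,
    (∀ p, c p ∈ classicalComponent π) ∧
      x = ∑ p, c p * (g ^ (p.1 : ℕ) * z ^ monomialExp n p.1 p.2) := by
  have h1 : ∀ p : Fin n × Fin n, ∃ c ∈ biPiece π ζ 0 0,
      rProj π ζ n (p.2 : ℕ) (lProj π ζ n (p.1 : ℕ) x) =
        c * (g ^ (p.1 : ℕ) * z ^ monomialExp n p.1 p.2) :=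
    fun p => F.exists_eq_mul_generator p.1.2 p.2.2 (F.rProj_mem (F.lWind_lProj _ _))
  choose c hc hcx using h1
  refine ⟨c, fun p => (mem_classicalComponent ζ).2 (hc p), ?_⟩
  simp only [← hcx]
  rw [Fintype.sum_prod_type]
  conv_lhs => rw [← F.sum_lProj x, ← Fin.sum_univ_eq_sum_range (fun i => lProj π ζ n i x)]
  refine Finset.sum_congr rfl fun i _ => ?_
  conv_lhs => rw [← F.sum_rProj (lProj π ζ n i x),
    ← Fin.sum_univ_eq_sum_range (fun j => rProj π ζ n j (lProj π ζ n i x))]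

theorem eq_zero_of_sum_generator {c : Fin n × Fin n → H} (hc : ∀ p, c p ∈ classicalComponent π)
    (h0 : ∑ p, c p * (g ^ (p.1 : ℕ) * z ^ monomialExp n p.1 p.2) = 0) (p : Fin n × Fin n) :
    c p = 0 := by
  have hm : ∀ p : Fin n × Fin n, c p * (g ^ (p.1 : ℕ) * z ^ monomialExp n p.1 p.2) ∈
      biPiece π ζ (p.1 : ℕ) (p.2 : ℕ) := fun p => by
    simpa using F.mul_mem ((mem_classicalComponent ζ).1 (hc p)) (F.generator_mem p.1.2)
  have hdvd : ∀ i j : Fin n, (n : ℤ) ∣ (i : ℕ) - (j : ℕ) → i = j := by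
    intro i j hd
    have := Int.eq_zero_of_abs_lt_dvd hd (by rw [abs_lt]; omega)
    exact Fin.ext (by omega)
  have h1 := congrArg (fun x => rProj π ζ n (p.2 : ℕ) (lProj π ζ n (p.1 : ℕ) x)) h0
  simp only [map_sum, map_zero] at h1
  rw [Finset.sum_eq_single p] at h1
  · rw [F.lProj_eigen (hm p).1, if_pos (by simp), F.rProj_eigen (hm p).2, if_pos (by simp)] at h1
    exact F.eq_zero_of_mul_generator ((mem_classicalComponent ζ).1 (hc p)) h1
  · intro p' _ hne
    rw [F.lProj_eigen (hm p').1]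
    split_ifs with h2
    · rw [F.rProj_eigen (hm p').2, if_neg]
      exact fun h3 => hne (Prod.ext (hdvd _ _ h2) (hdvd _ _ h3))
    · rw [map_zero]
  · intro h; exact absurd (Finset.mem_univ p) h

theorem exists_sum_of_mem_twistorIdeal {x : H} (hx : x ∈ twistorIdeal π) :
    ∃ c : Fin n × Fin n → H, (∀ p, c p ∈ classicalAugmentation π) ∧
      x = ∑ p, c p * (g ^ (p.1 : ℕ) * z ^ monomialExp n p.1 p.2) := by
  refine twistorIdeal_induction F.classicalAugmentation_central (p := fun x =>
    ∃ c : Fin n × Fin n → H, (∀ p, c p ∈ classicalAugmentation π) ∧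
      x = ∑ p, c p * (g ^ (p.1 : ℕ) * z ^ monomialExp n p.1 p.2)) hx
    (fun a ha b => ?_) ⟨0, fun _ => zero_mem _, by simp⟩ ?_
  · obtain ⟨c, hc, rfl⟩ := F.exists_sum_generator b
    refine ⟨fun p => a * c p, fun p => ?_, ?_⟩
    · refine mem_classicalAugmentation.2 ⟨?_, mul_mem ha.2 (hc p)⟩
      rw [Bialgebra.counit_mul, (mem_classicalAugmentation.1 ha).1, zero_mul]
    · simp only [Finset.mul_sum, mul_assoc]
  · rintro x y ⟨c, hc, rfl⟩ ⟨d, hd, rfl⟩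
    exact ⟨c + d, fun p => add_mem (hc p) (hd p), by simp [add_mul, Finset.sum_add_distrib]⟩

/-- The images of the generators form a basis of the twistor. -/
def twistorBasis : Module.Basis (Fin n × Fin n) k (Twistor π) :=
  Module.Basis.mk (v := fun p => Ideal.Quotient.mk (twistorIdeal π)
      (g ^ (p.1 : ℕ) * z ^ monomialExp n p.1 p.2))
    (by
      rw [Fintype.linearIndependent_iff]
      intro a ha p
      have h1 : ∑ p, a p • (g ^ (p.1 : ℕ) * z ^ monomialExp n p.1 p.2) ∈ twistorIdeal π := by
        rw [← Ideal.Quotient.eq_zero_iff_mem, ← ha]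
        exact map_sum (Ideal.Quotient.mkₐ k (twistorIdeal π)) _ _
      obtain ⟨c, hc, hsum⟩ := F.exists_sum_of_mem_twistorIdeal h1
      -- By freeness over H₀ each scalar a_p equals the coefficient c_p, whose counit is 0.
      have h2 := F.eq_zero_of_sum_generator (c := fun p => a p • 1 - c p)
        (fun p => sub_mem (Subalgebra.smul_mem _ (one_mem _) _) (hc p).2)
        (by simp only [sub_mul, smul_mul_assoc, one_mul, Finset.sum_sub_distrib, hsum, sub_self]) p
      have h3 := congrArg (Coalgebra.counit (R := k)) h2
      rw [map_sub, (mem_classicalAugmentation.1 (hc p)).1] at h3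
      simpa using h3)
    (by
      rintro x -
      obtain ⟨x, rfl⟩ := Ideal.Quotient.mk_surjective x
      obtain ⟨c, hc, rfl⟩ := F.exists_sum_generator x
      rw [map_sum]
      refine sum_mem fun p _ => ?_
      have h1 := mk_classical (hc p)
      rw [Ideal.Quotient.mkₐ_eq_mk] at h1
      rw [map_mul, h1, smul_mul_assoc, one_mul]
      exact Submodule.smul_mem _ _ (Submodule.subset_span ⟨p, rfl⟩))

theorem twistorBasis_apply (i j : Fin n) : F.twistorBasis (i, j) =
    Ideal.Quotient.mk (twistorIdeal π) (g ^ (i : ℕ) * z ^ monomialExp n i j) := by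
  simp [twistorBasis]

theorem mk_z_mul_g : Ideal.Quotient.mk (twistorIdeal π) z * Ideal.Quotient.mk (twistorIdeal π) g =
    ξ • (Ideal.Quotient.mk (twistorIdeal π) g * Ideal.Quotient.mk (twistorIdeal π) z) := by
  rw [← map_mul, F.z_mul_g, ← map_mul]
  exact map_smul (Ideal.Quotient.mkₐ k (twistorIdeal π)) _ _

theorem mk_z_pow : Ideal.Quotient.mk (twistorIdeal π) z ^ n = 0 := by
  rw [← map_pow, ← Ideal.Quotient.mkₐ_eq_mk k,
    mk_classical ((mem_classicalComponent ζ).2 F.z_pow_mem_classical), Bialgebra.counit_pow,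
    F.counit_z, zero_pow F.pos.ne', zero_smul]

theorem mk_g_pow : Ideal.Quotient.mk (twistorIdeal π) g ^ n = 1 := by
  rw [← map_pow, ← Ideal.Quotient.mkₐ_eq_mk k,
    mk_classical ((mem_classicalComponent ζ).2 F.g_pow_mem_classical), Bialgebra.counit_pow,
    F.counit_g, one_pow, one_smul]

end TaftFrame

/-! ### Spanning by ordered monomials -/

section Monomials

variable {k : Type*} {C : Type*} [Field k] [Ring C] [Algebra k C] {g y : C} {ξ : k}

theorem mul_pow_of_skew_comm (hyg : y * g = ξ • (g * y)) (m : ℕ) :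
    y * g ^ m = ξ ^ m • (g ^ m * y) := by
  induction m with
  | zero => simp
  | succ m ih =>
    rw [pow_succ, ← mul_assoc, ih, smul_mul_assoc, mul_assoc, hyg, mul_smul_comm, smul_smul,
      ← mul_assoc, pow_succ]

/-- The span contains 1 and is stable under left multiplication by g and y, hence by the whole
algebra. -/
theorem span_monomials_eq_top (hyg : y * g = ξ • (g * y))
    (hadj : Algebra.adjoin k {g, y} = ⊤) :
    Submodule.span k (Set.range fun p : ℕ × ℕ => g ^ p.1 * y ^ p.2) = ⊤ := by
  set M := Submodule.span k (Set.range fun p : ℕ × ℕ => g ^ p.1 * y ^ p.2)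
  have hmem : ∀ a b : ℕ, g ^ a * y ^ b ∈ M := fun a b => Submodule.subset_span ⟨(a, b), rfl⟩
  have hgen : ∀ c : C, (∀ a b : ℕ, c * (g ^ a * y ^ b) ∈ M) → ∀ m ∈ M, c * m ∈ M := by
    intro c hc m hm
    refine Submodule.span_induction (p := fun m _ => c * m ∈ M) ?_ (by simp) ?_ ?_ hm
    · rintro _ ⟨p, rfl⟩
      exact hc _ _
    · intro x x' _ _ hx hx'
      rw [mul_add]
      exact add_mem hx hx'
    · intro r x _ hx
      rw [mul_smul_comm]
      exact M.smul_mem _ hx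
  rw [eq_top_iff]
  rintro b -
  have hb : b ∈ Algebra.adjoin k {g, y} := hadj ▸ Algebra.mem_top
  have key : ∀ m ∈ M, b * m ∈ M := by
    refine Algebra.adjoin_induction (p := fun b _ => ∀ m ∈ M, b * m ∈ M) ?_ ?_ ?_ ?_ hb
    · rintro x (rfl | rfl)
      · refine hgen _ fun a b => ?_
        rw [← mul_assoc, ← pow_succ']
        exact hmem _ _
      · refine hgen _ fun a b => ?_
        rw [← mul_assoc, mul_pow_of_skew_comm hyg, smul_mul_assoc, mul_assoc, ← pow_succ']
        exact M.smul_mem _ (hmem _ _)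
    · intro r m hm
      rw [← Algebra.smul_def]
      exact M.smul_mem _ hm
    · intro x x' _ _ hx hx' m hm
      rw [add_mul]
      exact add_mem (hx m hm) (hx' m hm)
    · intro x x' _ _ hx hx' m hm
      rw [mul_assoc]
      exact hx _ (hx' m hm)
  simpa using key 1 (by simpa using hmem 0 0)

theorem span_generators_eq_top {n : ℕ} (hn : 0 < n) (hyg : y * g = ξ • (g * y))
    (hadj : Algebra.adjoin k {g, y} = ⊤) (hg : g ^ n = 1) (hy : y ^ n = 0) :
    Submodule.span k (Set.range fun p : Fin n × Fin n =>
      g ^ (p.1 : ℕ) * y ^ monomialExp n p.1 p.2) = ⊤ := by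
  rw [eq_top_iff, ← span_monomials_eq_top hyg hadj, Submodule.span_le]
  rintro _ ⟨⟨a, b⟩, rfl⟩
  by_cases hb : b < n
  · have ha := Nat.mod_lt a hn
    obtain ⟨j, hj, hjb⟩ := exists_monomialExp_eq ha hb
    refine Submodule.subset_span ⟨(⟨a % n, ha⟩, ⟨j, hj⟩), ?_⟩
    change g ^ (a % n) * y ^ monomialExp n (a % n) j = g ^ a * y ^ b
    rw [hjb]
    conv_rhs => rw [← Nat.mod_add_div a n, pow_add, pow_mul, hg, one_pow, mul_one]
  · obtain ⟨d, rfl⟩ := Nat.exists_eq_add_of_le (not_lt.1 hb)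
    simp [pow_add, hy]

/-- A linear map sending a spanning family to a basis is bijective. -/
theorem bijective_of_map_span_basis {V W ι : Type*} [AddCommGroup V] [Module k V]
    [AddCommGroup W] [Module k W] [Fintype ι] (e : V →ₗ[k] W) (w : ι → V)
    (b : Module.Basis ι k W) (hspan : Submodule.span k (Set.range w) = ⊤)
    (hw : ∀ i, e (w i) = b i) : Function.Bijective e := by
  constructor
  · rw [injective_iff_map_eq_zero]
    intro x hx
    have hxm : x ∈ Submodule.span k (Set.range w) := hspan ▸ Submodule.mem_top
    obtain ⟨c, rfl⟩ := (Submodule.mem_span_range_iff_exists_fun k).1 hxm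
    rw [map_sum] at hx
    simp only [map_smul, hw] at hx
    have := Fintype.linearIndependent_iff.1 b.linearIndependent c hx
    simp [this]
  · rw [← LinearMap.range_eq_top, eq_top_iff, ← b.span_eq, Submodule.span_le]
    rintro _ ⟨i, rfl⟩
    exact ⟨w i, hw i⟩

end Monomials

/-! ### Kernels of bialgebra homomorphisms -/

section Kernel

variable {k : Type*} {A B : Type*} [Field k] [Ring A] [Ring B] [HopfAlgebra k A] [HopfAlgebra k B]

/-- Both composites are convolution inverses of f, one on the left and one on the right. -/
theorem antipode_bialgHom (f : A →ₐc[k] B) (a : A) :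
    HopfAlgebra.antipode k (f a) = f (HopfAlgebra.antipode k a) := by
  have h1 : (WithConv.toConv (HopfAlgebra.antipode k ∘ₗ (f : A →ₗ[k] B)) *
      WithConv.toConv (f : A →ₗ[k] B) : WithConv (A →ₗ[k] B)) = 1 := by
    have := LinearMap.convMul_comp_coalgHom_distrib
      (WithConv.toConv (HopfAlgebra.antipode k)) (WithConv.toConv LinearMap.id)
      (f : A →ₗc[k] B)
    rw [LinearMap.antipode_mul_id] at this
    apply WithConv.ofConv_injective
    refine this.symm.trans ?_
    ext a
    simp
  have h2 : (WithConv.toConv (f : A →ₗ[k] B) *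
      WithConv.toConv ((f : A →ₗ[k] B) ∘ₗ HopfAlgebra.antipode k) : WithConv (A →ₗ[k] B)) = 1 := by
    have := LinearMap.algHom_comp_convMul_distrib (f : A →ₐ[k] B)
      (WithConv.toConv LinearMap.id) (WithConv.toConv (HopfAlgebra.antipode k (A := A)))
    rw [LinearMap.id_mul_antipode] at this
    apply WithConv.ofConv_injective
    refine this.symm.trans ?_
    ext a
    simpa using AlgHomClass.commutes f _
  have h3 := left_inv_eq_right_inv h1 h2
  exact LinearMap.congr_fun (congrArg WithConv.ofConv h3) a

/-- The kernel of a bialgebra homomorphism of Hopf algebras is a Hopf ideal. -/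
theorem isHopfIdeal_of_mem_iff (f : A →ₐc[k] B) (I : Ideal A) (hI : ∀ x, x ∈ I ↔ f x = 0) :
    I.IsHopfIdeal k := by
  refine { counit_eq_zero := ?_, map_mkQ_comul_eq_zero := ?_, antipode_mem := ?_ }
  · intro x hx
    have h1 : Coalgebra.counit (R := k) (f x) = Coalgebra.counit (R := k) x := by simp
    rw [← h1, (hI x).1 hx, map_zero]
  · intro x hx
    let e : (A ⧸ I.restrictScalars k) →ₗ[k] B :=
      (I.restrictScalars k).liftQ (f : A →ₗ[k] B) fun x hx => (hI x).1 hx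
    have he : Function.Injective e := by
      rw [← LinearMap.ker_eq_bot]
      refine Submodule.ker_liftQ_eq_bot _ _ _ fun x hx => (hI x).2 hx
    -- Over a field e ⊗ e stays injective, so the vanishing can be tested in B ⊗ B.
    refine TensorProduct.map_injective_of_flat_flat e e he he ?_
    have h2 : e ∘ₗ (I.restrictScalars k).mkQ = (f : A →ₗ[k] B) := Submodule.liftQ_mkQ _ _ _
    rw [map_zero, ← LinearMap.comp_apply, ← TensorProduct.map_comp, h2]
    have h1 := CoalgHomClass.map_comp_comul_apply f x
    rw [(hI x).1 hx, map_zero] at h1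
    exact h1
  · intro x hx
    rw [hI, ← antipode_bialgHom, (hI x).1 hx, map_zero]

end Kernel

/-! ### The Taft algebra and the presented quotient -/

section TaftSide

variable {k : Type v} [Field k] {n : ℕ} {ξ : k}

namespace Taft

theorem adjoin_gen : Algebra.adjoin k {gen k n ξ Gen.g, gen k n ξ Gen.x} = ⊤ := by
  rw [eq_top_iff]
  rintro a -
  refine induction (C := fun a => a ∈ Algebra.adjoin k {gen k n ξ Gen.g, gen k n ξ Gen.x})
    (fun r => Subalgebra.algebraMap_mem _ r) ?_ (fun _ _ => mul_mem) (fun _ _ => add_mem) a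
  rintro (_ | _) <;> exact Algebra.subset_adjoin (by simp)

variable (hξ : IsPrimitiveRoot ξ n)

theorem taftChar_gen (a : Gen) : taftChar n hξ (gen k n ξ a) = charGen ξ a := by
  simp [taftChar]

variable [NeZero n]

theorem lWind_g : lWind (taftChar n hξ) (gen k n ξ Gen.g) = ξ⁻¹ • gen k n ξ Gen.g := by
  rw [lWind_eq_lSlice, lSlice_apply, comul_gen]
  simp [comulGen, taftChar_gen, charGen]

theorem lWind_x : lWind (taftChar n hξ) (gen k n ξ Gen.x) = gen k n ξ Gen.x := by
  rw [lWind_eq_lSlice, lSlice_apply, comul_gen]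
  simp [comulGen, taftChar_gen, charGen]

theorem rWind_g : rWind (taftChar n hξ) (gen k n ξ Gen.g) = ξ⁻¹ • gen k n ξ Gen.g := by
  rw [rWind_eq_rSlice, rSlice_apply, comul_gen]
  simp [comulGen, taftChar_gen, charGen]

theorem rWind_x : rWind (taftChar n hξ) (gen k n ξ Gen.x) = ξ⁻¹ • gen k n ξ Gen.x := by
  rw [rWind_eq_rSlice, rSlice_apply, comul_gen]
  simp [comulGen, taftChar_gen, charGen]

theorem x_pow_mem_twistorIdeal : gen k n ξ Gen.x ^ n ∈ twistorIdeal (taftChar n hξ) := by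
  refine mem_twistorIdeal (mem_classicalAugmentation.2 ⟨?_, ?_⟩)
  · rw [Bialgebra.counit_pow, counit_gen]
    simp [counitGen, NeZero.ne n]
  · rw [classicalComponent, Algebra.mem_inf, mem_leftComponent, mem_rightComponent, map_pow,
      map_pow, lWind_x, rWind_x, smul_pow, inv_pow, hξ.pow_eq_one]
    simp

theorem monomial_mem_biPiece (a b : ℕ) : gen k n ξ Gen.g ^ a * gen k n ξ Gen.x ^ b ∈
    biPiece (taftChar n hξ) ξ (-a) (-a - b) := by
  have hξ0 : ξ ≠ 0 := hξ.ne_zero (NeZero.ne n)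
  refine ⟨?_, ?_⟩
  · rw [map_mul, map_pow, map_pow, lWind_g, lWind_x, smul_pow, smul_mul_assoc, inv_pow, zpow_neg,
      zpow_natCast]
  · rw [map_mul, map_pow, map_pow, rWind_g, rWind_x, smul_pow, smul_pow, smul_mul_smul_comm,
      zpow_sub₀ hξ0, zpow_neg, zpow_natCast, zpow_natCast, inv_pow, inv_pow, div_eq_mul_inv]

/-- An algebra homomorphism killing `x ^ n` is scalar on the classical component. -/
theorem exists_map_classical_eq_smul {B : Type*} [Ring B] [Algebra k B]
    (θ : Taft k n ξ →ₐ[k] B) (hn : (n : k) ≠ 0) (hθ : θ (gen k n ξ Gen.x) ^ n = 0)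
    {c : Taft k n ξ} (hc : c ∈ classicalComponent (taftChar n hξ)) : ∃ r : k, θ c = r • 1 := by
  have hcm := (mem_classicalComponent ξ).1 hc
  -- The projector onto H₀ fixes c, and on g^a x^b it vanishes unless n divides both a and b; such a
  -- monomial maps to 1 or 0.
  set P : Module.End k (Taft k n ξ) :=
    rProj (taftChar n hξ) ξ n 0 * lProj (taftChar n hξ) ξ n 0 with hP
  have hPeig : ∀ {i j : ℤ} {a : Taft k n ξ}, a ∈ biPiece (taftChar n hξ) ξ i j →
      P a = if (n : ℤ) ∣ i ∧ (n : ℤ) ∣ j then a else 0 := by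
    intro i j a ha
    have h1 : lProj (taftChar n hξ) ξ n 0 a = if (n : ℤ) ∣ i then a else 0 := by
      rw [lProj, eigenProj_of_eigen hξ hn 0 ha.1, sub_zero]
    have h2 : rProj (taftChar n hξ) ξ n 0 a = if (n : ℤ) ∣ j then a else 0 := by
      rw [rProj, eigenProj_of_eigen hξ hn 0 ha.2, sub_zero]
    rw [hP, Module.End.mul_apply, h1]
    by_cases hi : (n : ℤ) ∣ i
    · simp [hi, h2]
    · simp [hi]
  have hall : ∀ b : Taft k n ξ, θ (P b) ∈ Submodule.span k {(1 : B)} := by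
    intro b
    have hb : b ∈ Submodule.span k
        (Set.range fun p : ℕ × ℕ => gen k n ξ Gen.g ^ p.1 * gen k n ξ Gen.x ^ p.2) := by
      rw [span_monomials_eq_top (ξ := ξ) x_mul_g adjoin_gen]
      exact Submodule.mem_top
    refine Submodule.span_induction (p := fun b _ => θ (P b) ∈ Submodule.span k {(1 : B)})
      ?_ (by simp) (fun x y _ _ hx hy => by rw [map_add, map_add]; exact add_mem hx hy)
      (fun r x _ hx => by rw [map_smul, map_smul]; exact Submodule.smul_mem _ _ hx) hb
    rintro _ ⟨⟨a, b⟩, rfl⟩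
    rw [hPeig (monomial_mem_biPiece hξ a b)]
    split_ifs with hd
    · have ha : n ∣ a := by
        have := hd.1
        rwa [dvd_neg, Int.natCast_dvd_natCast] at this
      have hb : n ∣ b := by
        have := dvd_sub hd.1 hd.2
        rwa [sub_sub_cancel, Int.natCast_dvd_natCast] at this
      obtain ⟨a', rfl⟩ := ha
      obtain ⟨b', rfl⟩ := hb
      rw [map_mul, map_pow, map_pow, pow_mul, pow_mul, hθ, ← map_pow, g_pow, map_one, one_pow,
        one_mul, zero_pow_eq]
      split_ifs
      · exact Submodule.mem_span_singleton_self _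
      · exact zero_mem _
    · rw [map_zero]; exact zero_mem _
  have h1 := hall c
  rw [hPeig hcm, if_pos (by simp)] at h1
  obtain ⟨r, hr⟩ := Submodule.mem_span_singleton.1 h1
  exact ⟨r, hr.symm⟩

end Taft

namespace SmallTaft

theorem adjoin_gen : Algebra.adjoin k {gen k n ξ Gen.g, gen k n ξ Gen.x} = ⊤ := by
  rw [eq_top_iff]
  rintro a -
  obtain ⟨a, rfl⟩ := RingQuot.mkAlgHom_surjective k (SmallTaftRel k n ξ) a
  induction a using FreeAlgebra.induction with
  | grade0 r => rw [AlgHom.commutes]; exact Subalgebra.algebraMap_mem _ r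
  | grade1 a =>
    change gen k n ξ a ∈ _
    cases a <;> exact Algebra.subset_adjoin (by simp)
  | mul a b ha hb => rw [map_mul]; exact mul_mem ha hb
  | add a b ha hb => rw [map_add]; exact add_mem ha hb

theorem g_pow : gen k n ξ Gen.g ^ n = 1 := by
  have h := RingQuot.mkAlgHom_rel k (SmallTaftRel.g_pow (k := k) (n := n) (ξ := ξ))
  rwa [map_pow, map_one] at h

theorem x_pow : gen k n ξ Gen.x ^ n = 0 := by
  have h := RingQuot.mkAlgHom_rel k (SmallTaftRel.y_pow (k := k) (n := n) (ξ := ξ))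
  rwa [map_pow, map_zero] at h

theorem x_mul_g : gen k n ξ Gen.x * gen k n ξ Gen.g =
    ξ • (gen k n ξ Gen.g * gen k n ξ Gen.x) := by
  have h := RingQuot.mkAlgHom_rel k (SmallTaftRel.comm (k := k) (n := n) (ξ := ξ))
  rwa [map_mul, map_smul, map_mul] at h

/-- The universal property of `k⟨g, y⟩ / (y ^ n, g ^ n - 1, y g - ξ g y)`. -/
theorem exists_lift {B : Type*} [Ring B] [Algebra k B] {g y : B} (hg : g ^ n = 1) (hy : y ^ n = 0)
    (hyg : y * g = ξ • (g * y)) :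
    ∃ ψ : SmallTaft k n ξ →ₐ[k] B, ψ (gen k n ξ Gen.g) = g ∧ ψ (gen k n ξ Gen.x) = y := by
  let b : Gen → B := fun a => Gen.casesOn a g y
  have hrel : ∀ ⦃a a' : FreeAlgebra k Gen⦄, SmallTaftRel k n ξ a a' →
      FreeAlgebra.lift k b a = FreeAlgebra.lift k b a' := by
    rintro _ _ (_ | _ | _)
    · simpa using hg
    · simpa using hy
    · simpa using hyg
  refine ⟨RingQuot.liftAlgHom k ⟨FreeAlgebra.lift k b, hrel⟩, ?_, ?_⟩
  · exact (RingQuot.liftAlgHom_mkAlgHom_apply k _ hrel _).trans (FreeAlgebra.lift_ι_apply _ _)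
  · exact (RingQuot.liftAlgHom_mkAlgHom_apply k _ hrel _).trans (FreeAlgebra.lift_ι_apply _ _)

end SmallTaft

end TaftSide

/-! ### Comparison of the two twistors -/

namespace TaftFrame

variable {k : Type v} {H : Type u} [Field k] [Ring H] [HopfAlgebra k H]
  {π : H →ₐ[k] k} {ζ : k} {n : ℕ} {h u : H} {ξ : k} {t : ℕ} {f : H →ₗ[k] k} {z g : H}
  (F : TaftFrame π ζ n h u ξ t f z g)

include F

/-- A homomorphism to the twistor, from an algebra generated by elements satisfying the
relations of `SmallTaft`, that matches the generators is bijective. -/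
theorem bijective_of_generators {C : Type*} [Ring C] [Algebra k C] {a b : C}
    (hba : b * a = ξ • (a * b)) (hadj : Algebra.adjoin k {a, b} = ⊤) (ha : a ^ n = 1)
    (hb : b ^ n = 0) (Ψ : C →ₐ[k] Twistor π) (hΨa : Ψ a = Ideal.Quotient.mk (twistorIdeal π) g)
    (hΨb : Ψ b = Ideal.Quotient.mk (twistorIdeal π) z) : Function.Bijective Ψ :=
  bijective_of_map_span_basis Ψ.toLinearMap _ F.twistorBasis
    (span_generators_eq_top F.pos hba hadj ha hb) fun p => by
      rw [F.twistorBasis_apply p.1 p.2, AlgHom.toLinearMap_apply]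
      simp only [map_mul, map_pow, hΨa, hΨb]

theorem exists_bialgHom [(twistorIdeal π).IsHopfIdeal k] :
    ∃ θ : Taft k n ξ →ₐc[k] Twistor π,
      θ (Taft.gen k n ξ Gen.g) = Ideal.Quotient.mk (twistorIdeal π) g ∧
      θ (Taft.gen k n ξ Gen.x) = Ideal.Quotient.mk (twistorIdeal π) z := by
  let θ : Taft k n ξ →ₐ[k] Twistor π :=
    Taft.lift (fun a => Gen.casesOn a (Ideal.Quotient.mk (twistorIdeal π) g)
      (Ideal.Quotient.mk (twistorIdeal π) z)) F.mk_g_pow F.mk_z_mul_g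
  have hg : θ (Taft.gen k n ξ Gen.g) = Ideal.Quotient.mk (twistorIdeal π) g := by
    simp [θ]
  have hx : θ (Taft.gen k n ξ Gen.x) = Ideal.Quotient.mk (twistorIdeal π) z := by
    simp [θ]
  refine ⟨BialgHom.ofAlgHom θ (Taft.algHom_ext ?_) (Taft.algHom_ext ?_), hg, hx⟩
  · rintro (_ | _)
    · simp [hg, Taft.counit_gen, Taft.counitGen, F.counit_g]
    · simp [hx, Taft.counit_gen, Taft.counitGen, F.counit_z]
  · rintro (_ | _)
    · simp [hg, Taft.comul_gen, Taft.comulGen, F.comul_g]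
    · simp [hx, hg, Taft.comul_gen, Taft.comulGen, F.comul_z]

variable [NeZero n] (hξ : IsPrimitiveRoot ξ n) [(twistorIdeal π).IsHopfIdeal k]
  {θ : Taft k n ξ →ₐc[k] Twistor π}
  (hg : θ (Taft.gen k n ξ Gen.g) = Ideal.Quotient.mk (twistorIdeal π) g)
  (hx : θ (Taft.gen k n ξ Gen.x) = Ideal.Quotient.mk (twistorIdeal π) z)

include hx

/-- A classical element maps to a scalar, and preservation of the counit identifies that scalar as 0
on the augmentation. -/
theorem map_eq_zero_of_mem_twistorIdeal {a : Taft k n ξ}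
    (ha : a ∈ twistorIdeal (taftChar n hξ)) : θ a = 0 := by
  have h1 : twistorIdeal (taftChar n hξ) ≤ RingHom.ker (θ : Taft k n ξ →ₐ[k] Twistor π) := by
    refine Ideal.span_le.2 ?_
    rintro _ ⟨c, hc, b, rfl⟩
    have hx' : (θ : Taft k n ξ →ₐ[k] Twistor π) (Taft.gen k n ξ Gen.x) ^ n = 0 := by
      rw [← F.mk_z_pow, ← hx]
      rfl
    obtain ⟨r, hr⟩ := Taft.exists_map_classical_eq_smul hξ _ F.cast_ne hx' hc.2
    have hr0 : r = 0 := by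
      have h2 := congrArg (Coalgebra.counit (R := k)) hr
      have h3 : Coalgebra.counit (R := k) (θ c) = Coalgebra.counit (R := k) c := by simp
      rw [map_smul, Bialgebra.counit_one, smul_eq_mul, mul_one] at h2
      rw [← h2]
      exact h3.trans (mem_classicalAugmentation.1 hc).1
    rw [SetLike.mem_coe, RingHom.mem_ker, map_mul, hr, hr0, zero_smul, zero_mul]
  exact h1 ha

/-- The map induced on the twistor of the Taft algebra. -/
def twistorMap : Twistor (taftChar n hξ) →ₐ[k] Twistor π :=
  Ideal.Quotient.liftₐ (twistorIdeal (taftChar n hξ)) (θ : Taft k n ξ →ₐ[k] Twistor π)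
    fun _ ha => F.map_eq_zero_of_mem_twistorIdeal hξ hx ha

theorem twistorMap_mk (a : Taft k n ξ) :
    F.twistorMap hξ hx (Ideal.Quotient.mk (twistorIdeal (taftChar n hξ)) a) = θ a := rfl

include hg

theorem bijective_twistorMap : Function.Bijective (F.twistorMap hξ hx) := by
  refine F.bijective_of_generators
    (a := Ideal.Quotient.mk (twistorIdeal (taftChar n hξ)) (Taft.gen k n ξ Gen.g))
    (b := Ideal.Quotient.mk (twistorIdeal (taftChar n hξ)) (Taft.gen k n ξ Gen.x))
    ?_ ?_ ?_ ?_ _ hg hx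
  · rw [← map_mul, Taft.x_mul_g, ← map_mul]
    exact map_smul (Ideal.Quotient.mkₐ k (twistorIdeal (taftChar n hξ))) _ _
  · have h1 := congrArg (Subalgebra.map (Ideal.Quotient.mkₐ k (twistorIdeal (taftChar n hξ))))
      (Taft.adjoin_gen (k := k) (n := n) (ξ := ξ))
    rw [AlgHom.map_adjoin, Set.image_pair, Algebra.map_top,
      (AlgHom.range_eq_top _).2 (Ideal.Quotient.mkₐ_surjective k _)] at h1
    exact h1
  · rw [← map_pow, Taft.g_pow, map_one]
  · rw [← map_pow, Ideal.Quotient.eq_zero_iff_mem]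
    exact Taft.x_pow_mem_twistorIdeal hξ

/-- Injectivity of the induced map makes the ideal exactly the kernel of the bialgebra map θ. -/
theorem taft_isHopfIdeal : (twistorIdeal (taftChar n hξ)).IsHopfIdeal k := by
  refine isHopfIdeal_of_mem_iff θ _ fun a =>
    ⟨F.map_eq_zero_of_mem_twistorIdeal hξ hx, fun ha => ?_⟩
  rw [← Ideal.Quotient.eq_zero_iff_mem]
  refine (F.bijective_twistorMap hξ hg hx).1 ?_
  rw [twistorMap_mk, ha, map_zero]

theorem exists_twistorEquiv [(twistorIdeal (taftChar n hξ)).IsHopfIdeal k] :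
    ∃ φ : Twistor π ≃ₐc[k] Twistor (taftChar n hξ),
      φ (Ideal.Quotient.mk (twistorIdeal π) g) =
        Ideal.Quotient.mk (twistorIdeal (taftChar n hξ)) (Taft.gen k n ξ Gen.g) ∧
      φ (Ideal.Quotient.mk (twistorIdeal π) z) =
        Ideal.Quotient.mk (twistorIdeal (taftChar n hξ)) (Taft.gen k n ξ Gen.x) := by
  let Θ : Twistor (taftChar n hξ) →ₐc[k] Twistor π :=
    BialgHom.ofAlgHom (F.twistorMap hξ hx)
      (by
        refine Ideal.Quotient.algHom_ext k (AlgHom.ext fun a => ?_)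
        have h3 : Coalgebra.counit (R := k) (θ a) = Coalgebra.counit (R := k) a := by simp
        exact h3)
      (by
        refine Ideal.Quotient.algHom_ext k (AlgHom.ext fun a => ?_)
        have h3 := CoalgHomClass.map_comp_comul_apply θ a
        refine Eq.trans ?_ h3
        change TensorProduct.map _ _ (TensorProduct.map _ _ (Coalgebra.comul (R := k) a)) = _
        rw [← LinearMap.comp_apply, ← TensorProduct.map_comp]
        rfl)
  let Φ := BialgEquiv.ofBijective Θ (F.bijective_twistorMap hξ hg hx)
  refine ⟨Φ.symm, ?_, ?_⟩
  · rw [← hg]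
    exact Φ.symm_apply_apply (Ideal.Quotient.mk _ (Taft.gen k n ξ Gen.g))
  · rw [← hx]
    exact Φ.symm_apply_apply (Ideal.Quotient.mk _ (Taft.gen k n ξ Gen.x))

end TaftFrame

/-! ### Assembly -/

theorem exists_taftFrame {k : Type v} {H : Type u} [Field k] [IsAlgClosed k] [Ring H]
    [HopfAlgebra k H] (π : H →ₐ[k] k) (n : ℕ) [NeZero n] (hH : StandingHypotheses π n)
    (hcard : 1 < Nat.card (lWindGroup π)) (hinf : lWindGroup π ⊓ rWindGroup π = ⊥) :
    ∃ ζ h u ξ t f z g, TaftFrame π ζ n h u ξ t f z g := by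
  obtain ⟨ζ, h, u, F⟩ := exists_uniformizedFrame π n hH hcard hinf
  obtain ⟨ξ, hξ, hcomm⟩ := F.exists_commutation
  have F' : ColorFrame π ζ n h u ξ := ⟨F, hξ, hcomm⟩
  obtain ⟨t, f, G⟩ := F'.exists_skewFrame (F'.isPrimitiveRoot hH.piDegree)
  obtain ⟨z, hz, hz1⟩ := G.exists_integral
  exact ⟨ζ, h, u, ξ, t, f, z, _, G.taftFrame hz hz1⟩

end TwistorPaper
end

open TwistorPaper
theorem theorem6p6 {k : Type v} {H : Type u} [Field k] [IsAlgClosed k] [Ring H]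
    [HopfAlgebra k H] (π : H →ₐ[k] k) (n : ℕ) [NeZero n]
    (hH : StandingHypotheses π n)
    (hcard : 1 < Nat.card (lWindGroup π))
    (hinf : lWindGroup π ⊓ rWindGroup π = ⊥) :
    (twistorIdeal π).restrictScalars k = classicalAugmentation π * ⊤ ∧
    ∃ (_ : (twistorIdeal π).IsHopfIdeal k) (ξ : k) (hξ : IsPrimitiveRoot ξ n)
      (_ : (twistorIdeal (taftChar n hξ)).IsHopfIdeal k)
      (φ : Twistor π ≃ₐc[k] Twistor (taftChar n hξ)) (g y : Twistor (taftChar n hξ)),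
      g = Ideal.Quotient.mk _ (Taft.gen k n ξ Gen.g) ∧
      y = Ideal.Quotient.mk _ (Taft.gen k n ξ Gen.x) ∧
      (∃ ψ : SmallTaft k n ξ ≃ₐ[k] Twistor (taftChar n hξ),
        ψ (SmallTaft.gen k n ξ Gen.g) = g ∧ ψ (SmallTaft.gen k n ξ Gen.x) = y) ∧
      IsGroupLikeElem k g ∧
      Coalgebra.comul (R := k) y = y ⊗ₜ[k] g + 1 ⊗ₜ[k] y ∧
      ∃ (ζ : k) (u : Fin n → Fin n → H) (v : Module.Basis (Fin n × Fin n) k (Twistor π)),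
        IsPrimitiveRoot ζ n ∧
        IsBigradedGenerators π ζ u ∧
        (∀ i j, v (i, j) = Ideal.Quotient.mk _ (u i j)) ∧
        ∀ i j, φ (v (i, j)) =
          if i ≤ j then g ^ (i : ℕ) * y ^ ((j : ℕ) - i) else g ^ (i : ℕ) * y ^ (n + j - i) := by
  obtain ⟨ζ, h, u, ξ, t, f, z, g, F⟩ := exists_taftFrame π n hH hcard hinf
  have hI := F.isHopfIdeal
  obtain ⟨θ, hθg, hθx⟩ := F.exists_bialgHom
  have hJ := F.taft_isHopfIdeal F.xi_prim hθg hθx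
  obtain ⟨φ, hφg, hφz⟩ := F.exists_twistorEquiv F.xi_prim hθg hθx
  refine ⟨twistorIdeal_eq_mul F.classicalAugmentation_central, hI, ξ, F.xi_prim, hJ, φ, _, _, rfl,
    rfl, ?_, ⟨?_, ?_⟩, ?_, ζ, _, F.twistorBasis, F.prim, F.isBigradedGenerators,
    F.twistorBasis_apply, fun i j => ?_⟩
  -- The presented algebra is compared with the twistor of `H`, where a basis is known, and then
  -- carried over by φ.
  · obtain ⟨ψ, hψg, hψx⟩ := SmallTaft.exists_lift F.mk_g_pow F.mk_z_pow F.mk_z_mul_g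
    have hψ := F.bijective_of_generators SmallTaft.x_mul_g SmallTaft.adjoin_gen SmallTaft.g_pow
      SmallTaft.x_pow ψ hψg hψx
    refine ⟨(AlgEquiv.ofBijective ψ hψ).trans (φ : Twistor π ≃ₐ[k] _), ?_, ?_⟩
    · rw [← hφg, ← hψg]
      rfl
    · rw [← hφz, ← hψx]
      rfl
  · rw [Bialgebra.Quotient.counit_mk, Taft.counit_gen]
    rfl
  · rw [Bialgebra.Quotient.comul_mk, Taft.comul_gen]
    rfl
  · rw [Bialgebra.Quotient.comul_mk, Taft.comul_gen, Taft.comulGen, map_add]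
    rfl
  · rw [F.twistorBasis_apply, map_mul, map_mul, map_pow, map_pow, map_pow, map_pow, hφg, hφz]
    simp only [monomialExp, Fin.val_fin_le]
    split_ifs <;> rfl
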